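/- **Theorem 1.1.** Let $N\ge 2$ and let $d\gamma_N=(2\pi)^{-N/2}e^{-|x|^2/2}\,dx$ be the standard Gaussian measure on $\mathbb R^N$. For a domain $\Omega\subset\mathbb R^N$ let $H^1(\Omega,d\gamma_N)$ be the space of all $u\in W^{1,1}_{\rm loc}(\Omega)$ such that $u$ and $|Du|$ belong to $L^2(\Omega,d\gamma_N)$. A number $\mu\in\mathbb R$ is a nontrivial Neumann eigenvalue of the Hermite (Ornstein–Uhlenbeck) operator in $\Omega$ if there is a non-constant (that is, not almost everywhere constant) $u\in H^1(\Omega,d\gamma_N)$ that solves $$-\mathrm{div}\bigl(e^{-|x|^2/2}Du\bigr)=\mu\, e^{-|x|^2/2}u\ \text{ in }\Omega,\qquad \frac{\partial u}{\partial\nu}=0\ \text{ on }\partial\Omega$$ in the weak sense, i.e. $\int_\Omega Du\cdot D\varphi\,d\gamma_N=\mu\int_\Omega u\varphi\,d\gamma_N$ for all $\varphi\in H^1(\Omega,d\gamma_N)$; $\mu_1(\Omega)$ denotes the smallest such $\mu$. (a) Let $\Omega\subset\mathbb R^N$ be a convex $C^2$ domain, possibly unbounded, that satisfies a uniform interior sphere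 condition: there is $\bar r>0$ such that for every $x\in\partial\Omega$ there is an open ball $B\subset\Omega$ of radius $\bar r$ with $\overline B\cap\partial\Omega=\{x\}$. Then $\mu_1(\Omega)$ exists, $$\mu_1(\Omega)=\min\left\{\frac{\int_\Omega|D\psi|^2\,d\gamma_N}{\int_\Omega\psi^2\,d\gamma_N}:\ \psi\in H^1(\Omega,d\gamma_N)\setminus\{0\},\ \int_\Omega\psi\,d\gamma_N=0\right\},$$ and $$\mu_1(\Omega)\ge 1.$$ Equivalently, the Poincaré–Wirtinger inequality $$\int_\Omega\Bigl(u-\frac1{\gamma_N(\Omega)}\int_\Omega u\,d\gamma_N\Bigr)^2d\gamma_N\le\int_\Omega|Du|^2\,d\gamma_N$$ holds for every $u\in H^1(\Omega,d\gamma_N)$. (b) Equality $\mu_1(\Omega)=1$ holds for every $N$-dimensional strip $\Omega=\{x\in\mathbb R^N:\ a<\langle e,x\rangle<b\}$, where $e\in\mathbb R^N$, $|e|=1$ and $-\infty<a<b<+\infty$. -/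

import Mathlib

open MeasureTheory Filter Topology Set
open scoped ContDiff RealInnerProductSpace

noncomputable section

namespace GaussNeumann

/-- The standard Gaussian measure `(2π)^(-N/2) exp (-|x|²/2) dx` on `ℝ^N`. -/
def gauss (N : ℕ) : Measure (EuclideanSpace ℝ (Fin N)) :=
  volume.withDensity fun x =>
    ENNReal.ofReal ((1 / (2 * Real.pi) ^ ((N : ℝ) / 2)) * Real.exp (-‖x‖ ^ 2 / 2))

/-- `Ω` is a `C²` domain: open, nonempty, connected, and near each boundary point `p` it is, for some
unit vector `ν`, the strict epigraph in direction `ν` of a `C²` function of the component of the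
point orthogonal to `ν`. -/
structure IsC2Domain {N : ℕ} (Ω : Set (EuclideanSpace ℝ (Fin N))) : Prop where
  isOpen : IsOpen Ω
  isConnected : IsConnected Ω
  boundary : ∀ p ∈ frontier Ω, ∃ r > 0, ∃ ν : EuclideanSpace ℝ (Fin N), ‖ν‖ = 1 ∧
    ∃ g : EuclideanSpace ℝ (Fin N) → ℝ, ContDiff ℝ 2 g ∧
      ∀ y ∈ Metric.ball p r, (y ∈ Ω ↔ g (y - ⟪ν, y⟫ • ν) < ⟪ν, y⟫)

/-- Uniform interior sphere condition: one radius `r > 0` such that every boundary point `p` is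
the only boundary point on the closure of some ball of radius `r` contained in `Ω`. -/
def UniformInteriorSphere {N : ℕ} (Ω : Set (EuclideanSpace ℝ (Fin N))) : Prop :=
  ∃ r > 0, ∀ p ∈ frontier Ω, ∃ c : EuclideanSpace ℝ (Fin N),
    Metric.ball c r ⊆ Ω ∧ Metric.closedBall c r ∩ frontier Ω = {p}

/-- `u ∈ W^{1,1}_loc(Ω)` with weak gradient `G` (with respect to Lebesgue measure). -/
structure HasWeakGradient {N : ℕ} (Ω : Set (EuclideanSpace ℝ (Fin N)))
    (u : EuclideanSpace ℝ (Fin N) → ℝ)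
    (G : EuclideanSpace ℝ (Fin N) → EuclideanSpace ℝ (Fin N)) : Prop where
  locallyIntegrable : LocallyIntegrableOn u Ω volume
  gradient_locallyIntegrable : LocallyIntegrableOn G Ω volume
  integral_by_parts : ∀ φ : EuclideanSpace ℝ (Fin N) → ℝ, ContDiff ℝ ∞ φ →
    HasCompactSupport φ → tsupport φ ⊆ Ω → ∀ v : EuclideanSpace ℝ (Fin N),
      ∫ x in Ω, u x * fderiv ℝ φ x v = -∫ x in Ω, ⟪G x, v⟫ * φ x

/-- `u ∈ H¹(Ω, dγ_N)`, with weak gradient `G`. -/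
structure MemH1 {N : ℕ} (Ω : Set (EuclideanSpace ℝ (Fin N)))
    (u : EuclideanSpace ℝ (Fin N) → ℝ)
    (G : EuclideanSpace ℝ (Fin N) → EuclideanSpace ℝ (Fin N)) : Prop where
  hasWeakGradient : HasWeakGradient Ω u G
  memLp : MemLp u 2 ((gauss N).restrict Ω)
  gradient_memLp : MemLp G 2 ((gauss N).restrict Ω)

/-- `u ∈ H¹(Ω, dγ_N)`, with weak gradient `G`, is a weak solution of the Neumann problem
`-div (exp (-|x|²/2) Du) = μ exp (-|x|²/2) u` in `Ω`, `∂u/∂ν = 0` on `∂Ω`. -/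
def IsNeumannSolution {N : ℕ} (Ω : Set (EuclideanSpace ℝ (Fin N))) (μ : ℝ)
    (u : EuclideanSpace ℝ (Fin N) → ℝ)
    (G : EuclideanSpace ℝ (Fin N) → EuclideanSpace ℝ (Fin N)) : Prop :=
  MemH1 Ω u G ∧ ∀ φ H, MemH1 Ω φ H →
    ∫ x in Ω, ⟪G x, H x⟫ ∂(gauss N) = μ * ∫ x in Ω, u x * φ x ∂(gauss N)

/-- The nontrivial Neumann eigenvalues of the Hermite operator in `Ω`: those with an eigenfunction
that is not (almost everywhere) constant. -/
def nontrivialNeumannEigenvalues {N : ℕ} (Ω : Set (EuclideanSpace ℝ (Fin N))) : Set ℝ :=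
  {μ | ∃ u G, IsNeumannSolution Ω μ u G ∧
    ¬ ∃ c : ℝ, ∀ᵐ x ∂((gauss N).restrict Ω), u x = c}

/-- The first nontrivial Neumann eigenvalue `μ₁(Ω)`. It is meaningful when the set of nontrivial
eigenvalues has a least element. -/
def mu1 {N : ℕ} (Ω : Set (EuclideanSpace ℝ (Fin N))) : ℝ :=
  sInf (nontrivialNeumannEigenvalues Ω)

/-- The Rayleigh quotients of the nonzero functions in `H¹(Ω, dγ_N)` with zero Gaussian mean. -/
def rayleighQuotients {N : ℕ} (Ω : Set (EuclideanSpace ℝ (Fin N))) : Set ℝ :=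
  {R | ∃ ψ G, MemH1 Ω ψ G ∧ (¬ ∀ᵐ x ∂((gauss N).restrict Ω), ψ x = 0) ∧
    ∫ x in Ω, ψ x ∂(gauss N) = 0 ∧
    R = (∫ x in Ω, ‖G x‖ ^ 2 ∂(gauss N)) / ∫ x in Ω, ψ x ^ 2 ∂(gauss N)}

/-- The strip `a < ⟨e, x⟩ < b` in `ℝ^N`. -/
def strip {N : ℕ} (e : EuclideanSpace ℝ (Fin N)) (a b : ℝ) : Set (EuclideanSpace ℝ (Fin N)) :=
  {x | a < ⟪e, x⟫ ∧ ⟪e, x⟫ < b}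

end GaussNeumann

end

/-!
Everything rests on one sharp inequality: for a Gaussian weight of precision `k`, restricted to any
convex set, the Poincaré inequality holds with constant `1 / k`. It follows from the
Prékopa-Leindler inequality, which is needed at midpoints only. The weight gains a factor
`exp (k / 4 * ‖x - y‖ ^ 2)` at the midpoint of `x` and `y`, so `(∫ exp F) (∫ exp G) ≤ (∫ 1) ^ 2`
whenever `F x + G y ≤ k / 4 * ‖x - y‖ ^ 2`; taking `F` and `G` to be opposite small multiples of a
smooth function `g`, corrected at second order by `‖∇g‖ ^ 2`, and comparing the terms of second order
gives the Poincaré inequality for `g` (`poincare_smooth`). No regularity of the boundary is involved.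
Mollification on compact subsets and an exhaustion by shrunken copies of the domain extend it to all
functions with square integrable weak gradient (`HasWeakGradient.poincare`). For `k = 1` this is the
Poincaré-Wirtinger inequality, and so the lower bound `1` for all Rayleigh quotients.

That the minimum of the Rayleigh quotient is attained needs the embedding of `H¹` into `L²` to be
compact. No extension theorem or Rellich theorem is used: far from a point of the domain the mass is
controlled because the flux of `u² e ^ (-|x|² / 2)` through the boundary of a star-shaped set is
nonnegative (`HasWeakGradient.tail_estimate`); near it the domain is cut by a fine grid into convex
cells, on each of which the same Poincaré inequality, now with precision `1 / δ²`, bounds the `L²`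
norm by `δ²` times the gradient and one linear functional (`MemH1.cell_estimate`). Together they say
that, modulo finitely many functionals, the `L²` norm is an arbitrarily small multiple of the `H¹`
norm (`MemH1.compactness`). A minimizing sequence then converges along an ultrafilter
(`exists_rayleigh_minimizer`), and its limit is an eigenfunction (`exists_isLeast_eigenvalue`).

On a strip orthogonal to `e` the linear function `x ↦ ⟪f, x⟫` with `f ≠ 0` orthogonal to `e` is an
eigenfunction with eigenvalue `1`: it satisfies the Neumann condition because its gradient is
tangential to the boundary (`MemH1.integral_inner_eq_of_strip`).
-/

namespace GaussNeumann

/-! ### The midpoint Prékopa-Leindler inequality -/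

section

open scoped Pointwise

/-- One-dimensional Brunn-Minkowski inequality for midpoints. For compact `A`, `B` the translates
`min B + A` and `max A + B` meet in at most one point and both lie in `2 • C`. -/
theorem volume_add_volume_le_two_mul_of_midpoint {A B C : Set ℝ} (hA : MeasurableSet A)
    (hB : MeasurableSet B) (hA0 : A.Nonempty) (hB0 : B.Nonempty)
    (h : ∀ x ∈ A, ∀ y ∈ B, (x + y) / 2 ∈ C) : volume A + volume B ≤ 2 * volume C := by
  -- reduce to compact sets
  have key : ∀ K ⊆ A, IsCompact K → K.Nonempty → ∀ L ⊆ B, IsCompact L → L.Nonempty →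
      volume K + volume L ≤ 2 * volume C := by
    intro K hKA hK hK0 L hLB hL hL0
    obtain ⟨a, haK, ha⟩ := hK.exists_isGreatest hK0
    obtain ⟨b, hbL, hb⟩ := hL.exists_isLeast hL0
    have h1 : volume ((fun x => b + x) '' K) = volume K := by
      rw [Set.image_add_left, measure_preimage_add]
    have h2 : volume ((fun x => a + x) '' L) = volume L := by
      rw [Set.image_add_left, measure_preimage_add]
    have hKm : MeasurableSet ((fun x => b + x) '' K) :=
      (hK.image (by fun_prop)).measurableSet
    have hd : AEDisjoint volume ((fun x => b + x) '' K) ((fun x => a + x) '' L) := by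
      refine measure_mono_null (t := {a + b}) ?_ (by simp)
      rintro _ ⟨⟨x, hx, rfl⟩, ⟨y, hy, hxy⟩⟩
      have := ha hx
      have := hb hy
      simp only [mem_singleton_iff] at *
      linarith
    rw [← h1, ← h2, ← measure_union₀' hKm.nullMeasurableSet hd]
    have hsub : ((fun x => b + x) '' K) ∪ ((fun x => a + x) '' L) ⊆ (2 : ℝ) • C := by
      rintro _ (⟨x, hx, rfl⟩ | ⟨y, hy, rfl⟩)
      · exact ⟨(x + b) / 2, h x (hKA hx) b (hLB hbL), by simp; ring⟩
      · exact ⟨(a + y) / 2, h a (hKA haK) y (hLB hy), by simp; ring⟩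
    refine (measure_mono hsub).trans ?_
    rw [Measure.addHaar_smul]
    simp
  have approx : ∀ S : Set ℝ, MeasurableSet S → S.Nonempty → ∀ r < volume S,
      ∃ K ⊆ S, IsCompact K ∧ K.Nonempty ∧ r < volume K := by
    intro S hS _ r hr
    obtain ⟨K, hKS, hK, hrK⟩ := hS.exists_lt_isCompact hr
    refine ⟨K, hKS, hK, ?_, hrK⟩
    by_contra hne
    rw [Set.not_nonempty_iff_eq_empty] at hne
    simp [hne] at hrK
  obtain ⟨a, ha⟩ := hA0
  obtain ⟨b, hb⟩ := hB0
  have stepA : ∀ L ⊆ B, IsCompact L → L.Nonempty → volume A + volume L ≤ 2 * volume C := by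
    intro L hL1 hL2 hL3
    rcases eq_or_ne (volume A) 0 with h0 | h0
    · have := key {a} (by simpa using ha) isCompact_singleton (by simp) L hL1 hL2 hL3
      simpa [h0] using this
    · refine le_of_forall_lt fun r hr => ?_
      rcases lt_or_ge r (volume L) with h | h
      · obtain ⟨K, hK, hKc, hK0, _⟩ := approx A hA ⟨a, ha⟩ 0 (pos_iff_ne_zero.2 h0)
        exact h.trans_le ((le_add_self).trans (key K hK hKc hK0 L hL1 hL2 hL3))
      · have hL' : volume L ≠ ⊤ := hL2.measure_lt_top.ne
        have : r - volume L < volume A := by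
          exact ENNReal.sub_lt_of_lt_add h (by simpa [add_comm] using hr)
        obtain ⟨K, hK, hKc, hK0, hrK⟩ := approx A hA ⟨a, ha⟩ _ this
        have h3 : r < volume K + volume L := by
          rw [← tsub_add_cancel_of_le h]
          exact ENNReal.add_lt_add_right hL' hrK
        exact h3.trans_le (key K hK hKc hK0 L hL1 hL2 hL3)
  rcases eq_or_ne (volume B) 0 with h0 | h0
  · have := stepA {b} (by simpa using hb) isCompact_singleton (by simp)
    simpa [h0] using this
  rcases eq_or_ne (volume A) ⊤ with hT | hT
  · have := stepA {b} (by simpa using hb) isCompact_singleton (by simp)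
    simp only [hT, top_add, top_le_iff] at this
    simp [this]
  refine le_of_forall_lt fun r hr => ?_
  rcases lt_or_ge r (volume A) with h | h
  · obtain ⟨K, hK, hKc, hK0, _⟩ := approx B hB ⟨b, hb⟩ 0 (pos_iff_ne_zero.2 h0)
    exact h.trans_le ((le_self_add).trans (stepA K hK hKc hK0))
  · have : r - volume A < volume B := ENNReal.sub_lt_of_lt_add h (by simpa [add_comm] using hr)
    obtain ⟨K, hK, hKc, hK0, hrK⟩ := approx B hB ⟨b, hb⟩ _ this
    have h3 : r < volume A + volume K := by
      rw [← add_tsub_cancel_of_le h]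
      exact ENNReal.add_lt_add_left hT hrK
    exact h3.trans_le (stepA K hK hKc hK0)

/-- One-dimensional Prékopa-Leindler inequality, additive form, for functions with
supremum one: Brunn-Minkowski for the superlevel sets, integrated with the layer cake formula. The
supremum condition makes all superlevel sets of level below one nonempty. -/
theorem lintegral_add_lintegral_le_of_midpoint {f g h : ℝ → ℝ} (hf : Measurable f)
    (hg : Measurable g) (hh : Measurable h) (hf0 : ∀ x, 0 ≤ f x) (hg0 : ∀ x, 0 ≤ g x)
    (hh0 : ∀ x, 0 ≤ h x) (hf1 : ∀ x, f x ≤ 1) (hg1 : ∀ x, g x ≤ 1)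
    (hfs : ∀ t < 1, ∃ x, t < f x) (hgs : ∀ t < 1, ∃ x, t < g x)
    (H : ∀ x y, f x * g y ≤ h ((x + y) / 2) ^ 2) :
    (∫⁻ x, ENNReal.ofReal (f x)) + ∫⁻ x, ENNReal.ofReal (g x) ≤
      2 * ∫⁻ x, ENNReal.ofReal (h x) := by
  rw [lintegral_eq_lintegral_meas_lt volume (ae_of_all _ hf0) hf.aemeasurable,
    lintegral_eq_lintegral_meas_lt volume (ae_of_all _ hg0) hg.aemeasurable,
    lintegral_eq_lintegral_meas_lt volume (ae_of_all _ hh0) hh.aemeasurable]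
  have hmf : Measurable fun t : ℝ => volume {a | t < f a} :=
    Antitone.measurable fun s t hst => measure_mono fun a (ha : t < f a) => hst.trans_lt ha
  have hmh : Measurable fun t : ℝ => volume {a | t < h a} :=
    Antitone.measurable fun s t hst => measure_mono fun a (ha : t < h a) => hst.trans_lt ha
  rw [← lintegral_add_left hmf, ← lintegral_const_mul _ hmh]
  refine lintegral_mono_ae ?_
  filter_upwards [ae_restrict_mem measurableSet_Ioi] with t (ht : 0 < t)
  rcases lt_or_ge t 1 with ht1 | ht1
  · refine volume_add_volume_le_two_mul_of_midpoint (measurableSet_lt measurable_const hf)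
      (measurableSet_lt measurable_const hg) (hfs t ht1) (hgs t ht1) ?_
    intro x (hx : t < f x) y (hy : t < g y)
    have h1 : t ^ 2 < h ((x + y) / 2) ^ 2 := by
      refine lt_of_lt_of_le ?_ (H x y)
      nlinarith
    exact lt_of_pow_lt_pow_left₀ 2 (hh0 _) h1
  · have e1 : {a | t < f a} = ∅ := by
      ext a; simpa using (hf1 a).trans ht1
    have e2 : {a | t < g a} = ∅ := by
      ext a; simpa using (hg1 a).trans ht1
    simp [e1, e2]

/-- The midpoint case of the Prékopa-Leindler inequality holds on the measure space `E`. It is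
squared, so that no square roots occur, and is stated for `[0, ∞]`-valued functions, so that
integrability plays no role. -/
def PrekopaLeindler (E : Type*) [AddCommGroup E] [Module ℝ E] [MeasureSpace E] : Prop :=
  ∀ f g h : E → ENNReal, Measurable f → Measurable g → Measurable h →
    (∀ x y, f x * g y ≤ h ((1 / 2 : ℝ) • (x + y)) ^ 2) →
    (∫⁻ x, f x) * ∫⁻ x, g x ≤ (∫⁻ x, h x) ^ 2

/-- The bounded case follows from the additive form, after division by the suprema, by the
arithmetic-geometric mean inequality. -/
theorem prekopaLeindler_real_of_le {f g h : ℝ → ENNReal} (hf : Measurable f)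
    (hg : Measurable g) (hh : Measurable h)
    (H : ∀ x y, f x * g y ≤ h ((1 / 2 : ℝ) • (x + y)) ^ 2) (n : ENNReal) (hn : n ≠ ⊤)
    (hfn : ∀ x, f x ≤ n) (hgn : ∀ x, g x ≤ n) :
    (∫⁻ x, f x) * ∫⁻ x, g x ≤ (∫⁻ x, h x) ^ 2 := by
  set a := ⨆ x, f x with ha
  set b := ⨆ x, g x with hb
  have hfa : ∀ x, f x ≤ a := le_iSup f
  have hgb : ∀ x, g x ≤ b := le_iSup g
  have haT : a ≠ ⊤ := ((iSup_le hfn).trans_lt hn.lt_top).ne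
  have hbT : b ≠ ⊤ := ((iSup_le hgn).trans_lt hn.lt_top).ne
  rcases eq_or_ne a 0 with h0 | ha0
  · have : f = 0 := by ext x; simpa [h0] using hfa x
    simp [this]
  rcases eq_or_ne b 0 with h0 | hb0
  · have : g = 0 := by ext x; simpa [h0] using hgb x
    simp [this]
  set c : ENNReal := (a * b) ^ (1 / 2 : ℝ) with hc
  have habT : a * b ≠ ⊤ := ENNReal.mul_ne_top haT hbT
  have hcc : c ^ 2 = a * b := by
    rw [hc, ← ENNReal.rpow_natCast, ← ENNReal.rpow_mul]; norm_num
  have hc0 : c ≠ 0 := by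
    intro h; rw [h] at hcc; simp [ha0, hb0, eq_comm] at hcc
  have hcT : c ≠ ⊤ := by
    intro h; rw [h] at hcc; simp [eq_comm, habT] at hcc
  have hF1 : ∀ x, f x / a ≤ 1 := fun x => ENNReal.div_le_of_le_mul (by simpa using hfa x)
  have hG1 : ∀ x, g x / b ≤ 1 := fun x => ENNReal.div_le_of_le_mul (by simpa using hgb x)
  have hFT : ∀ x, f x / a ≠ ⊤ := fun x => ((hF1 x).trans_lt ENNReal.one_lt_top).ne
  have hGT : ∀ x, g x / b ≠ ⊤ := fun x => ((hG1 x).trans_lt ENNReal.one_lt_top).ne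
  have hHT : ∀ x, min (h x / c) 1 ≠ ⊤ := fun x =>
    ((min_le_right _ _).trans_lt ENNReal.one_lt_top).ne
  have hsup : ∀ (φ : ℝ → ENNReal) (m : ENNReal), m = ⨆ x, φ x → m ≠ 0 → m ≠ ⊤ →
      ∀ t < (1 : ℝ), ∃ x, t < (φ x / m).toReal := by
    intro φ m hm hm0 hmT t ht
    rcases lt_or_ge t 0 with h | h
    · exact ⟨0, h.trans_le ENNReal.toReal_nonneg⟩
    have h1 : ENNReal.ofReal t * m < m := by
      have : ENNReal.ofReal t < 1 := by simpa using ht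
      calc ENNReal.ofReal t * m < 1 * m := (ENNReal.mul_lt_mul_iff_left hm0 hmT).2 this
        _ = m := one_mul m
    conv_rhs at h1 => rw [hm]
    obtain ⟨x, hx⟩ := lt_iSup_iff.1 h1
    refine ⟨x, ?_⟩
    have hxm : φ x ≤ m := hm ▸ le_iSup φ x
    rw [← ENNReal.ofReal_lt_iff_lt_toReal h (ENNReal.div_ne_top (hxm.trans_lt hmT.lt_top).ne hm0)]
    exact (ENNReal.lt_div_iff_mul_lt (Or.inl hm0) (Or.inl hmT)).2 hx
  have main := lintegral_add_lintegral_le_of_midpoint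
    (f := fun x => (f x / a).toReal) (g := fun x => (g x / b).toReal)
    (h := fun x => (min (h x / c) 1).toReal)
    (by fun_prop) (by fun_prop) (by fun_prop)
    (fun _ => ENNReal.toReal_nonneg) (fun _ => ENNReal.toReal_nonneg)
    (fun _ => ENNReal.toReal_nonneg)
    (fun x => ENNReal.toReal_le_of_le_ofReal zero_le_one (by simpa using hF1 x))
    (fun x => ENNReal.toReal_le_of_le_ofReal zero_le_one (by simpa using hG1 x))
    (hsup f a ha ha0 haT) (hsup g b hb hb0 hbT) (by
      intro x y
      rw [← ENNReal.toReal_mul, ← ENNReal.toReal_pow]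
      refine ENNReal.toReal_mono (ENNReal.pow_ne_top (hHT _)) ?_
      have hxy : (x + y) / 2 = (1 / 2 : ℝ) • (x + y) := by simp; ring
      rw [hxy]
      rcases le_total (h ((1 / 2 : ℝ) • (x + y)) / c) 1 with h1 | h1
      · rw [min_eq_left h1, ENNReal.div_eq_inv_mul, ENNReal.div_eq_inv_mul,
          ENNReal.div_eq_inv_mul, mul_pow, ← ENNReal.inv_pow, hcc,
          ENNReal.mul_inv (Or.inl ha0) (Or.inl haT)]
        calc a⁻¹ * f x * (b⁻¹ * g y) = a⁻¹ * b⁻¹ * (f x * g y) := by ring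
          _ ≤ _ := by gcongr; exact H x y
      · rw [min_eq_right h1]
        calc _ ≤ (1 : ENNReal) * 1 := mul_le_mul' (hF1 x) (hG1 y)
          _ = 1 ^ 2 := by norm_num)
  simp only [ENNReal.ofReal_toReal (hFT _), ENNReal.ofReal_toReal (hGT _),
    ENNReal.ofReal_toReal (hHT _)] at main
  have hf' : ∫⁻ x, f x = a * ∫⁻ x, f x / a := by
    rw [← lintegral_const_mul _ (by fun_prop)]
    exact lintegral_congr fun x => (ENNReal.mul_div_cancel ha0 haT).symm
  have hg' : ∫⁻ x, g x = b * ∫⁻ x, g x / b := by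
    rw [← lintegral_const_mul _ (by fun_prop)]
    exact lintegral_congr fun x => (ENNReal.mul_div_cancel hb0 hbT).symm
  have hh' : c * ∫⁻ x, min (h x / c) 1 ≤ ∫⁻ x, h x := by
    rw [← lintegral_const_mul _ (by fun_prop)]
    refine lintegral_mono fun x => ?_
    calc c * min (h x / c) 1 ≤ c * (h x / c) := by gcongr; exact min_le_left _ _
      _ = h x := ENNReal.mul_div_cancel hc0 hcT
  set I := ∫⁻ x, f x / a
  set J := ∫⁻ x, g x / b
  set K := ∫⁻ x, min (h x / c) 1
  have h4 : 4 * (I * J) ≤ 4 * K ^ 2 := by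
    calc 4 * (I * J) = 4 * I * J := by ring
      _ ≤ (I + J) ^ 2 := by
        rcases le_total I J with h | h
        · obtain ⟨d, hd⟩ := exists_add_of_le h
          rw [hd]
          calc 4 * I * (I + d) ≤ 4 * I * (I + d) + d ^ 2 := le_self_add
            _ = _ := by ring
        · obtain ⟨d, hd⟩ := exists_add_of_le h
          rw [hd]
          calc 4 * (J + d) * J ≤ 4 * (J + d) * J + d ^ 2 := le_self_add
            _ = _ := by ring
      _ ≤ (2 * K) ^ 2 := by gcongr
      _ = 4 * K ^ 2 := by ring
  have h5 : I * J ≤ K ^ 2 :=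
    (ENNReal.mul_le_mul_iff_right (a := 4) (by norm_num) (by norm_num)).1 h4
  calc (∫⁻ x, f x) * ∫⁻ x, g x = (a * b) * (I * J) := by rw [hf', hg']; ring
    _ ≤ c ^ 2 * K ^ 2 := by rw [hcc]; gcongr
    _ = (c * K) ^ 2 := by ring
    _ ≤ _ := by gcongr

theorem prekopaLeindler_real : PrekopaLeindler ℝ := by
  intro f g h hf hg hh H
  -- truncate `f` and `g` at height `n`
  have key : ∀ n : ℕ, (∫⁻ x, min (f x) n) * ∫⁻ x, min (g x) n ≤ (∫⁻ x, h x) ^ 2 := fun n =>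
    prekopaLeindler_real_of_le (by fun_prop) (by fun_prop) hh
      (fun x y => (mul_le_mul' (min_le_left _ _) (min_le_left _ _)).trans (H x y)) n
      (ENNReal.natCast_ne_top n) (fun _ => min_le_right _ _) (fun _ => min_le_right _ _)
  have lim : ∀ φ : ℝ → ENNReal, Measurable φ →
      ∫⁻ x, φ x = ⨆ n : ℕ, ∫⁻ x, min (φ x) n := by
    intro φ hφ
    rw [← lintegral_iSup (f := fun (n : ℕ) x => min (φ x) n) (fun n => by fun_prop)
      (fun m n hmn x => min_le_min_left _ (by exact_mod_cast hmn))]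
    refine lintegral_congr fun x => ?_
    rw [← inf_iSup_eq, ENNReal.iSup_natCast, inf_top_eq]
  have mono : ∀ φ : ℝ → ENNReal, Monotone fun n : ℕ => ∫⁻ x, min (φ x) n := fun φ m n hmn =>
    lintegral_mono fun x => min_le_min_left _ (by exact_mod_cast hmn)
  rw [lim f hf, lim g hg]
  simp only [ENNReal.iSup_mul, ENNReal.mul_iSup]
  refine iSup_le fun i => iSup_le fun j => ?_
  exact (mul_le_mul' (mono f (le_max_right i j)) (mono g (le_max_left i j))).trans (key _)

/-- The Prékopa-Leindler inequality tensorises: apply it on the fibres, then to the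
marginals. -/
theorem PrekopaLeindler.prod {E F : Type*} [AddCommGroup E] [Module ℝ E] [MeasureSpace E]
    [AddCommGroup F] [Module ℝ F] [MeasureSpace F] [SFinite (volume : Measure E)]
    [SFinite (volume : Measure F)]
    (hE : PrekopaLeindler E) (hF : PrekopaLeindler F) : PrekopaLeindler (E × F) := by
  intro f g h hf hg hh H
  simp only [Measure.volume_eq_prod]
  rw [lintegral_prod _ hf.aemeasurable, lintegral_prod _ hg.aemeasurable,
    lintegral_prod _ hh.aemeasurable]
  refine hE _ _ _ hf.lintegral_prod_right' hg.lintegral_prod_right' hh.lintegral_prod_right' ?_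
  intro x y
  refine hF _ _ _ (by fun_prop) (by fun_prop) (by fun_prop) fun z w => ?_
  simpa using H (x, z) (y, w)

theorem PrekopaLeindler.of_measurePreserving {E F : Type*} [AddCommGroup E] [Module ℝ E]
    [MeasureSpace E] [AddCommGroup F] [Module ℝ F] [MeasureSpace F] (hE : PrekopaLeindler E)
    (e : E ≃ᵐ F) (he : MeasurePreserving e)
    (hlin : ∀ x y, e ((1 / 2 : ℝ) • (x + y)) = (1 / 2 : ℝ) • (e x + e y)) :
    PrekopaLeindler F := by
  intro f g h hf hg hh H
  rw [← he.lintegral_comp hf, ← he.lintegral_comp hg, ← he.lintegral_comp hh]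
  refine hE _ _ _ (hf.comp e.measurable) (hg.comp e.measurable) (hh.comp e.measurable) ?_
  intro x y
  rw [hlin]
  exact H (e x) (e y)

theorem prekopaLeindler_pi (n : ℕ) : PrekopaLeindler (Fin n → ℝ) := by
  induction n with
  | zero =>
    intro f g h _ _ _ H
    rw [volume_pi, Measure.pi_of_empty _ default]
    simp only [lintegral_dirac]
    have := H default default
    rwa [Subsingleton.elim ((1 / 2 : ℝ) • ((default : Fin 0 → ℝ) + default)) default] at this
  | succ n ih =>
    refine (prekopaLeindler_real.prod ih).of_measurePreserving
      (MeasurableEquiv.piFinSuccAbove (fun _ => ℝ) 0).symm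
      (volume_preserving_piFinSuccAbove (fun _ => ℝ) 0).symm ?_
    intro x y
    ext i
    refine Fin.cases ?_ (fun j => ?_) i <;> simp [MeasurableEquiv.piFinSuccAbove] <;> ring

/-- The midpoint Prékopa-Leindler inequality in `ℝ^N`. -/
theorem prekopaLeindler_euclideanSpace (N : ℕ) : PrekopaLeindler (EuclideanSpace ℝ (Fin N)) :=
  (prekopaLeindler_pi N).of_measurePreserving (MeasurableEquiv.toLp 2 (Fin N → ℝ))
    (PiLp.volume_preserving_toLp (Fin N)) fun x y => by simp

end

/-! ### The Poincaré inequality for smooth functions -/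

/-- The unnormalised Gaussian weight of precision `k` centred at `c`. -/
noncomputable def weight {N : ℕ} (k : ℝ) (c x : EuclideanSpace ℝ (Fin N)) : ℝ :=
  Real.exp (-(k / 2) * ‖x - c‖ ^ 2)

theorem weight_pos {N : ℕ} (k : ℝ) (c x : EuclideanSpace ℝ (Fin N)) : 0 < weight k c x :=
  Real.exp_pos _

theorem weight_le_one {N : ℕ} {k : ℝ} (hk : 0 ≤ k) (c x : EuclideanSpace ℝ (Fin N)) :
    weight k c x ≤ 1 := by
  rw [weight, Real.exp_le_one_iff]
  have := sq_nonneg ‖x - c‖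
  nlinarith [mul_nonneg hk this]

@[fun_prop]
theorem contDiff_weight {N : ℕ} {n : WithTop ℕ∞} (k : ℝ) (c : EuclideanSpace ℝ (Fin N)) :
    ContDiff ℝ n (weight k c) := by
  unfold weight
  exact (contDiff_const.mul ((contDiff_id.sub contDiff_const).norm_sq ℝ)).exp

@[fun_prop]
theorem continuous_weight {N : ℕ} (k : ℝ) (c : EuclideanSpace ℝ (Fin N)) :
    Continuous (weight k c) := (contDiff_weight (n := 0) k c).continuous

/-- Quantitative log-concavity of the Gaussian weight, from the parallelogram law. -/
theorem weight_midpoint_sq {N : ℕ} (k : ℝ) (c x y : EuclideanSpace ℝ (Fin N)) :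
    weight k c ((1 / 2 : ℝ) • (x + y)) ^ 2 =
      weight k c x * weight k c y * Real.exp (k / 4 * ‖x - y‖ ^ 2) := by
  have h := parallelogram_law_with_norm ℝ (x - c) (y - c)
  have e1 : (1 / 2 : ℝ) • (x + y) - c = (1 / 2 : ℝ) • ((x - c) + (y - c)) := by module
  have e2 : (x - c) - (y - c) = x - y := by abel
  rw [e2] at h
  rw [weight, weight, weight, ← Real.exp_nat_mul, ← Real.exp_add, ← Real.exp_add, e1, norm_smul]
  congr 1
  have : ‖(1 / 2 : ℝ)‖ = 1 / 2 := by norm_num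
  rw [this]
  push_cast
  linear_combination (-(k / 4)) * h

theorem integrableOn_of_continuous_of_isBounded {N : ℕ} {F : Type*} [NormedAddCommGroup F]
    {f : EuclideanSpace ℝ (Fin N) → F} (hf : Continuous f) {P : Set (EuclideanSpace ℝ (Fin N))}
    (hP : Bornology.IsBounded P) : IntegrableOn f P :=
  (hf.locallyIntegrable.integrableOn_isCompact hP.isCompact_closure).mono_set subset_closure

/-- The Prékopa-Leindler inequality for `exp F · weight`, `exp G · weight` and `weight` on a convex
set: the Gaussian weight is log-concave with room `k / 4 * ‖x - y‖ ^ 2` for `F x + G y`. -/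
theorem integral_exp_mul_integral_exp_le {N : ℕ} {P : Set (EuclideanSpace ℝ (Fin N))}
    (hPc : Convex ℝ P) (hPm : MeasurableSet P) (hPb : Bornology.IsBounded P) (k : ℝ)
    (c : EuclideanSpace ℝ (Fin N)) {F G : EuclideanSpace ℝ (Fin N) → ℝ} (hF : Continuous F)
    (hG : Continuous G) (h : ∀ x ∈ P, ∀ y ∈ P, F x + G y ≤ k / 4 * ‖x - y‖ ^ 2) :
    (∫ x in P, Real.exp (F x) * weight k c x) * (∫ x in P, Real.exp (G x) * weight k c x) ≤
      (∫ x in P, weight k c x) ^ 2 := by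
  have conv : ∀ φ : EuclideanSpace ℝ (Fin N) → ℝ, Continuous φ → (∀ x, 0 ≤ φ x) →
      ENNReal.ofReal (∫ x in P, φ x) = ∫⁻ x, P.indicator (fun x => ENNReal.ofReal (φ x)) x := by
    intro φ hφ hφ0
    rw [lintegral_indicator hPm, ofReal_integral_eq_lintegral_ofReal
      (integrableOn_of_continuous_of_isBounded hφ hPb) (ae_of_all _ hφ0)]
  have hm : ∀ φ : EuclideanSpace ℝ (Fin N) → ℝ, Continuous φ →
      Measurable (P.indicator (fun x => ENNReal.ofReal (φ x))) := fun φ hφ =>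
    (hφ.measurable.ennreal_ofReal).indicator hPm
  have c1 : Continuous fun x => Real.exp (F x) * weight k c x := by fun_prop
  have c2 : Continuous fun x => Real.exp (G x) * weight k c x := by fun_prop
  have p1 : ∀ x, 0 ≤ Real.exp (F x) * weight k c x := fun x =>
    mul_nonneg (Real.exp_pos _).le (weight_pos _ _ _).le
  have p2 : ∀ x, 0 ≤ Real.exp (G x) * weight k c x := fun x =>
    mul_nonneg (Real.exp_pos _).le (weight_pos _ _ _).le
  have p3 : ∀ x, 0 ≤ weight k c x := fun x => (weight_pos _ _ _).le
  rw [← ENNReal.ofReal_le_ofReal_iff (by positivity),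
    ENNReal.ofReal_mul (integral_nonneg p1), ENNReal.ofReal_pow (integral_nonneg p3),
    conv _ c1 p1, conv _ c2 p2, conv _ (continuous_weight k c) p3]
  refine prekopaLeindler_euclideanSpace N _ _ _ (hm _ c1) (hm _ c2)
    (hm _ (continuous_weight k c)) fun x y => ?_
  by_cases hx : x ∈ P
  · by_cases hy : y ∈ P
    · have hxy : (1 / 2 : ℝ) • (x + y) ∈ P := by
        rw [smul_add]
        exact hPc hx hy (by norm_num) (by norm_num) (by norm_num)
      rw [indicator_of_mem hx, indicator_of_mem hy, indicator_of_mem hxy,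
        ← ENNReal.ofReal_mul (p1 x), ← ENNReal.ofReal_pow (p3 _), weight_midpoint_sq]
      refine ENNReal.ofReal_le_ofReal ?_
      have h1 : Real.exp (F x) * Real.exp (G y) ≤ Real.exp (k / 4 * ‖x - y‖ ^ 2) := by
        rw [← Real.exp_add]; exact Real.exp_le_exp.2 (h x hx y hy)
      calc _ = weight k c x * weight k c y * (Real.exp (F x) * Real.exp (G y)) := by ring
        _ ≤ _ := by
          refine mul_le_mul_of_nonneg_left h1 (mul_nonneg (p3 x) (p3 y))
    · simp [hy]
  · simp [hx]

/-- First-order expansion at `x` with a quadratic remainder that is uniform on bounded sets. -/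
theorem exists_taylor_bound {N : ℕ} {P : Set (EuclideanSpace ℝ (Fin N))}
    (hPb : Bornology.IsBounded P) {g : EuclideanSpace ℝ (Fin N) → ℝ} (hg : ContDiff ℝ 2 g) :
    ∃ L, 0 ≤ L ∧ ∀ x ∈ P, ∀ y ∈ P,
      g x - g y ≤ ‖fderiv ℝ g x‖ * ‖x - y‖ + L * ‖x - y‖ ^ 2 := by
  obtain ⟨R, hR⟩ := hPb.subset_closedBall 0
  have hg' : ContDiff ℝ 1 (fderiv ℝ g) := hg.fderiv_right (by norm_num)
  obtain ⟨L, hL⟩ :=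
    (isCompact_closedBall (0 : EuclideanSpace ℝ (Fin N)) R).exists_bound_of_continuousOn
    (hg'.continuous_fderiv one_ne_zero).continuousOn
  have hlip : ∀ x ∈ Metric.closedBall (0 : EuclideanSpace ℝ (Fin N)) R,
      ∀ z ∈ Metric.closedBall (0 : EuclideanSpace ℝ (Fin N)) R,
      ‖fderiv ℝ g z - fderiv ℝ g x‖ ≤ L * ‖z - x‖ := fun x hx z hz =>
    (convex_closedBall _ _).norm_image_sub_le_of_norm_fderiv_le
      (fun w _ => hg'.differentiable one_ne_zero w) hL hx hz
  refine ⟨max L 0, le_max_right _ _, fun x hx y hy => ?_⟩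
  have hseg : segment ℝ x y ⊆ Metric.closedBall 0 R :=
    (convex_closedBall _ _).segment_subset (hR hx) (hR hy)
  have h1 : ‖g y - g x - fderiv ℝ g x (y - x)‖ ≤ (max L 0 * ‖y - x‖) * ‖y - x‖ := by
    refine (convex_segment x y).norm_image_sub_le_of_norm_fderiv_le'
      (fun w _ => (hg.differentiable two_ne_zero) w) (fun z hz => ?_)
      (left_mem_segment ℝ x y) (right_mem_segment ℝ x y)
    refine (hlip x (hR hx) z (hseg hz)).trans ?_
    have h2 : ‖z - x‖ ≤ ‖y - x‖ := by
      rw [← dist_eq_norm, ← dist_eq_norm, dist_comm z, dist_comm y]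
      obtain ⟨a, b, ha, hb, hab, rfl⟩ := hz
      rw [dist_eq_norm, dist_eq_norm]
      have : x - (a • x + b • y) = b • (x - y) := by
        have : a = 1 - b := by linarith
        subst this; module
      rw [this, norm_smul, Real.norm_of_nonneg hb]
      have := norm_nonneg (x - y)
      nlinarith
    calc L * ‖z - x‖ ≤ max L 0 * ‖z - x‖ := by gcongr; exact le_max_left _ _
      _ ≤ _ := by gcongr
  have h3 := (fderiv ℝ g x).le_opNorm (y - x)
  rw [Real.norm_eq_abs] at h1 h3
  rw [norm_sub_rev x y]
  have h4 := abs_le.1 h1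
  have h5 := abs_le.1 h3
  nlinarith [h4.1, h5.1]

/-- Second-order lower bound for the exponential with an explicit cubic error. -/
theorem exp_lower_bound {t g q K Q : ℝ} (ht : 0 < t) (ht1 : t ≤ 1) (hg : |g| ≤ K) (hq : 0 ≤ q)
    (hqQ : q ≤ Q) (htK : t * (K + Q) ≤ 1) :
    1 + t * g + t ^ 2 * (g ^ 2 / 2 - q) - t ^ 3 * ((K + Q) ^ 3 + K * Q) ≤
      Real.exp (t * g - t ^ 2 * q) := by
  have hK : 0 ≤ K := (abs_nonneg g).trans hg
  have hz : |t * g - t ^ 2 * q| ≤ t * (K + Q) := by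
    have h1 : |t * g| ≤ t * K := by rw [abs_mul, abs_of_pos ht]; gcongr
    have h2 : |t ^ 2 * q| ≤ t * Q := by
      rw [abs_of_nonneg (by positivity)]
      have : t * q ≤ 1 * Q := mul_le_mul ht1 hqQ hq (by norm_num)
      nlinarith
    calc _ ≤ |t * g| + |t ^ 2 * q| := abs_sub _ _
      _ ≤ _ := by linarith
  have h := Real.exp_bound (hz.trans htK) (n := 3) (by norm_num)
  simp only [Finset.sum_range_succ, Finset.sum_range_zero, Nat.factorial] at h
  have h' := (abs_le.1 h).1
  have h3 : |t * g - t ^ 2 * q| ^ 3 ≤ (t * (K + Q)) ^ 3 := by gcongr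
  have h4 : g * q ≤ K * Q := mul_le_mul ((le_abs_self g).trans hg) hqQ hq hK
  have h5 : t ^ 3 * (g * q) ≤ t ^ 3 * (K * Q) := by gcongr
  have h6 : 0 ≤ |t * g - t ^ 2 * q| ^ 3 := by positivity
  norm_num at h'
  nlinarith [sq_nonneg (t ^ 2 * q)]

/-- The Poincaré inequality is the linearisation of the Prékopa-Leindler inequality: for `θ > 1` and
small `t > 0` the functions `F = t g - t² (θ / k) ‖∇g‖²` and `G = -t g` satisfy
`F x + G y ≤ k / 4 * ‖x - y‖ ^ 2`, and the terms of order `t²` in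
`(∫ exp F) (∫ exp G) ≤ (∫ 1)²` give the inequality with constant `θ / k`. -/
theorem poincare_smooth_of_mean_zero {N : ℕ} {P : Set (EuclideanSpace ℝ (Fin N))}
    (hPc : Convex ℝ P) (hPm : MeasurableSet P) (hPb : Bornology.IsBounded P) {k : ℝ} (hk : 0 < k)
    (c : EuclideanSpace ℝ (Fin N)) {g : EuclideanSpace ℝ (Fin N) → ℝ} (hg : ContDiff ℝ 2 g)
    (hM : 0 < ∫ x in P, weight k c x) (hmean : ∫ x in P, g x * weight k c x = 0) :
    ∫ x in P, g x ^ 2 * weight k c x ≤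
      1 / k * ∫ x in P, ‖fderiv ℝ g x‖ ^ 2 * weight k c x := by
  set M := ∫ x in P, weight k c x with hMdef
  set I := ∫ x in P, g x ^ 2 * weight k c x with hI
  set J := ∫ x in P, ‖fderiv ℝ g x‖ ^ 2 * weight k c x with hJ
  have hgc : Continuous g := hg.continuous
  have hpc : Continuous (fderiv ℝ g) := hg.continuous_fderiv two_ne_zero
  obtain ⟨L, hL0, hL⟩ := exists_taylor_bound hPb hg
  obtain ⟨K, hK⟩ := hPb.isCompact_closure.exists_bound_of_continuousOn hgc.continuousOn
  obtain ⟨Q₀, hQ₀⟩ := hPb.isCompact_closure.exists_bound_of_continuousOn hpc.continuousOn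
  have int : ∀ {φ : EuclideanSpace ℝ (Fin N) → ℝ}, Continuous φ → IntegrableOn φ P := fun h =>
    integrableOn_of_continuous_of_isBounded h hPb
  have key : ∀ θ : ℝ, 1 < θ → I ≤ θ / k * J := by
    intro θ hθ
    set Q := θ / k * Q₀ ^ 2 with hQ
    set C := (K + Q) ^ 3 + K * Q with hC
    -- the integrated second-order lower bound
    have low : ∀ (σ t : ℝ) (q : EuclideanSpace ℝ (Fin N) → ℝ), |σ| = 1 → 0 < t → t ≤ 1 →
        t * (K + Q) ≤ 1 → Continuous q → (∀ x ∈ P, 0 ≤ q x ∧ q x ≤ Q) →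
        M + t ^ 2 * (I / 2 - ∫ x in P, q x * weight k c x) - t ^ 3 * C * M ≤
          ∫ x in P, Real.exp (t * (σ * g x) - t ^ 2 * q x) * weight k c x := by
      intro σ t q hσ ht ht1 htK hq hqQ
      have hσ2 : σ ^ 2 = 1 := by rw [← sq_abs, hσ]; norm_num
      have e : M + t ^ 2 * (I / 2 - ∫ x in P, q x * weight k c x) - t ^ 3 * C * M =
          ∫ x in P, (1 + t * (σ * g x) + t ^ 2 * ((σ * g x) ^ 2 / 2 - q x) - t ^ 3 * C) *
            weight k c x := by
        have e1 : ∀ x, (1 + t * (σ * g x) + t ^ 2 * ((σ * g x) ^ 2 / 2 - q x) - t ^ 3 * C) *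
            weight k c x =
            (1 - t ^ 3 * C) * weight k c x + t * σ * (g x * weight k c x) +
              t ^ 2 / 2 * (g x ^ 2 * weight k c x) - t ^ 2 * (q x * weight k c x) := fun x => by
          rw [mul_pow, hσ2]; ring
        simp only [e1]
        rw [integral_sub (int (by fun_prop)) (int (by fun_prop)),
          integral_add (int (by fun_prop)) (int (by fun_prop)),
          integral_add (int (by fun_prop)) (int (by fun_prop)), integral_const_mul,
          integral_const_mul, integral_const_mul, integral_const_mul, hmean, ← hI, ← hMdef]
        ring
      rw [e]
      refine setIntegral_mono_on (int (by fun_prop)) (int (by fun_prop)) hPm fun x hx => ?_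
      refine mul_le_mul_of_nonneg_right ?_ (weight_pos _ _ _).le
      refine exp_lower_bound ht ht1 ?_ (hqQ x hx).1 (hqQ x hx).2 htK
      rw [abs_mul, hσ, one_mul]
      exact hK x (subset_closure hx)
    have ev1 : ∀ a : ℝ, ∀ᶠ t in 𝓝[>] (0 : ℝ), t * a < 1 := by
      intro a
      have : Tendsto (fun t : ℝ => t * a) (𝓝[>] 0) (𝓝 (0 * a)) :=
        (continuous_id.mul continuous_const).continuousWithinAt
      exact this.eventually_lt_const (by simp)
    -- the coefficients of `t²` in the expansions of the two exponential integrals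
    set a := I / 2 - θ / k * J with ha
    set b := I / 2 with hb
    have ev2 : ∀ b : ℝ, ∀ᶠ t in 𝓝[>] (0 : ℝ), 0 ≤ M + t ^ 2 * b - t ^ 3 * C * M := by
      intro b
      have : Tendsto (fun t : ℝ => M + t ^ 2 * b - t ^ 3 * C * M) (𝓝[>] 0)
          (𝓝 (M + 0 ^ 2 * b - 0 ^ 3 * C * M)) :=
        (by fun_prop : Continuous fun t : ℝ => M + t ^ 2 * b - t ^ 3 * C * M).continuousWithinAt
      exact (this.eventually_const_lt (by simpa using hM)).mono fun t ht => ht.le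
    -- the inequality between the two products, after subtraction of `M ^ 2` and division by `t ^ 2`
    have ev : ∀ᶠ t in 𝓝[>] (0 : ℝ),
        M * (a + b) - 2 * t * C * M ^ 2 + t ^ 2 * ((a - t * C * M) * (b - t * C * M)) ≤ 0 := by
      filter_upwards [ev1 1, ev1 (K + Q), ev1 (4 * L * θ / (k * (θ - 1))), ev2 a, ev2 b,
        self_mem_nhdsWithin] with t h1 h2 h3 h4 h5 (ht : 0 < t)
      have hA := low 1 t (fun x => θ / k * ‖fderiv ℝ g x‖ ^ 2) (by norm_num) ht (by linarith)
        h2.le (by fun_prop)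
        (fun x hx => ⟨by positivity, by
          rw [hQ]; gcongr; exact hQ₀ x (subset_closure hx)⟩)
      have hB := low (-1) t (fun x => 0) (by norm_num) ht (by linarith) h2.le (by fun_prop)
        (fun x hx => ⟨le_rfl, by rw [hQ]; positivity⟩)
      simp only [mul_assoc (θ / k), integral_const_mul, ← hJ, ← ha] at hA
      simp only [zero_mul, integral_zero, sub_zero] at hB
      have hPL := integral_exp_mul_integral_exp_le hPc hPm hPb k c
        (F := fun x => t * (1 * g x) - t ^ 2 * (θ / k * ‖fderiv ℝ g x‖ ^ 2))
        (G := fun x => t * (-1 * g x) - t ^ 2 * 0) (by fun_prop) (by fun_prop) (by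
          intro x hx y hy
          have hT := hL x hx y hy
          set p := ‖fderiv ℝ g x‖
          set d := ‖x - y‖
          have hθ0 : 0 < θ - 1 := by linarith
          have h6 : 4 * L * θ * t < k * (θ - 1) := by
            rw [← mul_div_assoc, div_lt_one (by positivity)] at h3
            linarith
          -- the arithmetic-geometric mean inequality absorbs the cross term
          have h7 : t * (p * d) ≤ t ^ 2 * (θ / k * p ^ 2) + k / (4 * θ) * d ^ 2 := by
            have : t ^ 2 * (θ / k * p ^ 2) + k / (4 * θ) * d ^ 2 - t * (p * d) =
                1 / (4 * θ * k) * (2 * θ * t * p - k * d) ^ 2 := by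
              field_simp; ring
            have h8 : 0 ≤ 1 / (4 * θ * k) * (2 * θ * t * p - k * d) ^ 2 := by positivity
            linarith
          have h9 : k / (4 * θ) + t * L ≤ k / 4 := by
            have : k / 4 - (k / (4 * θ) + t * L) =
                (k * (θ - 1) - 4 * L * θ * t) / (4 * θ) := by
              field_simp; ring
            have h10 : 0 ≤ (k * (θ - 1) - 4 * L * θ * t) / (4 * θ) :=
              div_nonneg (by linarith) (by positivity)
            linarith
          have h11 : t * (g x - g y) ≤ t * (p * d + L * d ^ 2) := by gcongr
          have h12 : (k / (4 * θ) + t * L) * d ^ 2 ≤ k / 4 * d ^ 2 := by gcongr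
          nlinarith)
      rw [← hMdef] at hPL
      have hAB := (mul_le_mul hA hB h5 (h4.trans hA)).trans hPL
      have ht2 : 0 < t ^ 2 := by positivity
      refine nonpos_of_mul_nonpos_right ?_ ht2
      nlinarith
    have hlim : Tendsto (fun t : ℝ => M * (a + b) - 2 * t * C * M ^ 2 +
        t ^ 2 * ((a - t * C * M) * (b - t * C * M))) (𝓝[>] 0)
        (𝓝 (M * (a + b) - 2 * 0 * C * M ^ 2 +
        0 ^ 2 * ((a - 0 * C * M) * (b - 0 * C * M)))) :=
      (by fun_prop : Continuous fun t : ℝ => M * (a + b) - 2 * t * C * M ^ 2 +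
        t ^ 2 * ((a - t * C * M) * (b - t * C * M))).continuousWithinAt
    have h0 := le_of_tendsto hlim ev
    have h1 : M * (a + b) ≤ 0 := by simpa using h0
    have h2 : a + b ≤ 0 := nonpos_of_mul_nonpos_right h1 hM
    rw [ha, hb] at h2
    linarith
  have hlim : Tendsto (fun θ : ℝ => θ / k * J) (𝓝[>] 1) (𝓝 (1 / k * J)) :=
    (by fun_prop : Continuous fun θ : ℝ => θ / k * J).continuousWithinAt
  refine ge_of_tendsto hlim ?_
  filter_upwards [self_mem_nhdsWithin] with θ hθ using key θ hθ

/-- The Poincaré inequality with the sharp Gaussian constant for smooth functions on a bounded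
convex set. -/
theorem poincare_smooth {N : ℕ} {P : Set (EuclideanSpace ℝ (Fin N))}
    (hPc : Convex ℝ P) (hPm : MeasurableSet P) (hPb : Bornology.IsBounded P) {k : ℝ} (hk : 0 < k)
    (c : EuclideanSpace ℝ (Fin N)) {g : EuclideanSpace ℝ (Fin N) → ℝ} (hg : ContDiff ℝ 2 g) :
    (∫ x in P, weight k c x) * (∫ x in P, g x ^ 2 * weight k c x) -
        (∫ x in P, g x * weight k c x) ^ 2 ≤
      1 / k * ((∫ x in P, weight k c x) * ∫ x in P, ‖fderiv ℝ g x‖ ^ 2 * weight k c x) := by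
  have hgc : Continuous g := hg.continuous
  have int : ∀ {φ : EuclideanSpace ℝ (Fin N) → ℝ}, Continuous φ → IntegrableOn φ P := fun h =>
    integrableOn_of_continuous_of_isBounded h hPb
  set M := ∫ x in P, weight k c x with hM
  have hM0 : 0 ≤ M := integral_nonneg fun x => (weight_pos k c x).le
  rcases hM0.eq_or_lt with h0 | h0
  · rw [← h0]
    simp only [zero_mul, mul_zero, zero_sub, neg_nonpos]
    positivity
  set m := (∫ x in P, g x * weight k c x) / M with hm
  have hmM : ∫ x in P, g x * weight k c x = m * M := by rw [hm]; field_simp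
  have hmean : ∫ x in P, (g x - m) * weight k c x = 0 := by
    simp only [sub_mul]
    rw [integral_sub (int (by fun_prop)) (int (by fun_prop)), integral_const_mul, ← hM, hmM]
    ring
  have main := poincare_smooth_of_mean_zero hPc hPm hPb hk c (hg.sub contDiff_const) h0 hmean
  simp only [fderiv_sub_const] at main
  have e : ∫ x in P, (g x - m) ^ 2 * weight k c x =
      (∫ x in P, g x ^ 2 * weight k c x) - m ^ 2 * M := by
    have e1 : ∀ x, (g x - m) ^ 2 * weight k c x = g x ^ 2 * weight k c x -
        2 * m * (g x * weight k c x) + m ^ 2 * weight k c x := fun x => by ring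
    simp only [e1]
    rw [integral_add (int (by fun_prop)) (int (by fun_prop)),
      integral_sub (int (by fun_prop)) (int (by fun_prop)), integral_const_mul,
      integral_const_mul, ← hM, hmM]
    ring
  rw [e] at main
  rw [hmM]
  have := mul_le_mul_of_nonneg_left main hM0
  linarith

/-! ### Mollification -/

section

open scoped Convolution ENNReal

section Mollification

variable {E F : Type*} [NormedAddCommGroup E] [NormedSpace ℝ E] [FiniteDimensional ℝ E]
  [MeasurableSpace E] [BorelSpace E] [HasContDiffBump E]
  [NormedAddCommGroup F] [NormedSpace ℝ F]

/-- Convolution with a normalised bump function does not increase the `L²` norm. -/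
theorem eLpNorm_two_convolution_le (μ : Measure E) [μ.IsAddHaarMeasure]
    (φ : ContDiffBump (0 : E)) {f : E → F} (hf : AEStronglyMeasurable f μ) :
    eLpNorm (φ.normed μ ⋆[ContinuousLinearMap.lsmul ℝ ℝ, μ] f) 2 μ ≤ eLpNorm f 2 μ := by
  -- pass to a strongly measurable representative
  wlog hfm : StronglyMeasurable f generalizing f
  · rw [convolution_congr _ (ae_eq_refl _) hf.ae_eq_mk, eLpNorm_congr_ae hf.ae_eq_mk]
    exact this hf.stronglyMeasurable_mk.aestronglyMeasurable hf.stronglyMeasurable_mk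
  have hφm : Measurable fun t => ENNReal.ofReal (φ.normed μ t) :=
    φ.continuous_normed.measurable.ennreal_ofReal
  have hφ1 : ∫⁻ t, ENNReal.ofReal (φ.normed μ t) ∂μ = 1 := by
    rw [← ofReal_integral_eq_lintegral_ofReal φ.integrable_normed (ae_of_all _ φ.nonneg_normed),
      φ.integral_normed, ENNReal.ofReal_one]
  have sq : ∀ (g : E → F) (ν : Measure E),
      eLpNorm g 2 ν ^ 2 = ∫⁻ x, ‖g x‖ₑ ^ 2 ∂ν := by
    intro g ν
    have := eLpNorm_nnreal_pow_eq_lintegral (f := g) (μ := ν) (p := 2) (by norm_num)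
    simpa using this
  set ν := μ.withDensity fun t => ENNReal.ofReal (φ.normed μ t) with hν
  have : IsProbabilityMeasure ν := ⟨by rw [hν, withDensity_apply _ .univ]; simpa using hφ1⟩
  have hfx : ∀ x, StronglyMeasurable fun t => f (x - t) := fun x =>
    hfm.comp_measurable (measurable_const.sub measurable_id)
  -- Jensen's inequality for the probability density `φ.normed μ`
  have jensen : ∀ x, ‖(φ.normed μ ⋆[ContinuousLinearMap.lsmul ℝ ℝ, μ] f) x‖ₑ ^ 2 ≤
      ∫⁻ t, ENNReal.ofReal (φ.normed μ t) * ‖f (x - t)‖ₑ ^ 2 ∂μ := by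
    intro x
    have h1 : ‖(φ.normed μ ⋆[ContinuousLinearMap.lsmul ℝ ℝ, μ] f) x‖ₑ ≤
        ∫⁻ t, ‖f (x - t)‖ₑ ∂ν := by
      rw [convolution_lsmul, hν, lintegral_withDensity_eq_lintegral_mul _ hφm (hfx x).enorm]
      refine (enorm_integral_le_lintegral_enorm _).trans (lintegral_mono fun t => ?_)
      simp only [Pi.mul_apply]
      rw [enorm_smul, Real.enorm_of_nonneg (φ.nonneg_normed t)]
    have h2 : ∫⁻ t, ‖f (x - t)‖ₑ ∂ν ≤ eLpNorm (fun t => f (x - t)) 2 ν := by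
      rw [← eLpNorm_one_eq_lintegral_enorm]
      exact eLpNorm_le_eLpNorm_of_exponent_le (by norm_num) (hfx x).aestronglyMeasurable
    calc _ ≤ (eLpNorm (fun t => f (x - t)) 2 ν) ^ 2 := by gcongr; exact h1.trans h2
      _ = _ := by
        rw [sq, hν, lintegral_withDensity_eq_lintegral_mul _ hφm ((hfx x).enorm.pow_const 2)]
        rfl
  have h3 : eLpNorm (φ.normed μ ⋆[ContinuousLinearMap.lsmul ℝ ℝ, μ] f) 2 μ ^ 2 ≤
      eLpNorm f 2 μ ^ 2 := by
    rw [sq, sq]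
    refine (lintegral_mono jensen).trans ?_
    rw [lintegral_lintegral_swap]
    · have : ∀ t, ∫⁻ x, ENNReal.ofReal (φ.normed μ t) * ‖f (x - t)‖ₑ ^ 2 ∂μ =
          ENNReal.ofReal (φ.normed μ t) * ∫⁻ x, ‖f x‖ₑ ^ 2 ∂μ := by
        intro t
        have hm : Measurable fun x => ‖f (x - t)‖ₑ ^ 2 :=
          (hfm.comp_measurable (measurable_id.sub_const t)).enorm.pow_const 2
        rw [lintegral_const_mul _ hm,
          lintegral_sub_right_eq_self (fun x => ‖f x‖ₑ ^ 2) t]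
      simp only [this]
      rw [lintegral_mul_const _ hφm, hφ1, one_mul]
    · refine Measurable.aemeasurable ?_
      exact (hφm.comp measurable_snd).mul
        ((hfm.comp_measurable (measurable_fst.sub measurable_snd)).enorm.pow_const 2)
  exact (ENNReal.pow_le_pow_left_iff two_ne_zero).1 h3

/-- Mollifications of an `L²` function converge in `L²`. -/
theorem tendsto_eLpNorm_convolution_sub [CompleteSpace F] (μ : Measure E) [μ.IsAddHaarMeasure]
    {φ : ℕ → ContDiffBump (0 : E)} (hφ : Tendsto (fun n => (φ n).rOut) atTop (𝓝 0)) {f : E → F}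
    (hf : MemLp f 2 μ) (hfi : LocallyIntegrable f μ) :
    Tendsto (fun n => eLpNorm
      ((φ n).normed μ ⋆[ContinuousLinearMap.lsmul ℝ ℝ, μ] f - f) 2 μ) atTop (𝓝 0) := by
  rw [ENNReal.tendsto_nhds_zero]
  intro ε hε
  rcases eq_or_ne ε ⊤ with rfl | hεT
  · simp
  have hε3 : ε / 3 ≠ 0 := by simp [hε.ne', ENNReal.div_eq_zero_iff]
  obtain ⟨g, hgs, hfg, hgc, hgm⟩ := hf.exists_hasCompactSupport_eLpNorm_sub_le
    (by norm_num) hε3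
  set S := Metric.cthickening 1 (tsupport g) with hS
  have hSc : IsCompact S := hgs.isCompact.cthickening
  -- uniform convergence for the continuous approximant
  obtain ⟨η, hη, hηS⟩ : ∃ η : ℝ, 0 < η ∧
      ENNReal.ofReal η * μ S ^ (1 / (2 : ℝ≥0∞).toReal) ≤ ε / 3 := by
    have hT : μ S ^ (1 / (2 : ℝ≥0∞).toReal) ≠ ⊤ :=
      ENNReal.rpow_ne_top_of_nonneg (by norm_num) hSc.measure_lt_top.ne
    have : Tendsto (fun η : ℝ => ENNReal.ofReal η * μ S ^ (1 / (2 : ℝ≥0∞).toReal)) (𝓝[>] 0)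
        (𝓝 (ENNReal.ofReal 0 * μ S ^ (1 / (2 : ℝ≥0∞).toReal))) := by
      refine ENNReal.Tendsto.mul_const ?_ (Or.inr hT)
      exact (ENNReal.continuous_ofReal.tendsto 0).mono_left nhdsWithin_le_nhds
    have h0 : ∀ᶠ η in 𝓝[>] (0 : ℝ), ENNReal.ofReal η * μ S ^ (1 / (2 : ℝ≥0∞).toReal) < ε / 3 :=
      this.eventually_lt_const (by simpa using pos_iff_ne_zero.2 hε3)
    obtain ⟨η, h1, h2⟩ := (h0.and self_mem_nhdsWithin).exists
    exact ⟨η, h2, h1.le⟩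
  obtain ⟨δ, hδ, hgδ⟩ := Metric.uniformContinuous_iff.1
    (hgs.uniformContinuous_of_continuous hgc) η hη
  filter_upwards [hφ.eventually_lt_const hδ, hφ.eventually_lt_const one_pos] with n hn hn1
  set T : (E → F) → E → F := fun f =>
    (φ n).normed μ ⋆[ContinuousLinearMap.lsmul ℝ ℝ, μ] f with hTdef
  have hex : ∀ {f : E → F}, LocallyIntegrable f μ →
      ConvolutionExists ((φ n).normed μ) f (ContinuousLinearMap.lsmul ℝ ℝ) μ := fun h =>
    (φ n).hasCompactSupport_normed.convolutionExists_left _ (φ n).continuous_normed h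
  have hTc : ∀ {f : E → F}, LocallyIntegrable f μ → Continuous (T f) := fun h =>
    (φ n).hasCompactSupport_normed.continuous_convolution_left _ (φ n).continuous_normed h
  have hgi := hgc.locallyIntegrable (μ := μ)
  have hTsub : T (f - g) = T f - T g := by
    ext x
    simp only [hTdef, convolution_lsmul, Pi.sub_apply, smul_sub]
    exact integral_sub (hex hfi x) (hex hgi x)
  have e : T f - f = T (f - g) + (T g - g) + (g - f) := by rw [hTsub]; abel
  have b1 : eLpNorm (T (f - g)) 2 μ ≤ ε / 3 :=
    (eLpNorm_two_convolution_le μ (φ n) (hf.1.sub hgm.1)).trans hfg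
  have b3 : eLpNorm (g - f) 2 μ ≤ ε / 3 := by rw [eLpNorm_sub_comm]; exact hfg
  have b2 : eLpNorm (T g - g) 2 μ ≤ ε / 3 := by
    refine (eLpNorm_sub_le_of_dist_bdd μ (by norm_num) hSc.measurableSet hη.le (fun x => ?_)
      ?_ ?_).trans hηS
    · exact (φ n).dist_normed_convolution_le hgc.aestronglyMeasurable fun y hy =>
        (hgδ (lt_of_lt_of_le (Metric.mem_ball.1 hy) hn.le)).le
    · refine (support_convolution_subset _).trans ?_
      rw [(φ n).support_normed_eq]
      rintro _ ⟨y, hy, z, hz, rfl⟩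
      refine Metric.mem_cthickening_of_dist_le _ z _ _ (subset_tsupport _ hz) ?_
      have : ‖y‖ < (φ n).rOut := by simpa using hy
      simp only [dist_add_self_left]
      linarith
    · exact (subset_tsupport g).trans (Metric.self_subset_cthickening _)
  rw [e]
  calc eLpNorm (T (f - g) + (T g - g) + (g - f)) 2 μ
      ≤ eLpNorm (T (f - g) + (T g - g)) 2 μ + eLpNorm (g - f) 2 μ :=
        eLpNorm_add_le (((hTc (hfi.sub hgi)).aestronglyMeasurable).add
          ((hTc hgi).aestronglyMeasurable.sub hgm.1)) (hgm.1.sub hf.1) (by norm_num)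
    _ ≤ eLpNorm (T (f - g)) 2 μ + eLpNorm (T g - g) 2 μ + eLpNorm (g - f) 2 μ := by
        gcongr
        exact eLpNorm_add_le ((hTc (hfi.sub hgi)).aestronglyMeasurable)
          ((hTc hgi).aestronglyMeasurable.sub hgm.1) (by norm_num)
    _ ≤ ε / 3 + ε / 3 + ε / 3 := by gcongr
    _ = ε := ENNReal.add_thirds ε

end Mollification

/-- A function with a weak gradient that is locally square integrable, together with its gradient,
is approximated in `L²` on a compact set by `C²` functions, together with their gradients. -/
theorem HasWeakGradient.exists_smooth_approx {N : ℕ} {Ω : Set (EuclideanSpace ℝ (Fin N))}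
    (hΩ : IsOpen Ω) {u : EuclideanSpace ℝ (Fin N) → ℝ}
    {G : EuclideanSpace ℝ (Fin N) → EuclideanSpace ℝ (Fin N)} (h : HasWeakGradient Ω u G)
    (hu : ∀ K ⊆ Ω, IsCompact K → MemLp u 2 (volume.restrict K))
    (hG : ∀ K ⊆ Ω, IsCompact K → MemLp G 2 (volume.restrict K))
    {K : Set (EuclideanSpace ℝ (Fin N))} (hK : IsCompact K) (hKΩ : K ⊆ Ω) :
    ∃ (v : ℕ → EuclideanSpace ℝ (Fin N) → ℝ)
      (H : ℕ → EuclideanSpace ℝ (Fin N) → EuclideanSpace ℝ (Fin N)),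
      (∀ n, ContDiff ℝ 2 (v n)) ∧ (∀ n, Continuous (H n)) ∧
      (∀ n, ∀ x ∈ K, ∀ y, fderiv ℝ (v n) x y = ⟪H n x, y⟫) ∧
      Tendsto (fun n => eLpNorm (v n - u) 2 (volume.restrict K)) atTop (𝓝 0) ∧
      Tendsto (fun n => eLpNorm (H n - G) 2 (volume.restrict K)) atTop (𝓝 0) := by
  -- mollify on a compact neighbourhood of `K`, at scales at most its width
  obtain ⟨δ, hδ, hδΩ⟩ := hK.exists_cthickening_subset_open hΩ hKΩ
  set S := Metric.cthickening δ K with hS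
  have hSc : IsCompact S := hK.cthickening
  have hSm : MeasurableSet S := hSc.measurableSet
  set u' := S.indicator u with hu'
  set G' := S.indicator G with hG'
  have hu'2 : MemLp u' 2 volume := (memLp_indicator_iff_restrict hSm).2 (hu S hδΩ hSc)
  have hG'2 : MemLp G' 2 volume := (memLp_indicator_iff_restrict hSm).2 (hG S hδΩ hSc)
  have hu'i : LocallyIntegrable u' volume := hu'2.locallyIntegrable (by norm_num)
  have hG'i : LocallyIntegrable G' volume := hG'2.locallyIntegrable (by norm_num)
  let φ : ℕ → ContDiffBump (0 : EuclideanSpace ℝ (Fin N)) := fun n =>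
    ⟨δ / (2 * (n + 2)), δ / (n + 2), by positivity, by
      rw [mul_comm, ← div_div]; exact half_lt_self (by positivity)⟩
  have hφ : Tendsto (fun n => (φ n).rOut) atTop (𝓝 0) := by
    have := (tendsto_const_div_atTop_nhds_zero_nat δ).comp (tendsto_add_atTop_nat 2)
    refine this.congr fun n => ?_
    simp [φ]
  have hφδ : ∀ n, (φ n).rOut ≤ δ := fun n => by
    simp only [φ]
    exact div_le_self hδ.le (by linarith [(Nat.cast_nonneg n : (0 : ℝ) ≤ n)])
  refine ⟨fun n => (φ n).normed volume ⋆[ContinuousLinearMap.lsmul ℝ ℝ, volume] u',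
    fun n => (φ n).normed volume ⋆[ContinuousLinearMap.lsmul ℝ ℝ, volume] G',
    fun n => ?_, fun n => ?_, fun n x hx y => ?_, ?_, ?_⟩
  · exact (φ n).hasCompactSupport_normed.contDiff_convolution_left (n := 2) _
      (φ n).contDiff_normed hu'i
  · exact (φ n).hasCompactSupport_normed.continuous_convolution_left _
      (φ n).continuous_normed hG'i
  · set ρ := (φ n).normed (volume : Measure (EuclideanSpace ℝ (Fin N))) with hρ
    have hρc : ContDiff ℝ ∞ ρ := (φ n).contDiff_normed
    have hρs : HasCompactSupport ρ := (φ n).hasCompactSupport_normed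
    have hd := hρs.hasFDerivAt_convolution_left (ContinuousLinearMap.lsmul ℝ ℝ)
      (hρc.of_le (by exact_mod_cast le_top)) hu'i x
    rw [hd.fderiv]
    have hdi : ConvolutionExistsAt (fderiv ℝ ρ) u' x
        ((ContinuousLinearMap.lsmul ℝ ℝ : ℝ →L[ℝ] ℝ →L[ℝ] ℝ).precompL
          (EuclideanSpace ℝ (Fin N))) volume :=
      (hρs.fderiv ℝ).convolutionExists_left _ (hρc.continuous_fderiv (by simp)) hu'i x
    have hGi : ConvolutionExistsAt ρ G' x (ContinuousLinearMap.lsmul ℝ ℝ) volume :=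
      hρs.convolutionExists_left _ hρc.continuous hG'i x
    have hball : ∀ t, t ∉ S → x - t ∉ tsupport ρ := by
      intro t ht hmem
      rw [hρ, (φ n).tsupport_normed_eq, mem_closedBall_zero_iff, norm_sub_rev] at hmem
      exact ht (Metric.mem_cthickening_of_dist_le _ x _ _ hx
        ((dist_eq_norm t x).trans_le (hmem.trans (hφδ n))))
    have hρ0 : ∀ t, t ∉ S → ρ (x - t) = 0 := fun t ht =>
      image_eq_zero_of_notMem_tsupport (hball t ht)
    have hdρ0 : ∀ t, t ∉ S → fderiv ℝ ρ (x - t) = 0 := fun t ht =>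
      image_eq_zero_of_notMem_tsupport fun hm => hball t ht (tsupport_fderiv_subset ℝ hm)
    -- the translated reflected kernel is an admissible test function
    have hψs : tsupport (fun t => ρ (x - t)) ⊆ S := by
      refine closure_minimal (fun t ht => ?_) hSc.isClosed
      by_contra hn
      exact ht (hρ0 t hn)
    have hψ := h.integral_by_parts (fun t => ρ (x - t))
      (hρc.comp (contDiff_const.sub contDiff_id))
      (hSc.of_isClosed_subset (isClosed_tsupport _) hψs) (hψs.trans hδΩ) y
    have hψd : ∀ t, fderiv ℝ (fun t => ρ (x - t)) t y = -fderiv ℝ ρ (x - t) y := by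
      intro t
      have h1 : HasFDerivAt (fun t => x - t)
          (-ContinuousLinearMap.id ℝ (EuclideanSpace ℝ (Fin N))) t := (hasFDerivAt_id t).const_sub x
      have h2 : HasFDerivAt (fun t => ρ (x - t)) _ t :=
        (hρc.differentiable (by simp) (x - t)).hasFDerivAt.comp t h1
      rw [h2.fderiv]
      simp
    simp only [hψd, mul_neg, integral_neg, neg_inj] at hψ
    have e1 : (fderiv ℝ ρ ⋆[(ContinuousLinearMap.lsmul ℝ ℝ : ℝ →L[ℝ] ℝ →L[ℝ] ℝ).precompL
        (EuclideanSpace ℝ (Fin N)), volume] u') x y = ∫ t in Ω, u t * fderiv ℝ ρ (x - t) y := by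
      rw [convolution_eq_swap, ContinuousLinearMap.integral_apply hdi.integrable_swap,
        ← integral_indicator hΩ.measurableSet]
      refine integral_congr_ae (ae_of_all _ fun t => ?_)
      by_cases ht : t ∈ S
      · simp [hu', ht, hδΩ ht, mul_comm]
      · simp [hu', ht, hdρ0 t ht, indicator]
    have e2 : ⟪(ρ ⋆[ContinuousLinearMap.lsmul ℝ ℝ, volume] G') x, y⟫ =
        ∫ t in Ω, ⟪G t, y⟫ * ρ (x - t) := by
      rw [convolution_eq_swap, real_inner_comm, ← integral_inner hGi.integrable_swap,
        ← integral_indicator hΩ.measurableSet]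
      refine integral_congr_ae (ae_of_all _ fun t => ?_)
      by_cases ht : t ∈ S
      · simp [hG', ht, hδΩ ht, mul_comm, real_inner_smul_right, real_inner_comm]
      · simp [hG', ht, hρ0 t ht, indicator]
    rw [e1, e2, hψ]
  all_goals
    have hKS : K ⊆ S := Metric.self_subset_cthickening K
    have hae : ∀ᵐ x ∂volume.restrict K, x ∈ S := by
      filter_upwards [ae_restrict_mem hK.measurableSet] with x hx using hKS hx
  · refine tendsto_of_tendsto_of_tendsto_of_le_of_le tendsto_const_nhds
      (tendsto_eLpNorm_convolution_sub volume hφ hu'2 hu'i) (fun _ => zero_le) fun n => ?_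
    refine (eLpNorm_congr_ae ?_).trans_le (eLpNorm_restrict_le _ 2 volume K)
    filter_upwards [hae] with x hx
    simp [hu', hx]
  · refine tendsto_of_tendsto_of_tendsto_of_le_of_le tendsto_const_nhds
      (tendsto_eLpNorm_convolution_sub volume hφ hG'2 hG'i) (fun _ => zero_le) fun n => ?_
    refine (eLpNorm_congr_ae ?_).trans_le (eLpNorm_restrict_le _ 2 volume K)
    filter_upwards [hae] with x hx
    simp [hG', hx]

end

/-! ### The Poincaré inequality for weakly differentiable functions -/

section L2

variable {α F : Type*} [MeasurableSpace α] {μ : Measure α} [NormedAddCommGroup F]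
  [InnerProductSpace ℝ F]

theorem inner_toLp {f g : α → F} (hf : MemLp f 2 μ) (hg : MemLp g 2 μ) :
    ⟪hf.toLp f, hg.toLp g⟫ = ∫ x, ⟪f x, g x⟫ ∂μ := by
  rw [L2.inner_def]
  refine integral_congr_ae ?_
  filter_upwards [hf.coeFn_toLp, hg.coeFn_toLp] with x h1 h2
  rw [h1, h2]

theorem norm_toLp_sq {f : α → F} (hf : MemLp f 2 μ) :
    ‖hf.toLp f‖ ^ 2 = ∫ x, ‖f x‖ ^ 2 ∂μ := by
  rw [← real_inner_self_eq_norm_sq, inner_toLp]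
  simp only [real_inner_self_eq_norm_sq]

theorem tendsto_integral_norm_sq {f : ℕ → α → F} {g : α → F} (hf : ∀ n, MemLp (f n) 2 μ)
    (hg : MemLp g 2 μ) (h : Tendsto (fun n => eLpNorm (f n - g) 2 μ) atTop (𝓝 0)) :
    Tendsto (fun n => ∫ x, ‖f n x‖ ^ 2 ∂μ) atTop (𝓝 (∫ x, ‖g x‖ ^ 2 ∂μ)) := by
  have h1 := (Lp.tendsto_Lp_iff_tendsto_eLpNorm'' f hf g hg).2 h
  have h2 := h1.norm.pow 2
  simpa only [norm_toLp_sq] using h2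

theorem tendsto_integral_of_tendsto_eLpNorm_two [IsFiniteMeasure μ] {f : ℕ → α → ℝ} {g : α → ℝ}
    (hf : ∀ n, MemLp (f n) 2 μ) (hg : MemLp g 2 μ)
    (h : Tendsto (fun n => eLpNorm (f n - g) 2 μ) atTop (𝓝 0)) :
    Tendsto (fun n => ∫ x, f n x ∂μ) atTop (𝓝 (∫ x, g x ∂μ)) := by
  have h1 := (Lp.tendsto_Lp_iff_tendsto_eLpNorm'' f hf g hg).2 h
  have hc : MemLp (fun _ : α => (1 : ℝ)) 2 μ := memLp_const 1
  have h2 := (tendsto_const_nhds (x := hc.toLp _)).inner (𝕜 := ℝ) h1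
  simp only [inner_toLp] at h2
  simpa using h2

end L2

/-- The unnormalised Gaussian measure of precision `k` centred at `c`, with density `weight k c`. It
is finite for `k > 0`. -/
noncomputable def gaussianMeasure {N : ℕ} (k : ℝ) (c : EuclideanSpace ℝ (Fin N)) :
    Measure (EuclideanSpace ℝ (Fin N)) :=
  volume.withDensity fun x => ENNReal.ofReal (weight k c x)

theorem measurable_ofReal_weight {N : ℕ} (k : ℝ) (c : EuclideanSpace ℝ (Fin N)) :
    Measurable fun x => ENNReal.ofReal (weight k c x) :=
  (continuous_weight k c).measurable.ennreal_ofReal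

theorem setIntegral_gaussianMeasure {N : ℕ} (k : ℝ) (c : EuclideanSpace ℝ (Fin N))
    {P : Set (EuclideanSpace ℝ (Fin N))} (hP : MeasurableSet P)
    (f : EuclideanSpace ℝ (Fin N) → ℝ) :
    ∫ x in P, f x ∂gaussianMeasure k c = ∫ x in P, f x * weight k c x := by
  rw [gaussianMeasure, setIntegral_withDensity_eq_setIntegral_toReal_smul
    (measurable_ofReal_weight k c) (ae_of_all _ fun _ => ENNReal.ofReal_lt_top) _ hP]
  simp [ENNReal.toReal_ofReal (weight_pos k c _).le, mul_comm]

theorem gaussianMeasure_le_volume {N : ℕ} {k : ℝ} (hk : 0 ≤ k) (c : EuclideanSpace ℝ (Fin N)) :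
    gaussianMeasure k c ≤ volume := by
  conv_rhs => rw [← withDensity_one (μ := (volume : Measure (EuclideanSpace ℝ (Fin N))))]
  refine withDensity_mono (ae_of_all _ fun x => ?_)
  simpa using weight_le_one hk c x

theorem integrable_weight {N : ℕ} {k : ℝ} (hk : 0 < k) (c : EuclideanSpace ℝ (Fin N)) :
    Integrable (weight k c) := by
  have h := GaussianFourier.integrable_cexp_neg_mul_sq_norm_add (b := ((k / 2 : ℝ) : ℂ))
    (V := EuclideanSpace ℝ (Fin N)) (by simpa using hk) 0 0
  have h1 : Integrable (fun x : EuclideanSpace ℝ (Fin N) => Real.exp (-(k / 2) * ‖x‖ ^ 2)) := by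
    refine h.re.congr (ae_of_all _ fun x => ?_)
    simp only [zero_mul, add_zero]
    rw [← Complex.ofReal_neg, ← Complex.ofReal_pow, ← Complex.ofReal_mul, ← Complex.ofReal_exp]
    exact Complex.ofReal_re _
  exact h1.comp_sub_right c

theorem isFiniteMeasure_gaussianMeasure {N : ℕ} {k : ℝ} (hk : 0 < k)
    (c : EuclideanSpace ℝ (Fin N)) : IsFiniteMeasure (gaussianMeasure k c) :=
  isFiniteMeasure_withDensity_ofReal (integrable_weight hk c).2

/-- Any open convex set is exhausted by bounded open convex sets with closure inside: shrink
`Ω ∩ ball x₀ (n + 1)` towards `x₀` by a factor that tends to one. -/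
theorem exists_convex_exhaustion {E : Type*} [NormedAddCommGroup E] [NormedSpace ℝ E] {Ω : Set E}
    (hc : Convex ℝ Ω) (ho : IsOpen Ω) {x₀ : E} (hx₀ : x₀ ∈ Ω) :
    ∃ Q : ℕ → Set E, Monotone Q ∧ (∀ n, Convex ℝ (Q n)) ∧ (∀ n, IsOpen (Q n)) ∧
      (∀ n, Bornology.IsBounded (Q n)) ∧ (∀ n, closure (Q n) ⊆ Ω) ∧ (∀ n, x₀ ∈ Q n) ∧
      ⋃ n, Q n = Ω := by
  let s : ℕ → ℝ := fun n => 1 + 1 / ((n : ℝ) + 1)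
  have hs1 : ∀ n, 1 < s n := fun n => by
    simp only [s]; linarith [Nat.one_div_pos_of_nat (α := ℝ) (n := n)]
  have hs0 : ∀ n, 0 < s n := fun n => one_pos.trans (hs1 n)
  have hsa : Antitone s := fun m n hmn => by
    simp only [s]; gcongr
  let T : ℕ → E → E := fun n => AffineMap.homothety x₀ (s n)
  have hT : ∀ n x, T n x = s n • (x - x₀) + x₀ := fun n x => by
    simp [T, AffineMap.homothety_apply]
  have hTc : ∀ n, Continuous (T n) := fun n => by
    have : T n = fun x => s n • (x - x₀) + x₀ := funext (hT n)
    rw [this]; fun_prop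
  -- `x` lies on the segment from `x₀` to its dilation
  have hseg : ∀ (r : ℝ), 1 ≤ r → ∀ z, z = (1 - 1 / r) • x₀ + (1 / r) • (r • (z - x₀) + x₀) := by
    intro r hr z
    have : r ≠ 0 := by positivity
    rw [smul_add, smul_smul, one_div_mul_cancel this]
    module
  have hstar : ∀ {m n : ℕ}, m ≤ n → ∀ {A : Set E}, Convex ℝ A → x₀ ∈ A →
      ∀ x, T m x ∈ A → T n x ∈ A := by
    intro m n hmn A hA hxA x hx
    have h1 : 0 ≤ s n / s m := (div_pos (hs0 n) (hs0 m)).le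
    have h2 : s n / s m ≤ 1 := (div_le_one (hs0 m)).2 (hsa hmn)
    have e : T n x = (1 - s n / s m) • x₀ + (s n / s m) • T m x := by
      rw [hT, hT, smul_add, smul_smul, div_mul_cancel₀ _ (hs0 m).ne']
      module
    rw [e]
    exact hA hxA hx (by linarith) h1 (by ring)
  have hB : ∀ n : ℕ, Convex ℝ (Ω ∩ Metric.ball x₀ (n + 1)) := fun n =>
    hc.inter (convex_ball _ _)
  have hxB : ∀ n : ℕ, x₀ ∈ Ω ∩ Metric.ball x₀ (n + 1) := fun n =>
    ⟨hx₀, Metric.mem_ball_self (by positivity)⟩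
  have hTx : ∀ n, T n x₀ = x₀ := fun n => by simp [hT]
  refine ⟨fun n => T n ⁻¹' (Ω ∩ Metric.ball x₀ (n + 1)), ?_, fun n => ?_, fun n => ?_,
    fun n => ?_, fun n x hx => ?_, fun n => ?_, ?_⟩
  · intro m n hmn x hx
    have h1 : T n x ∈ Ω ∩ Metric.ball x₀ (m + 1) := hstar hmn (hB m) (hxB m) x hx
    exact ⟨h1.1, Metric.ball_subset_ball (by gcongr) h1.2⟩
  · exact (hB n).affine_preimage _
  · exact (ho.inter Metric.isOpen_ball).preimage (hTc n)
  · refine (Metric.isBounded_ball (x := x₀) (r := n + 1)).subset fun x hx => ?_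
    have h1 : dist (T n x) x₀ < n + 1 := hx.2
    rw [hT, dist_add_self_left, norm_smul, Real.norm_of_nonneg (hs0 n).le] at h1
    rw [Metric.mem_ball, dist_eq_norm]
    nlinarith [hs1 n, norm_nonneg (x - x₀)]
  · have h1 : T n x ∈ closure Ω :=
      closure_mono (image_preimage_subset (T n) _ |>.trans inter_subset_left)
        (image_closure_subset_closure_image (hTc n) ⟨x, hx, rfl⟩)
    have h2 := hc.openSegment_interior_closure_subset_interior
      (x := x₀) (by rwa [ho.interior_eq]) h1
    rw [ho.interior_eq] at h2
    refine h2 ⟨1 - 1 / s n, 1 / s n, ?_, by have := hs0 n; positivity, by ring, ?_⟩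
    · rw [sub_pos, div_lt_one (hs0 n)]; exact hs1 n
    · rw [hT]; exact (hseg _ (hs1 n).le x).symm
  · have h1 : T n x₀ ∈ Ω ∩ Metric.ball x₀ (n + 1) := by rw [hTx]; exact hxB n
    exact h1
  · refine Subset.antisymm (iUnion_subset fun n x hx => ?_) fun x hx => ?_
    · have h1 : T n x ∈ Ω := hx.1
      rw [hseg _ (hs1 n).le x, ← hT]
      exact hc hx₀ h1 (by rw [sub_nonneg, div_le_one (hs0 n)]; exact (hs1 n).le)
        (by have := hs0 n; positivity) (by ring)
    · have hlim : Tendsto (fun n => T n x) atTop (𝓝 x) := by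
        have h1 : Tendsto s atTop (𝓝 (1 + 0)) :=
          tendsto_const_nhds.add tendsto_one_div_add_atTop_nhds_zero_nat
        have h2 := (h1.smul_const (x - x₀)).add_const x₀
        simp only [add_zero, one_smul, sub_add_cancel] at h2
        exact h2.congr fun n => (hT n x).symm
      have ev1 := hlim.eventually (ho.mem_nhds hx)
      have ev2 : ∀ᶠ n in atTop, dist (T n x) x₀ < dist x x₀ + 1 :=
        (hlim.dist tendsto_const_nhds).eventually_lt_const (by linarith)
      have ev3 : ∀ᶠ n : ℕ in atTop, dist x x₀ ≤ n := eventually_ge_atTop ⌈dist x x₀⌉₊ |>.mono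
        fun n hn => (Nat.le_ceil _).trans (by exact_mod_cast hn)
      obtain ⟨n, h1, h2, h3⟩ := (ev1.and (ev2.and ev3)).exists
      exact mem_iUnion.2 ⟨n, h1, by rw [Metric.mem_ball]; linarith⟩

/-- The Poincaré inequality on bounded convex sets compactly contained in the domain, obtained from
the smooth case by mollification. The domain itself need not be convex. -/
theorem poincare_of_closure_subset {N : ℕ} {Ω : Set (EuclideanSpace ℝ (Fin N))}
    (hΩ : IsOpen Ω) {u : EuclideanSpace ℝ (Fin N) → ℝ}
    {G : EuclideanSpace ℝ (Fin N) → EuclideanSpace ℝ (Fin N)} (h : HasWeakGradient Ω u G)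
    (hu : ∀ K ⊆ Ω, IsCompact K → MemLp u 2 (volume.restrict K))
    (hG : ∀ K ⊆ Ω, IsCompact K → MemLp G 2 (volume.restrict K))
    {P : Set (EuclideanSpace ℝ (Fin N))} (hPc : Convex ℝ P) (hPm : MeasurableSet P)
    (hPb : Bornology.IsBounded P) (hPΩ : closure P ⊆ Ω) {k : ℝ} (hk : 0 < k)
    (c : EuclideanSpace ℝ (Fin N)) :
    (∫ _ in P, (1 : ℝ) ∂gaussianMeasure k c) * (∫ x in P, ‖u x‖ ^ 2 ∂gaussianMeasure k c) -
        (∫ x in P, u x ∂gaussianMeasure k c) ^ 2 ≤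
      1 / k * ((∫ _ in P, (1 : ℝ) ∂gaussianMeasure k c) *
        ∫ x in P, ‖G x‖ ^ 2 ∂gaussianMeasure k c) := by
  have hK := hPb.isCompact_closure
  obtain ⟨v, H, hv, hH, hvH, hvu, hHG⟩ := h.exists_smooth_approx hΩ hu hG hK hPΩ
  set ν := (gaussianMeasure k c).restrict P with hν
  have : IsFiniteMeasure (gaussianMeasure k c) := isFiniteMeasure_gaussianMeasure hk c
  have hνle : ν ≤ volume.restrict (closure P) :=
    Measure.restrict_mono subset_closure (gaussianMeasure_le_volume hk.le c)
  have cont : ∀ {F : Type} [NormedAddCommGroup F] {f : EuclideanSpace ℝ (Fin N) → F},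
      [SecondCountableTopologyEither (EuclideanSpace ℝ (Fin N)) F] →
      Continuous f → MemLp f 2 ν := by
    intro F _ f _ hf
    obtain ⟨C, hC⟩ := hK.exists_bound_of_continuousOn hf.continuousOn
    refine MemLp.of_bound hf.aestronglyMeasurable C ?_
    filter_upwards [ae_restrict_mem hPm] with x hx using hC x (subset_closure hx)
  have lim0 : ∀ {F : Type} [NormedAddCommGroup F] {f : ℕ → EuclideanSpace ℝ (Fin N) → F}
      {g : EuclideanSpace ℝ (Fin N) → F},
      Tendsto (fun n => eLpNorm (f n - g) 2 (volume.restrict (closure P))) atTop (𝓝 0) →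
      Tendsto (fun n => eLpNorm (f n - g) 2 ν) atTop (𝓝 0) := fun hf =>
    tendsto_of_tendsto_of_tendsto_of_le_of_le tendsto_const_nhds hf (fun _ => zero_le)
      fun n => eLpNorm_mono_measure _ hνle
  have hu2 : MemLp u 2 ν := (hu _ hPΩ hK).mono_measure hνle
  have hG2 : MemLp G 2 ν := (hG _ hPΩ hK).mono_measure hνle
  have l1 := tendsto_integral_norm_sq (fun n => cont (hv n).continuous) hu2 (lim0 hvu)
  have l2 := tendsto_integral_norm_sq (fun n => cont (hH n)) hG2 (lim0 hHG)
  have l3 := tendsto_integral_of_tendsto_eLpNorm_two (fun n => cont (hv n).continuous) hu2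
    (lim0 hvu)
  refine le_of_tendsto_of_tendsto' ((l1.const_mul _).sub (l3.pow 2))
    ((l2.const_mul _).const_mul _) fun n => ?_
  have main := poincare_smooth hPc hPm hPb hk c (hv n)
  simp only [hν]
  rw [setIntegral_gaussianMeasure k c hPm, setIntegral_gaussianMeasure k c hPm,
    setIntegral_gaussianMeasure k c hPm, setIntegral_gaussianMeasure k c hPm]
  simp only [one_mul, Real.norm_eq_abs, sq_abs]
  refine main.trans_eq ?_
  congr 2
  refine setIntegral_congr_fun hPm fun x hx => ?_
  have e : fderiv ℝ (v n) x = innerSL ℝ (H n x) := by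
    ext y; simpa using hvH n x (subset_closure hx) y
  simp only [e, innerSL_apply_norm]

/-- The sharp Poincaré inequality on an arbitrary convex measurable subset `P` of the convex domain:
apply the bounded case to the intersections of `P` with an exhaustion of the domain. -/
theorem HasWeakGradient.poincare {N : ℕ} {Ω : Set (EuclideanSpace ℝ (Fin N))}
    (hΩ : IsOpen Ω) (hΩc : Convex ℝ Ω) {u : EuclideanSpace ℝ (Fin N) → ℝ}
    {G : EuclideanSpace ℝ (Fin N) → EuclideanSpace ℝ (Fin N)} (h : HasWeakGradient Ω u G)
    (hu : ∀ K ⊆ Ω, IsCompact K → MemLp u 2 (volume.restrict K))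
    (hG : ∀ K ⊆ Ω, IsCompact K → MemLp G 2 (volume.restrict K))
    {P : Set (EuclideanSpace ℝ (Fin N))} (hPc : Convex ℝ P) (hPm : MeasurableSet P)
    (hPΩ : P ⊆ Ω) {k : ℝ} (hk : 0 < k) (c : EuclideanSpace ℝ (Fin N))
    (hu2 : MemLp u 2 ((gaussianMeasure k c).restrict P))
    (hG2 : MemLp G 2 ((gaussianMeasure k c).restrict P)) :
    (∫ _ in P, (1 : ℝ) ∂gaussianMeasure k c) * (∫ x in P, ‖u x‖ ^ 2 ∂gaussianMeasure k c) -
        (∫ x in P, u x ∂gaussianMeasure k c) ^ 2 ≤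
      1 / k * ((∫ _ in P, (1 : ℝ) ∂gaussianMeasure k c) *
        ∫ x in P, ‖G x‖ ^ 2 ∂gaussianMeasure k c) := by
  rcases P.eq_empty_or_nonempty with rfl | ⟨x₀, hx₀⟩
  · simp
  have : IsFiniteMeasure (gaussianMeasure k c) := isFiniteMeasure_gaussianMeasure hk c
  obtain ⟨Q, hQm, hQc, hQo, hQb, hQΩ, -, hQU⟩ := exists_convex_exhaustion hΩc hΩ (hPΩ hx₀)
  have hU : ⋃ n, P ∩ Q n = P := by rw [← inter_iUnion, hQU, inter_eq_left.2 hPΩ]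
  have lim : ∀ f : EuclideanSpace ℝ (Fin N) → ℝ, IntegrableOn f P (gaussianMeasure k c) →
      Tendsto (fun n => ∫ x in P ∩ Q n, f x ∂gaussianMeasure k c) atTop
        (𝓝 (∫ x in P, f x ∂gaussianMeasure k c)) := by
    intro f hf
    have := tendsto_setIntegral_of_monotone (f := f) (μ := gaussianMeasure k c)
      (s := fun n => P ∩ Q n) (fun n => hPm.inter (hQo n).measurableSet)
      (fun m n hmn => inter_subset_inter_right P (hQm hmn)) (by rwa [hU])
    rwa [hU] at this
  have i1 : IntegrableOn (fun _ => (1 : ℝ)) P (gaussianMeasure k c) := integrableOn_const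
  have i2 : IntegrableOn (fun x => ‖u x‖ ^ 2) P (gaussianMeasure k c) :=
    hu2.integrable_norm_pow two_ne_zero
  have i3 : IntegrableOn u P (gaussianMeasure k c) := hu2.integrable (by norm_num)
  have i4 : IntegrableOn (fun x => ‖G x‖ ^ 2) P (gaussianMeasure k c) :=
    hG2.integrable_norm_pow two_ne_zero
  refine le_of_tendsto_of_tendsto' (((lim _ i1).mul (lim _ i2)).sub ((lim _ i3).pow 2))
    (((lim _ i1).mul (lim _ i4)).const_mul _) fun n => ?_
  exact poincare_of_closure_subset hΩ h hu hG (hPc.inter (hQc n))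
    (hPm.inter (hQo n).measurableSet) ((hQb n).subset inter_subset_right)
    ((closure_mono inter_subset_right).trans (hQΩ n)) hk c

/-! ### Decay at infinity -/

section

open scoped ENNReal

/-- On a set star-shaped about the origin the flux of `φ x` through the boundary is nonnegative:
the derivative at `s = 1` of the monotone function `s ↦ ∫_{sQ} φ`. -/
theorem integral_div_radial_nonneg_zero {N : ℕ} {Q : Set (EuclideanSpace ℝ (Fin N))}
    (hQm : MeasurableSet Q) (hQb : Bornology.IsBounded Q) (hQs : StarConvex ℝ 0 Q)
    {φ : EuclideanSpace ℝ (Fin N) → ℝ} (hφ : ContDiff ℝ 1 φ) (hφ0 : ∀ x, 0 ≤ φ x) :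
    0 ≤ ∫ x in Q, (N * φ x + fderiv ℝ φ x x) := by
  have hφc : Continuous φ := hφ.continuous
  have hdc : Continuous (fderiv ℝ φ) := hφ.continuous_fderiv one_ne_zero
  have int : ∀ {f : EuclideanSpace ℝ (Fin N) → ℝ}, Continuous f → IntegrableOn f Q := fun h =>
    integrableOn_of_continuous_of_isBounded h hQb
  obtain ⟨R, hR⟩ := hQb.subset_closedBall 0
  obtain ⟨C, hC⟩ := (isCompact_closedBall (0 : EuclideanSpace ℝ (Fin N))
    (2 * R)).exists_bound_of_continuousOn hdc.continuousOn
  have hJ : HasDerivAt (fun s : ℝ => ∫ x in Q, φ (s • x))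
      (∫ x in Q, fderiv ℝ φ ((1 : ℝ) • x) x) 1 := by
    refine (hasDerivAt_integral_of_dominated_loc_of_deriv_le (μ := volume.restrict Q)
      (F := fun (s : ℝ) x => φ (s • x)) (F' := fun (s : ℝ) x => fderiv ℝ φ (s • x) x)
      (s := Icc 0 2) (bound := fun _ => C * R) (x₀ := 1)
      (Icc_mem_nhds (by norm_num) (by norm_num)) ?_ ?_ ?_ ?_ ?_ ?_).2
    · exact Eventually.of_forall fun s =>
        (by fun_prop : Continuous fun x => φ (s • x)).aestronglyMeasurable
    · exact int (by fun_prop)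
    · have : Continuous fun x => fderiv ℝ φ ((1 : ℝ) • x) x := by fun_prop
      exact this.aestronglyMeasurable
    · filter_upwards [ae_restrict_mem hQm] with x hx s hs
      have hxR : ‖x‖ ≤ R := by simpa using hR hx
      have hsx : s • x ∈ Metric.closedBall (0 : EuclideanSpace ℝ (Fin N)) (2 * R) := by
        rw [mem_closedBall_zero_iff, norm_smul, Real.norm_of_nonneg hs.1]
        exact mul_le_mul hs.2 hxR (norm_nonneg _) (by norm_num)
      have h1 := hC _ hsx
      exact ((fderiv ℝ φ (s • x)).le_opNorm x).trans
        (mul_le_mul h1 hxR (norm_nonneg _) ((norm_nonneg _).trans h1))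
    · exact int continuous_const
    · refine ae_of_all _ fun x s _ => ?_
      have h1 : HasDerivAt (fun s : ℝ => s • x) x s := by
        simpa using (hasDerivAt_id s).smul_const x
      exact ((hφ.differentiable one_ne_zero (s • x)).hasFDerivAt.comp_hasDerivAt s h1)
  have hF : HasDerivAt (fun s : ℝ => s ^ N * ∫ x in Q, φ (s • x))
      (∫ x in Q, (N * φ x + fderiv ℝ φ x x)) 1 := by
    -- the product is `∫_{sQ} φ`, by the change of variables `x ↦ s • x`
    have h1 := (hasDerivAt_pow N (1 : ℝ)).mul hJ
    have e : ∫ x in Q, (N * φ x + fderiv ℝ φ x x) =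
        N * (1 : ℝ) ^ (N - 1) * (∫ x in Q, φ ((1 : ℝ) • x)) +
          (1 : ℝ) ^ N * ∫ x in Q, fderiv ℝ φ ((1 : ℝ) • x) x := by
      rw [integral_add (int (by fun_prop)) (int (by fun_prop)), integral_const_mul]
      simp
    rw [e]
    exact h1
  have hmono : ∀ s ∈ Ioo (0 : ℝ) 1, s ^ N * ∫ x in Q, φ (s • x) ≤
      (1 : ℝ) ^ N * ∫ x in Q, φ ((1 : ℝ) • x) := by
    intro s hs
    rw [Measure.setIntegral_comp_smul_of_pos _ _ _ hs.1, finrank_euclideanSpace_fin, smul_eq_mul,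
      mul_inv_cancel_left₀ (pow_ne_zero _ hs.1.ne')]
    simp only [one_pow, one_mul, one_smul]
    refine setIntegral_mono_set (int hφc) (ae_of_all _ hφ0) (LE.le.eventuallyLE ?_)
    rintro _ ⟨x, hx, rfl⟩
    exact hQs.smul_mem hx hs.1.le hs.2.le
  -- the difference quotients from the left are nonnegative
  have hslope := (hasDerivAt_iff_tendsto_slope.1 hF).mono_left
    (nhdsWithin_mono 1 (fun s (hs : s ∈ Iio (1 : ℝ)) => ne_of_lt hs))
  refine ge_of_tendsto hslope ?_
  filter_upwards [Ioo_mem_nhdsLT (zero_lt_one' ℝ)] with s hs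
  rw [slope_def_field]
  exact div_nonneg_of_nonpos (sub_nonpos.2 (hmono s hs)) (by linarith [hs.2])

theorem integral_div_radial_nonneg {N : ℕ} {Q : Set (EuclideanSpace ℝ (Fin N))}
    (hQm : MeasurableSet Q) (hQb : Bornology.IsBounded Q) {x₀ : EuclideanSpace ℝ (Fin N)}
    (hQs : StarConvex ℝ x₀ Q)
    {φ : EuclideanSpace ℝ (Fin N) → ℝ} (hφ : ContDiff ℝ 1 φ) (hφ0 : ∀ x, 0 ≤ φ x) :
    0 ≤ ∫ x in Q, (N * φ x + fderiv ℝ φ x (x - x₀)) := by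
  have hmp : MeasurePreserving (fun y => y + x₀)
    (volume : Measure (EuclideanSpace ℝ (Fin N))) volume := measurePreserving_add_right _ x₀
  have hemb : MeasurableEmbedding (fun y : EuclideanSpace ℝ (Fin N) => y + x₀) :=
    measurableEmbedding_addRight x₀
  rw [← hmp.setIntegral_preimage_emb hemb]
  have h1 := integral_div_radial_nonneg_zero (Q := (fun y => y + x₀) ⁻¹' Q)
    (hemb.measurable hQm) ?_ ?_ (φ := fun y => φ (y + x₀))
    (hφ.comp (contDiff_id.add contDiff_const))
    (fun x => hφ0 _)
  · simpa only [fderiv_comp_add_right, add_sub_cancel_right] using h1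
  · obtain ⟨R, hR⟩ := hQb.subset_closedBall x₀
    refine (Metric.isBounded_closedBall (x := 0) (r := R)).subset fun y hy => ?_
    have := hR hy
    simpa [dist_eq_norm] using this
  · intro y hy a b ha hb hab
    have := hQs hy ha hb hab
    simp only [mem_preimage, smul_zero, zero_add]
    convert this using 1
    have : a = 1 - b := by linarith
    subst this
    module

theorem fderiv_weight_apply {N : ℕ} (k : ℝ) (c x y : EuclideanSpace ℝ (Fin N)) :
    fderiv ℝ (weight k c) x y = -k * ⟪x - c, y⟫ * weight k c x := by
  have h1 : HasFDerivAt (fun x : EuclideanSpace ℝ (Fin N) => x - c)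
      (ContinuousLinearMap.id ℝ _) x := (hasFDerivAt_id x).sub_const c
  have h2 := (h1.norm_sq.const_mul (-(k / 2))).exp
  have h3 : HasFDerivAt (weight k c) _ x := h2
  rw [h3.fderiv]
  simp [weight, inner_sub_left]
  ring

/-- A weighted Hardy-type estimate, which prevents concentration of mass at infinity: the flux of
`v² · weight` through the boundary is nonnegative, and the derivative of the weight produces the
quadratic factor on the left with a favourable sign. -/
theorem integral_norm_sq_mul_le_of_smooth {N : ℕ} {Q : Set (EuclideanSpace ℝ (Fin N))}
    (hQm : MeasurableSet Q) (hQb : Bornology.IsBounded Q) {x₀ : EuclideanSpace ℝ (Fin N)}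
    (hQs : StarConvex ℝ x₀ Q) {v : EuclideanSpace ℝ (Fin N) → ℝ} (hv : ContDiff ℝ 2 v) :
    ∫ x in Q, ‖x - x₀‖ ^ 2 * v x ^ 2 * weight 1 0 x ≤
      (4 * N + 2 * ‖x₀‖ ^ 2) * (∫ x in Q, v x ^ 2 * weight 1 0 x) +
        16 * ∫ x in Q, ‖fderiv ℝ v x‖ ^ 2 * weight 1 0 x := by
  have hvc : Continuous v := hv.continuous
  have hdc : Continuous (fderiv ℝ v) := hv.continuous_fderiv two_ne_zero
  have int : ∀ {f : EuclideanSpace ℝ (Fin N) → ℝ}, Continuous f → IntegrableOn f Q := fun h =>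
    integrableOn_of_continuous_of_isBounded h hQb
  have hφ : ContDiff ℝ 1 fun x => v x ^ 2 * weight 1 0 x :=
    ((hv.of_le one_le_two).pow 2).mul (contDiff_weight 1 0)
  have h0 := integral_div_radial_nonneg hQm hQb hQs hφ
    (fun x => mul_nonneg (sq_nonneg _) (weight_pos _ _ _).le)
  have hder : ∀ x y, fderiv ℝ (fun x => v x ^ 2 * weight 1 0 x) x y =
      (2 * v x * fderiv ℝ v x y - v x ^ 2 * ⟪x, y⟫) * weight 1 0 x := by
    intro x y
    have hd : DifferentiableAt ℝ v x := hv.differentiable two_ne_zero x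
    have hw : DifferentiableAt ℝ (weight 1 0) x :=
      (contDiff_weight (n := 1) (1 : ℝ) (0 : EuclideanSpace ℝ (Fin N))).differentiable one_ne_zero x
    have hd2 : HasFDerivAt (fun x => v x ^ 2) _ x := hd.hasFDerivAt.pow 2
    have hd3 := hd2.mul hw.hasFDerivAt
    have hd4 : HasFDerivAt (fun x => v x ^ 2 * weight 1 0 x) _ x := hd3
    rw [hd4.fderiv]
    simp [fderiv_weight_apply]
    ring
  simp only [hder] at h0
  have hpt : ∀ x, N * (v x ^ 2 * weight 1 0 x) +
      (2 * v x * fderiv ℝ v x (x - x₀) - v x ^ 2 * ⟪x, x - x₀⟫) * weight 1 0 x ≤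
      ((N + ‖x₀‖ ^ 2 / 2) * (v x ^ 2 * weight 1 0 x) +
        4 * (‖fderiv ℝ v x‖ ^ 2 * weight 1 0 x)) -
        1 / 4 * (‖x - x₀‖ ^ 2 * v x ^ 2 * weight 1 0 x) := by
    intro x
    have hw := weight_pos 1 0 x
    have e : ⟪x, x - x₀⟫ = (‖x‖ ^ 2 + ‖x - x₀‖ ^ 2 - ‖x₀‖ ^ 2) / 2 := by
      have := norm_sub_sq_real x (x - x₀)
      rw [sub_sub_cancel] at this
      linarith
    have h1 : v x * fderiv ℝ v x (x - x₀) ≤ |v x| * (‖fderiv ℝ v x‖ * ‖x - x₀‖) := by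
      refine (le_abs_self _).trans ?_
      rw [abs_mul]
      gcongr
      exact (fderiv ℝ v x).le_opNorm _
    set p := ‖fderiv ℝ v x‖
    set d := ‖x - x₀‖
    have h2 : |v x| ^ 2 = v x ^ 2 := sq_abs _
    have h3 : 2 * (v x * fderiv ℝ v x (x - x₀)) ≤ 1 / 4 * (d ^ 2 * v x ^ 2) + 4 * p ^ 2 := by
      nlinarith [sq_nonneg (1 / 2 * (d * |v x|) - 2 * p)]
    have h4 : N * v x ^ 2 + (2 * v x * fderiv ℝ v x (x - x₀) - v x ^ 2 * ⟪x, x - x₀⟫) ≤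
        (N + ‖x₀‖ ^ 2 / 2) * v x ^ 2 + 4 * p ^ 2 - 1 / 4 * (d ^ 2 * v x ^ 2) := by
      rw [e]
      nlinarith [mul_nonneg (sq_nonneg (v x)) (sq_nonneg ‖x‖)]
    have h5 := mul_le_mul_of_nonneg_right h4 hw.le
    linarith
  have h1 := h0.trans
    (integral_mono (μ := volume.restrict Q) (int (by fun_prop)) (int (by fun_prop)) hpt)
  rw [integral_sub (int (by fun_prop)) (int (by fun_prop)),
    integral_add (int (by fun_prop)) (int (by fun_prop)), integral_const_mul,
    integral_const_mul, integral_const_mul] at h1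
  linarith

/-- Uniform smallness at infinity of functions bounded in `H¹`. -/
theorem HasWeakGradient.tail_estimate {N : ℕ} {Ω : Set (EuclideanSpace ℝ (Fin N))}
    (hΩ : IsOpen Ω) (hΩc : Convex ℝ Ω) {u : EuclideanSpace ℝ (Fin N) → ℝ}
    {G : EuclideanSpace ℝ (Fin N) → EuclideanSpace ℝ (Fin N)} (h : HasWeakGradient Ω u G)
    (hu : ∀ K ⊆ Ω, IsCompact K → MemLp u 2 (volume.restrict K))
    (hG : ∀ K ⊆ Ω, IsCompact K → MemLp G 2 (volume.restrict K))
    {x₀ : EuclideanSpace ℝ (Fin N)} (hx₀ : x₀ ∈ Ω)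
    (hu2 : MemLp u 2 ((gaussianMeasure 1 0).restrict Ω))
    (hG2 : MemLp G 2 ((gaussianMeasure 1 0).restrict Ω)) {R : ℝ} (hR : 0 ≤ R) :
    R ^ 2 * ∫ x in Ω \ Metric.ball x₀ R, ‖u x‖ ^ 2 ∂gaussianMeasure 1 0 ≤
      (4 * N + 2 * ‖x₀‖ ^ 2) * (∫ x in Ω, ‖u x‖ ^ 2 ∂gaussianMeasure 1 0) +
        16 * ∫ x in Ω, ‖G x‖ ^ 2 ∂gaussianMeasure 1 0 := by
  obtain ⟨Q, hQm, hQc, hQo, hQb, hQΩ, hxQ, hQU⟩ := exists_convex_exhaustion hΩc hΩ hx₀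
  have : IsFiniteMeasure (gaussianMeasure 1 (0 : EuclideanSpace ℝ (Fin N))) :=
    isFiniteMeasure_gaussianMeasure one_pos 0
  have i2 : IntegrableOn (fun x => ‖u x‖ ^ 2) Ω (gaussianMeasure 1 0) :=
    hu2.integrable_norm_pow two_ne_zero
  have i4 : IntegrableOn (fun x => ‖G x‖ ^ 2) Ω (gaussianMeasure 1 0) :=
    hG2.integrable_norm_pow two_ne_zero
  have hBm : MeasurableSet (Metric.ball x₀ R) := Metric.isOpen_ball.measurableSet
  have hU : ⋃ n, Q n \ Metric.ball x₀ R = Ω \ Metric.ball x₀ R := by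
    rw [← iUnion_sdiff, hQU]
  have lim := tendsto_setIntegral_of_monotone (f := fun x => ‖u x‖ ^ 2)
      (μ := gaussianMeasure 1 0) (s := fun n => Q n \ Metric.ball x₀ R)
      (fun n => (hQo n).measurableSet.diff hBm)
      (fun m n hmn => sdiff_subset_sdiff_left (hQm hmn))
      (by rw [hU]; exact i2.mono_set sdiff_subset)
  rw [hU] at lim
  refine le_of_tendsto' (lim.const_mul _) fun n => ?_
  have hQΩ' : Q n ⊆ Ω := subset_closure.trans (hQΩ n)
  have hQm' : MeasurableSet (Q n) := (hQo n).measurableSet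
  have hK := (hQb n).isCompact_closure
  obtain ⟨v, H, hv, hH, hvH, hvu, hHG⟩ := h.exists_smooth_approx hΩ hu hG hK (hQΩ n)
  set ν := (gaussianMeasure 1 0).restrict (Q n) with hν
  have hνle : ν ≤ volume.restrict (closure (Q n)) :=
    Measure.restrict_mono subset_closure (gaussianMeasure_le_volume zero_le_one 0)
  have hsub : (gaussianMeasure 1 0).restrict (Q n \ Metric.ball x₀ R) ≤ ν :=
    Measure.restrict_mono sdiff_subset le_rfl
  have cont : ∀ {F : Type} [NormedAddCommGroup F] {f : EuclideanSpace ℝ (Fin N) → F},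
      [SecondCountableTopologyEither (EuclideanSpace ℝ (Fin N)) F] →
      Continuous f → MemLp f 2 ν := by
    intro F _ f _ hf
    obtain ⟨C, hC⟩ := hK.exists_bound_of_continuousOn hf.continuousOn
    refine MemLp.of_bound hf.aestronglyMeasurable C ?_
    filter_upwards [ae_restrict_mem hQm'] with x hx using hC x (subset_closure hx)
  have hu2' : MemLp u 2 ν := (hu _ (hQΩ n) hK).mono_measure hνle
  have hG2' : MemLp G 2 ν := (hG _ (hQΩ n) hK).mono_measure hνle
  have sq : ∀ {a : ℕ → ℝ≥0∞} {b : ℕ → ℝ≥0∞}, (∀ n, a n ≤ b n) → Tendsto b atTop (𝓝 0) →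
      Tendsto a atTop (𝓝 0) := fun hab hb =>
    tendsto_of_tendsto_of_tendsto_of_le_of_le tendsto_const_nhds hb (fun _ => zero_le) hab
  have l1 := tendsto_integral_norm_sq (fun n => cont (hv n).continuous) hu2'
    (sq (fun n => eLpNorm_mono_measure _ hνle) hvu)
  have l2 := tendsto_integral_norm_sq (fun n => cont (hH n)) hG2'
    (sq (fun n => eLpNorm_mono_measure _ hνle) hHG)
  have l3 := tendsto_integral_norm_sq (fun n => (cont (hv n).continuous).mono_measure hsub)
    (hu2'.mono_measure hsub)
    (sq (fun n => eLpNorm_mono_measure _ (hsub.trans hνle)) hvu)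
  have key : R ^ 2 * ∫ x in Q n \ Metric.ball x₀ R, ‖u x‖ ^ 2 ∂gaussianMeasure 1 0 ≤
      (4 * N + 2 * ‖x₀‖ ^ 2) * (∫ x in Q n, ‖u x‖ ^ 2 ∂gaussianMeasure 1 0) +
        16 * ∫ x in Q n, ‖G x‖ ^ 2 ∂gaussianMeasure 1 0 := by
    refine le_of_tendsto_of_tendsto' (l3.const_mul _) ((l1.const_mul _).add (l2.const_mul _))
      fun j => ?_
    have main := integral_norm_sq_mul_le_of_smooth hQm' (hQb n)
      ((hQc n).starConvex (hxQ n)) (hv j)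
    have hvc := (hv j).continuous
    have e : ∫ x in Q n, ‖fderiv ℝ (v j) x‖ ^ 2 * weight 1 0 x =
        ∫ x in Q n, ‖H j x‖ ^ 2 * weight 1 0 x := by
      refine setIntegral_congr_fun hQm' fun x hx => ?_
      have e : fderiv ℝ (v j) x = innerSL ℝ (H j x) := by
        ext y; simpa using hvH j x (subset_closure hx) y
      simp only [e, innerSL_apply_norm]
    rw [e] at main
    simp only [hν]
    rw [setIntegral_gaussianMeasure _ _ hQm', setIntegral_gaussianMeasure _ _ hQm',
      setIntegral_gaussianMeasure _ _ (hQm'.diff hBm)]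
    simp only [Real.norm_eq_abs, sq_abs]
    refine le_trans ?_ main
    have int : ∀ {f : EuclideanSpace ℝ (Fin N) → ℝ}, Continuous f → IntegrableOn f (Q n) :=
      fun h => integrableOn_of_continuous_of_isBounded h (hQb n)
    rw [← integral_const_mul]
    calc ∫ x in Q n \ Metric.ball x₀ R, R ^ 2 * (v j x ^ 2 * weight 1 0 x)
        ≤ ∫ x in Q n \ Metric.ball x₀ R, ‖x - x₀‖ ^ 2 * v j x ^ 2 * weight 1 0 x := by
          refine setIntegral_mono_on ((int (by fun_prop)).mono_set sdiff_subset)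
            ((int (by fun_prop)).mono_set sdiff_subset) (hQm'.diff hBm) fun x hx => ?_
          have hd : R ≤ ‖x - x₀‖ := by
            have := hx.2
            rwa [Metric.mem_ball, not_lt, dist_eq_norm] at this
          have hw := weight_pos 1 0 x
          rw [mul_assoc]
          gcongr
      _ ≤ _ := setIntegral_mono_set (int (by fun_prop))
          (ae_of_all _ fun x => mul_nonneg (mul_nonneg (sq_nonneg _) (sq_nonneg _))
            (weight_pos _ _ _).le) (LE.le.eventuallyLE sdiff_subset)
  refine key.trans ?_
  have m1 : ∫ x in Q n, ‖u x‖ ^ 2 ∂gaussianMeasure 1 0 ≤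
      ∫ x in Ω, ‖u x‖ ^ 2 ∂gaussianMeasure 1 0 :=
    setIntegral_mono_set i2 (ae_of_all _ fun x => sq_nonneg _) (LE.le.eventuallyLE hQΩ')
  have m2 : ∫ x in Q n, ‖G x‖ ^ 2 ∂gaussianMeasure 1 0 ≤
      ∫ x in Ω, ‖G x‖ ^ 2 ∂gaussianMeasure 1 0 :=
    setIntegral_mono_set i4 (ae_of_all _ fun x => sq_nonneg _) (LE.le.eventuallyLE hQΩ')
  gcongr

end

/-! ### The direct method in Hilbert space -/

section Minimizer

variable {L L' : Type*} [NormedAddCommGroup L] [InnerProductSpace ℝ L]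
  [NormedAddCommGroup L'] [InnerProductSpace ℝ L']

/-- Completeness along an ultrafilter, with squared norms. -/
theorem exists_tendsto_of_tendsto_norm_sub_sq {M : Type*} [NormedAddCommGroup M] [CompleteSpace M]
    (U : Ultrafilter ℕ) (f : ℕ → M)
    (hf : Tendsto (fun x : ℕ × ℕ => ‖f x.1 - f x.2‖ ^ 2) (U ×ˢ U) (𝓝 0)) :
    ∃ y, Tendsto f U (𝓝 y) := by
  refine CompleteSpace.complete (cauchy_map_iff.2 ⟨U.neBot, ?_⟩)
  rw [tendsto_uniformity_iff_dist_tendsto_zero]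
  have := hf.sqrt
  simp only [Real.sqrt_sq (norm_nonneg _), Real.sqrt_zero] at this
  simpa only [dist_eq_norm] using this

/-- The Euler-Lagrange equation of the Rayleigh quotient. -/
theorem inner_eq_of_isMinimizer (V : Submodule ℝ (L × L')) {lam : ℝ}
    (hmin : ∀ q ∈ V, lam * ‖q.1‖ ^ 2 ≤ ‖q.2‖ ^ 2) {x : L} {y : L'} (hxy : (x, y) ∈ V)
    (hx1 : ‖x‖ = 1) (hy1 : ‖y‖ ^ 2 = lam) {q : L × L'} (hq : q ∈ V) :
    ⟪y, q.2⟫ = lam * ⟪x, q.1⟫ := by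
  set c := ⟪y, q.2⟫ - lam * ⟪x, q.1⟫ with hc
  set d := ‖q.2‖ ^ 2 - lam * ‖q.1‖ ^ 2 with hd
  have hd0 : 0 ≤ d := sub_nonneg.2 (hmin q hq)
  have hvar : ∀ t : ℝ, 0 ≤ 2 * t * c + t ^ 2 * d := by
    intro t
    have h1 := hmin ((x, y) + t • q) (V.add_mem hxy (V.smul_mem t hq))
    simp only [Prod.fst_add, Prod.snd_add, Prod.smul_fst, Prod.smul_snd] at h1
    rw [norm_add_sq_real, norm_add_sq_real, hx1, hy1, real_inner_smul_right,
      real_inner_smul_right, norm_smul, norm_smul, mul_pow, mul_pow, Real.norm_eq_abs,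
      sq_abs] at h1
    rw [hc, hd]
    linarith
  -- for this `t` the sum is negative unless `c = 0`; `d + 1` instead of `d` avoids division by zero
  have h1 := hvar (-c / (d + 1))
  have h2 : 2 * (-c / (d + 1)) * c + (-c / (d + 1)) ^ 2 * d = -(c ^ 2 * (d + 2)) / (d + 1) ^ 2 := by
    field_simp
    ring
  rw [h2, le_div_iff₀ (by positivity)] at h1
  have h3 : c ^ 2 = 0 := by nlinarith [sq_nonneg c]
  have h4 : c = 0 := by simpa using h3
  linarith

/-- The abstract direct method. The subspace `V` stands for pairs (function, gradient); the
hypothesis `hcomp` is a quantitative form of the compactness of the first projection. Along an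
ultrafilter all values of the functionals `θ i` on a minimizing sequence converge, so by `hcomp` the
first components of the sequence are Cauchy, and then so are the second ones. -/
theorem exists_rayleigh_minimizer [CompleteSpace L] [CompleteSpace L'] {ι : Type*}
    (V : Submodule ℝ (L × L')) (hV : IsClosed (V : Set (L × L')))
    (hcomp : ∀ ε > 0, ∃ (s : Finset ι) (θ : ι → L), ∀ p ∈ V,
      ‖p.1‖ ^ 2 ≤ ε * (‖p.1‖ ^ 2 + ‖p.2‖ ^ 2) + ∑ i ∈ s, ⟪θ i, p.1⟫ ^ 2)
    (hne : ∃ p ∈ V, p.1 ≠ 0) :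
    ∃ p ∈ V, ‖p.1‖ = 1 ∧ (∀ q ∈ V, ‖p.2‖ ^ 2 * ‖q.1‖ ^ 2 ≤ ‖q.2‖ ^ 2) ∧
      ∀ q ∈ V, ⟪p.2, q.2⟫ = ‖p.2‖ ^ 2 * ⟪p.1, q.1⟫ := by
  set S : Set ℝ := {r | ∃ p ∈ V, ‖p.1‖ = 1 ∧ ‖p.2‖ ^ 2 = r} with hS
  have hnormalize : ∀ p ∈ V, p.1 ≠ 0 → ‖p.2‖ ^ 2 / ‖p.1‖ ^ 2 ∈ S := by
    intro p hp hp1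
    refine ⟨‖p.1‖⁻¹ • p, V.smul_mem _ hp, ?_, ?_⟩
    · simp [norm_smul, norm_ne_zero_iff.2 hp1]
    · simp [norm_smul, mul_pow, div_eq_inv_mul]
  have hSne : S.Nonempty := by
    obtain ⟨p, hp, hp1⟩ := hne
    exact ⟨_, hnormalize p hp hp1⟩
  have hSb : BddBelow S := ⟨0, by rintro _ ⟨p, -, -, rfl⟩; positivity⟩
  set lam := sInf S with hlam
  have hmin : ∀ q ∈ V, lam * ‖q.1‖ ^ 2 ≤ ‖q.2‖ ^ 2 := by
    intro q hq
    rcases eq_or_ne q.1 0 with h0 | h0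
    · simp [h0]
    · have := csInf_le hSb (hnormalize q hq h0)
      rwa [le_div_iff₀ (by positivity)] at this
  obtain ⟨a, -, ha, haS⟩ := exists_seq_tendsto_sInf hSne hSb
  choose p hpV hp1 hp2 using haS
  -- along a nonprincipal ultrafilter every bounded real sequence converges
  set U : Ultrafilter ℕ := hyperfilter ℕ with hU
  have hUle : (U : Filter ℕ) ≤ atTop := Nat.hyperfilter_le_atTop
  have haU : Tendsto (fun n => ‖(p n).2‖ ^ 2) U (𝓝 lam) := by
    simp only [hp2]
    exact ha.mono_left hUle
  have hweak : ∀ θ : L, ∃ l : ℝ, Tendsto (fun n => ⟪θ, (p n).1⟫) U (𝓝 l) := by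
    intro θ
    have hb : ∀ n, ⟪θ, (p n).1⟫ ∈ Metric.closedBall (0 : ℝ) ‖θ‖ := fun n => by
      rw [mem_closedBall_zero_iff]
      simpa [hp1 n] using norm_inner_le_norm (𝕜 := ℝ) θ (p n).1
    obtain ⟨l, -, hl⟩ := (isCompact_closedBall (0 : ℝ) ‖θ‖).ultrafilter_le_nhds
      (U.map fun n => ⟪θ, (p n).1⟫) (le_principal_iff.2 (mem_map.2 (univ_mem' hb)))
    exact ⟨l, hl⟩
  choose l hl using hweak
  have haf : Tendsto (fun x : ℕ × ℕ => ‖(p x.1).2‖ ^ 2) (U ×ˢ U) (𝓝 lam) :=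
    haU.comp tendsto_fst
  have has : Tendsto (fun x : ℕ × ℕ => ‖(p x.2).2‖ ^ 2) (U ×ˢ U) (𝓝 lam) :=
    haU.comp tendsto_snd
  have hd1 : Tendsto (fun x : ℕ × ℕ => ‖(p x.1).1 - (p x.2).1‖ ^ 2) (U ×ˢ U) (𝓝 0) := by
    have hlam0 : 0 ≤ lam := le_csInf hSne (by rintro _ ⟨p, -, -, rfl⟩; positivity)
    rw [tendsto_order]
    refine ⟨fun b hb => Eventually.of_forall fun x => hb.trans_le (sq_nonneg _), fun ε hε => ?_⟩
    -- `4 + 4 * (lam + 1)` bounds the squared norm of the differences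
    obtain ⟨s, θ, hs⟩ := hcomp (ε / (2 * (4 + 4 * (lam + 1)))) (by positivity)
    have hsum : Tendsto (fun x : ℕ × ℕ =>
        ∑ i ∈ s, (⟪θ i, (p x.1).1⟫ - ⟪θ i, (p x.2).1⟫) ^ 2) (U ×ˢ U)
        (𝓝 (∑ i ∈ s, (l (θ i) - l (θ i)) ^ 2)) :=
      tendsto_finsetSum s fun i _ =>
        (((hl (θ i)).comp tendsto_fst).sub ((hl (θ i)).comp tendsto_snd)).pow 2
    have hsum' := hsum.eventually_lt_const (u := ε / 2) (by simpa using hε)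
    filter_upwards [hsum', haf.eventually_lt_const (lt_add_one lam),
      has.eventually_lt_const (lt_add_one lam)] with x h1 h2 h3
    have h4 := hs (p x.1 - p x.2) (V.sub_mem (hpV _) (hpV _))
    simp only [Prod.fst_sub, Prod.snd_sub, inner_sub_right] at h4
    have h5 := parallelogram_law_with_norm ℝ (p x.1).1 (p x.2).1
    have h6 := parallelogram_law_with_norm ℝ (p x.1).2 (p x.2).2
    rw [hp1, hp1] at h5
    have h7 : ‖(p x.1).1 - (p x.2).1‖ ^ 2 + ‖(p x.1).2 - (p x.2).2‖ ^ 2 ≤ 4 + 4 * (lam + 1) := by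
      nlinarith [mul_self_nonneg ‖(p x.1).1 + (p x.2).1‖, mul_self_nonneg ‖(p x.1).2 + (p x.2).2‖]
    have h8 : ε / (2 * (4 + 4 * (lam + 1))) *
        (‖(p x.1).1 - (p x.2).1‖ ^ 2 + ‖(p x.1).2 - (p x.2).2‖ ^ 2) ≤ ε / 2 := by
      calc _ ≤ ε / (2 * (4 + 4 * (lam + 1))) * (4 + 4 * (lam + 1)) := by gcongr
        _ = ε / 2 := by field_simp
    linarith
  -- the parallelogram law transfers the Cauchy property to the gradients
  have hd2 : Tendsto (fun x : ℕ × ℕ => ‖(p x.1).2 - (p x.2).2‖ ^ 2) (U ×ˢ U) (𝓝 0) := by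
    have hub : Tendsto (fun x : ℕ × ℕ => 2 * ‖(p x.1).2‖ ^ 2 + 2 * ‖(p x.2).2‖ ^ 2 -
        lam * (4 - ‖(p x.1).1 - (p x.2).1‖ ^ 2)) (U ×ˢ U)
        (𝓝 (2 * lam + 2 * lam - lam * (4 - 0))) :=
      ((haf.const_mul 2).add (has.const_mul 2)).sub ((tendsto_const_nhds.sub hd1).const_mul lam)
    have e : 2 * lam + 2 * lam - lam * (4 - 0) = 0 := by ring
    rw [e] at hub
    refine tendsto_of_tendsto_of_tendsto_of_le_of_le tendsto_const_nhds hub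
      (fun _ => sq_nonneg _) fun x => ?_
    have h1 := hmin (p x.1 + p x.2) (V.add_mem (hpV _) (hpV _))
    have h5 := parallelogram_law_with_norm ℝ (p x.1).1 (p x.2).1
    have h6 := parallelogram_law_with_norm ℝ (p x.1).2 (p x.2).2
    rw [hp1, hp1] at h5
    simp only [Prod.fst_add, Prod.snd_add] at h1
    have e1 : ‖(p x.1).1 + (p x.2).1‖ ^ 2 = 4 - ‖(p x.1).1 - (p x.2).1‖ ^ 2 := by linarith
    rw [e1] at h1
    linarith
  obtain ⟨x, hx⟩ := exists_tendsto_of_tendsto_norm_sub_sq U (fun n => (p n).1) hd1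
  obtain ⟨y, hy⟩ := exists_tendsto_of_tendsto_norm_sub_sq U (fun n => (p n).2) hd2
  have hxy : (x, y) ∈ V := hV.mem_of_tendsto (hx.prodMk_nhds hy) (Eventually.of_forall hpV)
  have hx1 : ‖x‖ = 1 := by
    have := hx.norm
    simp only [hp1] at this
    exact tendsto_nhds_unique this tendsto_const_nhds
  have hy1 : ‖y‖ ^ 2 = lam := tendsto_nhds_unique (hy.norm.pow 2) haU
  refine ⟨(x, y), hxy, hx1, fun q hq => by simpa only [hy1] using hmin q hq, fun q hq => ?_⟩
  simp only [hy1]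
  exact inner_eq_of_isMinimizer V hmin hxy hx1 hy1 hq

end Minimizer

/-! ### Estimates for the standard Gaussian measure -/

/-- The normalising constant `(2π)^(-N/2)`. -/
noncomputable def gaussConst (N : ℕ) : ℝ := 1 / (2 * Real.pi) ^ ((N : ℝ) / 2)

theorem gaussConst_pos (N : ℕ) : 0 < gaussConst N := by
  unfold gaussConst; positivity

theorem gauss_eq_smul (N : ℕ) :
    gauss N = ENNReal.ofReal (gaussConst N) • gaussianMeasure 1 0 := by
  rw [gaussianMeasure, ← withDensity_smul _ (measurable_ofReal_weight _ _), gauss]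
  congr 1
  ext x
  rw [Pi.smul_apply, smul_eq_mul, ← ENNReal.ofReal_mul (gaussConst_pos N).le, gaussConst, weight]
  congr 4
  simp
  ring

instance isFiniteMeasure_gauss (N : ℕ) : IsFiniteMeasure (gauss N) := by
  have := isFiniteMeasure_gaussianMeasure one_pos (0 : EuclideanSpace ℝ (Fin N))
  rw [gauss_eq_smul]
  exact Measure.smul_finite _ ENNReal.ofReal_ne_top

theorem setIntegral_gauss {N : ℕ} (P : Set (EuclideanSpace ℝ (Fin N)))
    (f : EuclideanSpace ℝ (Fin N) → ℝ) :
    ∫ x in P, f x ∂gauss N = gaussConst N * ∫ x in P, f x ∂gaussianMeasure 1 0 := by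
  rw [gauss_eq_smul, Measure.restrict_smul, integral_smul_measure,
    ENNReal.toReal_ofReal (gaussConst_pos N).le, smul_eq_mul]

theorem gaussianMeasure_restrict_le {N : ℕ} {k k' A : ℝ} {c c' : EuclideanSpace ℝ (Fin N)}
    {P : Set (EuclideanSpace ℝ (Fin N))} (hP : MeasurableSet P) (hA : 0 ≤ A)
    (h : ∀ x ∈ P, weight k c x ≤ A * weight k' c' x) :
    (gaussianMeasure k c).restrict P ≤ ENNReal.ofReal A • (gaussianMeasure k' c').restrict P := by
  rw [gaussianMeasure, gaussianMeasure, restrict_withDensity hP, restrict_withDensity hP,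
    ← withDensity_smul _ (measurable_ofReal_weight _ _)]
  refine withDensity_mono ?_
  filter_upwards [ae_restrict_mem hP] with x hx
  rw [Pi.smul_apply, smul_eq_mul, ← ENNReal.ofReal_mul hA]
  exact ENNReal.ofReal_le_ofReal (h x hx)

theorem gaussianMeasure_zero {N : ℕ} (c : EuclideanSpace ℝ (Fin N)) :
    gaussianMeasure 0 c = volume := by
  simp [gaussianMeasure, weight]

theorem memLp_gaussianMeasure_of_memLp_gauss {N : ℕ} {F : Type*} [NormedAddCommGroup F]
    {P : Set (EuclideanSpace ℝ (Fin N))} {f : EuclideanSpace ℝ (Fin N) → F}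
    (hf : MemLp f 2 ((gauss N).restrict P)) :
    MemLp f 2 ((gaussianMeasure 1 0).restrict P) := by
  have hC := gaussConst_pos N
  refine hf.of_measure_le_smul (c := (ENNReal.ofReal (gaussConst N))⁻¹)
    (ENNReal.inv_ne_top.2 (by simpa using hC)) ?_
  rw [gauss_eq_smul, Measure.restrict_smul, smul_smul,
    ENNReal.inv_mul_cancel (by simpa using hC) ENNReal.ofReal_ne_top, one_smul]

theorem memLp_volume_of_memLp_gauss {N : ℕ} {F : Type*} [NormedAddCommGroup F]
    {Ω K : Set (EuclideanSpace ℝ (Fin N))} {f : EuclideanSpace ℝ (Fin N) → F}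
    (hf : MemLp f 2 ((gauss N).restrict Ω)) (hKΩ : K ⊆ Ω) (hK : IsCompact K) :
    MemLp f 2 (volume.restrict K) := by
  have h1 := (memLp_gaussianMeasure_of_memLp_gauss hf).mono_measure
    (Measure.restrict_mono hKΩ le_rfl)
  obtain ⟨C, hC⟩ := hK.exists_bound_of_continuousOn (f := fun x => (weight 1 0 x)⁻¹)
    (((continuous_weight 1 (0 : EuclideanSpace ℝ (Fin N))).inv₀
      fun x => (weight_pos _ _ _).ne').continuousOn)
  refine h1.of_measure_le_smul (c := ENNReal.ofReal (max C 0)) ENNReal.ofReal_ne_top ?_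
  -- Lebesgue measure is the Gaussian measure of precision zero
  rw [← gaussianMeasure_zero (0 : EuclideanSpace ℝ (Fin N))]
  refine gaussianMeasure_restrict_le hK.measurableSet (le_max_right _ _) fun x hx => ?_
  have h2 := (le_abs_self _).trans ((hC x hx).trans (le_max_left C 0))
  have hw := weight_pos 1 0 x
  have h3 := mul_le_mul_of_nonneg_right h2 hw.le
  rw [inv_mul_cancel₀ hw.ne'] at h3
  exact (weight_le_one le_rfl _ _).trans h3

/-- The sharp Gaussian Poincaré-Wirtinger inequality, multiplied out. -/
theorem MemH1.poincare {N : ℕ} {Ω : Set (EuclideanSpace ℝ (Fin N))}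
    (hΩ : IsOpen Ω) (hΩc : Convex ℝ Ω) {u : EuclideanSpace ℝ (Fin N) → ℝ}
    {G : EuclideanSpace ℝ (Fin N) → EuclideanSpace ℝ (Fin N)} (h : MemH1 Ω u G) :
    (∫ _ in Ω, (1 : ℝ) ∂gauss N) * (∫ x in Ω, ‖u x‖ ^ 2 ∂gauss N) -
        (∫ x in Ω, u x ∂gauss N) ^ 2 ≤
      (∫ _ in Ω, (1 : ℝ) ∂gauss N) * ∫ x in Ω, ‖G x‖ ^ 2 ∂gauss N := by
  have main := h.hasWeakGradient.poincare hΩ hΩc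
    (fun K hK hKc => memLp_volume_of_memLp_gauss h.memLp hK hKc)
    (fun K hK hKc => memLp_volume_of_memLp_gauss h.gradient_memLp hK hKc) hΩc hΩ.measurableSet
    le_rfl one_pos 0 (memLp_gaussianMeasure_of_memLp_gauss h.memLp)
    (memLp_gaussianMeasure_of_memLp_gauss h.gradient_memLp)
  simp only [setIntegral_gauss]
  have h2 := mul_le_mul_of_nonneg_left main (sq_nonneg (gaussConst N))
  nlinarith

/-- Functions bounded in `H¹(Ω, γ)` are uniformly small in `L²` outside large balls. -/
theorem MemH1.tail_estimate {N : ℕ} {Ω : Set (EuclideanSpace ℝ (Fin N))}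
    (hΩ : IsOpen Ω) (hΩc : Convex ℝ Ω) {u : EuclideanSpace ℝ (Fin N) → ℝ}
    {G : EuclideanSpace ℝ (Fin N) → EuclideanSpace ℝ (Fin N)} (h : MemH1 Ω u G)
    {x₀ : EuclideanSpace ℝ (Fin N)} (hx₀ : x₀ ∈ Ω) {R : ℝ} (hR : 0 ≤ R) :
    R ^ 2 * ∫ x in Ω \ Metric.ball x₀ R, ‖u x‖ ^ 2 ∂gauss N ≤
      (4 * N + 2 * ‖x₀‖ ^ 2) * (∫ x in Ω, ‖u x‖ ^ 2 ∂gauss N) +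
        16 * ∫ x in Ω, ‖G x‖ ^ 2 ∂gauss N := by
  have main := h.hasWeakGradient.tail_estimate hΩ hΩc
    (fun K hK hKc => memLp_volume_of_memLp_gauss h.memLp hK hKc)
    (fun K hK hKc => memLp_volume_of_memLp_gauss h.gradient_memLp hK hKc) hx₀
    (memLp_gaussianMeasure_of_memLp_gauss h.memLp)
    (memLp_gaussianMeasure_of_memLp_gauss h.gradient_memLp) hR
  simp only [setIntegral_gauss]
  have h2 := mul_le_mul_of_nonneg_left main (gaussConst_pos N).le
  linarith

/-- On a convex cell of size `δ` the `L²` norm is controlled, up to one linear functional, by the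
gradient with a constant of order `δ²`. This is the sharp Poincaré inequality for the Gaussian of
precision `1 / δ²`, which is comparable to the standard one on the cell. -/
theorem MemH1.cell_estimate {N : ℕ} {Ω : Set (EuclideanSpace ℝ (Fin N))}
    (hΩ : IsOpen Ω) (hΩc : Convex ℝ Ω) {P : Set (EuclideanSpace ℝ (Fin N))} (hPc : Convex ℝ P)
    (hPm : MeasurableSet P) (hPΩ : P ⊆ Ω) {δ A B : ℝ} (hδ : 0 < δ) (hA : 0 ≤ A) (hB : 0 ≤ B)
    {c : EuclideanSpace ℝ (Fin N)}
    (hPA : ∀ x ∈ P, weight 1 0 x ≤ A * weight (1 / δ ^ 2) c x)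
    (hPB : ∀ x ∈ P, weight (1 / δ ^ 2) c x ≤ B * weight 1 0 x) :
    ∃ θ : Lp ℝ 2 ((gauss N).restrict Ω), ∀ u G, ∀ h : MemH1 Ω u G,
      ∫ x in P, ‖u x‖ ^ 2 ∂gauss N ≤ A * B * δ ^ 2 * (∫ x in P, ‖G x‖ ^ 2 ∂gauss N) +
        ⟪θ, h.memLp.toLp u⟫ ^ 2 := by
  set ν := gaussianMeasure (1 / δ ^ 2) c with hν
  have hk : 0 < 1 / δ ^ 2 := by positivity
  have : IsFiniteMeasure ν := isFiniteMeasure_gaussianMeasure hk c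
  have hC := gaussConst_pos N
  set M := ∫ _ in P, (1 : ℝ) ∂ν with hM
  have hM0 : 0 ≤ M := integral_nonneg fun _ => zero_le_one
  -- the functional `u ↦ ∫_P u dν` is represented by a bounded function
  set ϑ : EuclideanSpace ℝ (Fin N) → ℝ := P.indicator fun x =>
    weight (1 / δ ^ 2) c x / (gaussConst N * weight 1 0 x) with hϑ
  have hϑm : MemLp ϑ 2 ((gauss N).restrict Ω) := by
    refine MemLp.of_bound (C := B / gaussConst N) ?_ (ae_of_all _ fun x => ?_)
    · refine (Measurable.indicator ?_ hPm).aestronglyMeasurable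
      exact ((continuous_weight _ _).measurable).div
        ((continuous_weight _ _).measurable.const_mul _)
    · by_cases hx : x ∈ P
      · have h1 := weight_pos 1 0 x
        have h2 := weight_pos (1 / δ ^ 2) c x
        rw [hϑ, indicator_of_mem hx, Real.norm_of_nonneg (by positivity),
          div_le_div_iff₀ (by positivity) hC]
        nlinarith [hPB x hx]
      · rw [hϑ, indicator_of_notMem hx, norm_zero]; positivity
  have hrep : ∀ u : EuclideanSpace ℝ (Fin N) → ℝ,
      ∫ x in Ω, ⟪ϑ x, u x⟫ ∂gauss N = ∫ x in P, u x ∂ν := by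
    intro u
    rw [setIntegral_gauss, setIntegral_gaussianMeasure _ _ hΩ.measurableSet,
      setIntegral_gaussianMeasure _ _ hPm, ← integral_const_mul]
    have e : ∀ x, gaussConst N * (⟪ϑ x, u x⟫ * weight 1 0 x) =
        P.indicator (fun x => u x * weight (1 / δ ^ 2) c x) x := by
      intro x
      have h1 := (weight_pos 1 0 x).ne'
      by_cases hx : x ∈ P
      · simp only [hϑ, indicator_of_mem hx]
        simp only [RCLike.inner_apply, conj_trivial]
        field_simp
      · simp [hϑ, hx]
    simp only [e]
    rw [setIntegral_indicator hPm, inter_eq_right.2 hPΩ]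
  have r1 : (gaussianMeasure 1 0).restrict P ≤ ENNReal.ofReal A • ν.restrict P :=
    gaussianMeasure_restrict_le hPm hA hPA
  have r2 : ν.restrict P ≤ ENNReal.ofReal B • (gaussianMeasure 1 0).restrict P :=
    gaussianMeasure_restrict_le hPm hB hPB
  -- if `M = 0` the cell is null, and the junk value `0` of the quotient is harmless
  refine ⟨Real.sqrt (gaussConst N * A / M) • hϑm.toLp ϑ, fun u G h => ?_⟩
  rw [real_inner_smul_left, mul_pow, Real.sq_sqrt (by positivity), inner_toLp, hrep]
  have hu1 := (memLp_gaussianMeasure_of_memLp_gauss h.memLp).mono_measure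
    (Measure.restrict_mono hPΩ le_rfl)
  have hG1 := (memLp_gaussianMeasure_of_memLp_gauss h.gradient_memLp).mono_measure
    (Measure.restrict_mono hPΩ le_rfl)
  have hu2 : MemLp u 2 (ν.restrict P) := hu1.of_measure_le_smul ENNReal.ofReal_ne_top r2
  have hG2 : MemLp G 2 (ν.restrict P) := hG1.of_measure_le_smul ENNReal.ofReal_ne_top r2
  have main := h.hasWeakGradient.poincare hΩ hΩc
    (fun K hK hKc => memLp_volume_of_memLp_gauss h.memLp hK hKc)
    (fun K hK hKc => memLp_volume_of_memLp_gauss h.gradient_memLp hK hKc) hPc hPm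
    hPΩ hk c hu2 hG2
  rw [one_div_one_div, ← hν, ← hM] at main
  set I := ∫ x in P, ‖u x‖ ^ 2 ∂ν with hI
  set J := ∫ x in P, ‖G x‖ ^ 2 ∂ν with hJ
  set ℓ := ∫ x in P, u x ∂ν
  have hJ0 : 0 ≤ J := integral_nonneg fun _ => sq_nonneg _
  have hIJ : I ≤ δ ^ 2 * J + ℓ ^ 2 / M := by
    rcases hM0.eq_or_lt with h0 | h0
    · have : ν.restrict P = 0 := by
        have h1 : ν.real P = 0 := by simpa [hM] using h0.symm
        rw [measureReal_eq_zero_iff] at h1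
        exact Measure.restrict_eq_zero.2 h1
      rw [hI, this, ← h0]
      simp only [integral_zero_measure, div_zero, add_zero]
      positivity
    · rw [← sub_le_iff_le_add', le_div_iff₀ h0]
      linarith
  have s1 : ∫ x in P, ‖u x‖ ^ 2 ∂gaussianMeasure 1 0 ≤ A * I := by
    have h1 := integral_mono_measure r1 (ae_of_all _ fun x => sq_nonneg ‖u x‖)
      ((hu2.integrable_norm_pow two_ne_zero).smul_measure ENNReal.ofReal_ne_top)
    rwa [integral_smul_measure, ENNReal.toReal_ofReal hA, smul_eq_mul] at h1
  have s2 : J ≤ B * ∫ x in P, ‖G x‖ ^ 2 ∂gaussianMeasure 1 0 := by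
    have h1 := integral_mono_measure r2 (ae_of_all _ fun x => sq_nonneg ‖G x‖)
      ((hG1.integrable_norm_pow two_ne_zero).smul_measure ENNReal.ofReal_ne_top)
    rwa [integral_smul_measure, ENNReal.toReal_ofReal hB, smul_eq_mul] at h1
  rw [setIntegral_gauss, setIntegral_gauss]
  calc _ ≤ gaussConst N * (A * (δ ^ 2 * (B * ∫ x in P, ‖G x‖ ^ 2 ∂gaussianMeasure 1 0) +
        ℓ ^ 2 / M)) := by
        gcongr
        refine s1.trans ?_
        gcongr
        refine hIJ.trans ?_
        gcongr
    _ = _ := by ring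

/-! ### Compactness of the embedding into `L²` -/

/-- The half-open cube of side `δ` of the grid `δℤ^N` with lowest corner `δ m`. -/
def gridCube {N : ℕ} (δ : ℝ) (m : Fin N → ℤ) : Set (EuclideanSpace ℝ (Fin N)) :=
  {x | ∀ i, (m i : ℝ) * δ ≤ x i ∧ x i < ((m i : ℝ) + 1) * δ}

theorem convex_gridCube {N : ℕ} (δ : ℝ) (m : Fin N → ℤ) : Convex ℝ (gridCube δ m) := by
  intro x hx y hy a b ha hb hab i
  have h := (convex_Ico ((m i : ℝ) * δ) (((m i : ℝ) + 1) * δ)) (hx i) (hy i) ha hb hab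
  simpa using h

theorem measurableSet_gridCube {N : ℕ} (δ : ℝ) (m : Fin N → ℤ) :
    MeasurableSet (gridCube δ m) := by
  have : gridCube δ m = ⋂ i, {x | (m i : ℝ) * δ ≤ x i ∧ x i < ((m i : ℝ) + 1) * δ} := by
    ext x; simp [gridCube]
  rw [this]
  refine MeasurableSet.iInter fun i => ?_
  have hi : Measurable fun x : EuclideanSpace ℝ (Fin N) => x i := by fun_prop
  exact (measurableSet_le measurable_const hi).inter (measurableSet_lt hi measurable_const)

theorem mem_gridCube_iff {N : ℕ} {δ : ℝ} (hδ : 0 < δ) {m : Fin N → ℤ}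
    {x : EuclideanSpace ℝ (Fin N)} : x ∈ gridCube δ m ↔ ∀ i, ⌊x i / δ⌋ = m i := by
  simp only [gridCube, mem_ofPred_eq, Int.floor_eq_iff, le_div_iff₀ hδ, div_lt_iff₀ hδ]

theorem norm_sq_le_of_forall_abs_le {N : ℕ} {x : EuclideanSpace ℝ (Fin N)} {r : ℝ}
    (h : ∀ i, |x i| ≤ r) : ‖x‖ ^ 2 ≤ N * r ^ 2 := by
  rw [EuclideanSpace.norm_sq_eq]
  calc ∑ i, ‖x i‖ ^ 2 ≤ ∑ _i : Fin N, r ^ 2 := by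
        refine Finset.sum_le_sum fun i _ => ?_
        rw [Real.norm_eq_abs]
        exact pow_le_pow_left₀ (abs_nonneg _) (h i) 2
    _ = N * r ^ 2 := by simp

theorem one_le_exp_mul_weight {N : ℕ} {k a : ℝ} {c x : EuclideanSpace ℝ (Fin N)}
    (h : k / 2 * ‖x - c‖ ^ 2 ≤ a) : 1 ≤ Real.exp a * weight k c x := by
  rw [weight, ← Real.exp_add]
  exact Real.one_le_exp (by linarith)

/-- The quantitative compactness of the embedding `H¹(Ω, γ) ⊂ L²(Ω, γ)`: up to finitely many
linear functionals the `L²` norm is an arbitrarily small multiple of the `H¹` norm. -/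
theorem MemH1.compactness {N : ℕ} {Ω : Set (EuclideanSpace ℝ (Fin N))}
    (hΩ : IsOpen Ω) (hΩc : Convex ℝ Ω) (hne : Ω.Nonempty) {ε : ℝ} (hε : 0 < ε) :
    ∃ (s : Finset (Fin N → ℤ)) (θ : (Fin N → ℤ) → Lp ℝ 2 ((gauss N).restrict Ω)),
      ∀ u G, ∀ h : MemH1 Ω u G,
        ‖h.memLp.toLp u‖ ^ 2 ≤
          ε * (‖h.memLp.toLp u‖ ^ 2 + ‖h.gradient_memLp.toLp G‖ ^ 2) +
            ∑ m ∈ s, ⟪θ m, h.memLp.toLp u⟫ ^ 2 := by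
  obtain ⟨x₀, hx₀⟩ := hne
  set T : ℝ := 4 * N + 2 * ‖x₀‖ ^ 2 + 16 with hT
  have hT0 : 0 < T := by positivity
  -- the radius for which the tail is at most `ε / 2` times the squared norm
  set R : ℝ := Real.sqrt (2 * T / ε) with hR
  have hR0 : 0 ≤ R := Real.sqrt_nonneg _
  have hR2 : R ^ 2 = 2 * T / ε := Real.sq_sqrt (by positivity)
  -- the ball of radius `R` about `x₀` is contained in the ball of radius `ρ` about the origin
  set ρ : ℝ := R + ‖x₀‖ with hρ
  have hρ0 : 0 ≤ ρ := by positivity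
  -- comparison constants between the two Gaussian weights on a cell meeting that ball, valid for
  -- every side length `δ ≤ 1`
  set A : ℝ := Real.exp (N / 2) with hA
  set B : ℝ := Real.exp (N * (ρ + 2) ^ 2 / 2) with hB
  have hA0 : 0 < A := Real.exp_pos _
  have hB0 : 0 < B := Real.exp_pos _
  set δ : ℝ := min 1 (Real.sqrt (ε / (2 * (A * B)))) with hδdef
  have hδ : 0 < δ := lt_min one_pos (Real.sqrt_pos.2 (by positivity))
  have hδ1 : δ ≤ 1 := min_le_left _ _
  have hδ2 : A * B * δ ^ 2 ≤ ε / 2 := by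
    have h1 : δ ^ 2 ≤ ε / (2 * (A * B)) := by
      calc δ ^ 2 ≤ Real.sqrt (ε / (2 * (A * B))) ^ 2 :=
            pow_le_pow_left₀ hδ.le (min_le_right _ _) 2
        _ = _ := Real.sq_sqrt (by positivity)
    calc A * B * δ ^ 2 ≤ A * B * (ε / (2 * (A * B))) := by gcongr
      _ = ε / 2 := by field_simp
  -- the cells with index in the box `[-M, M]^N` cover the ball
  set M : ℤ := ⌈ρ / δ⌉ with hM
  set s : Finset (Fin N → ℤ) := Finset.Icc (fun _ => -M) (fun _ => M) with hs
  have hcell : ∀ m, ∃ θ : Lp ℝ 2 ((gauss N).restrict Ω), m ∈ s → ∀ u G, ∀ h : MemH1 Ω u G,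
      ∫ x in Ω ∩ gridCube δ m, ‖u x‖ ^ 2 ∂gauss N ≤
        A * B * δ ^ 2 * (∫ x in Ω ∩ gridCube δ m, ‖G x‖ ^ 2 ∂gauss N) +
          ⟪θ, h.memLp.toLp u⟫ ^ 2 := by
    intro m
    by_cases hm : m ∈ s
    · have hPA : ∀ x ∈ Ω ∩ gridCube δ m, weight 1 0 x ≤
          A * weight (1 / δ ^ 2) (WithLp.toLp 2 fun i => (m i : ℝ) * δ) x := by
        intro x hx
        refine (weight_le_one zero_le_one _ _).trans (one_le_exp_mul_weight ?_)
        have h1 : ‖x - WithLp.toLp 2 fun i => (m i : ℝ) * δ‖ ^ 2 ≤ N * δ ^ 2 := by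
          refine norm_sq_le_of_forall_abs_le fun i => ?_
          have h2 := hx.2 i
          simp only [PiLp.sub_apply]
          rw [abs_le]
          constructor <;> linarith [h2.1, h2.2]
        calc 1 / δ ^ 2 / 2 * ‖x - WithLp.toLp 2 fun i => (m i : ℝ) * δ‖ ^ 2
            ≤ 1 / δ ^ 2 / 2 * ((N : ℝ) * δ ^ 2) := by gcongr
          _ = (N : ℝ) / 2 := by field_simp
      have hPB : ∀ x ∈ Ω ∩ gridCube δ m,
          weight (1 / δ ^ 2) (WithLp.toLp 2 fun i => (m i : ℝ) * δ) x ≤ B * weight 1 0 x := by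
        intro x hx
        refine (weight_le_one (by positivity) _ _).trans (one_le_exp_mul_weight ?_)
        rw [sub_zero]
        have h1 : ‖x‖ ^ 2 ≤ N * (ρ + 2) ^ 2 := by
          refine norm_sq_le_of_forall_abs_le fun i => ?_
          have h2 := hx.2 i
          rw [hs, Finset.mem_Icc] at hm
          have h3 : (-M : ℝ) ≤ m i := by exact_mod_cast hm.1 i
          have h4 : (m i : ℝ) ≤ M := by exact_mod_cast hm.2 i
          have h5 : (M : ℝ) * δ ≤ ρ + δ := by
            have h6 : (M : ℝ) < ρ / δ + 1 := Int.ceil_lt_add_one _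
            calc (M : ℝ) * δ ≤ (ρ / δ + 1) * δ := by gcongr
              _ = ρ + δ := by field_simp
          rw [abs_le]
          constructor <;> nlinarith [h2.1, h2.2]
        linarith
      obtain ⟨θ, hθ⟩ := MemH1.cell_estimate hΩ hΩc (hΩc.inter (convex_gridCube δ m))
        (hΩ.measurableSet.inter (measurableSet_gridCube δ m)) inter_subset_left hδ hA0.le hB0.le
        hPA hPB
      exact ⟨θ, fun _ => hθ⟩
    · exact ⟨0, fun h => absurd h hm⟩
  choose θ hθ using hcell
  refine ⟨s, θ, fun u G h => ?_⟩
  rw [norm_toLp_sq, norm_toLp_sq]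
  have iu : IntegrableOn (fun x => ‖u x‖ ^ 2) Ω (gauss N) :=
    h.memLp.integrable_norm_pow two_ne_zero
  have iG : IntegrableOn (fun x => ‖G x‖ ^ 2) Ω (gauss N) :=
    h.gradient_memLp.integrable_norm_pow two_ne_zero
  set I := ∫ x in Ω, ‖u x‖ ^ 2 ∂gauss N with hI
  set J := ∫ x in Ω, ‖G x‖ ^ 2 ∂gauss N with hJ
  have hI0 : 0 ≤ I := integral_nonneg fun _ => sq_nonneg _
  have hJ0 : 0 ≤ J := integral_nonneg fun _ => sq_nonneg _
  have htail : ∫ x in Ω \ Metric.ball x₀ R, ‖u x‖ ^ 2 ∂gauss N ≤ ε / 2 * (I + J) := by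
    have h1 := h.tail_estimate hΩ hΩc hx₀ hR0
    have h2 : (4 * N + 2 * ‖x₀‖ ^ 2) * I + 16 * J ≤ T * (I + J) := by
      rw [hT]
      have : 0 ≤ 4 * (N : ℝ) + 2 * ‖x₀‖ ^ 2 := by positivity
      nlinarith
    have h3 := h1.trans h2
    rw [hR2] at h3
    have h4 : 2 * T / ε * (ε / 2 * (I + J)) = T * (I + J) := by field_simp
    rw [← h4] at h3
    exact le_of_mul_le_mul_left h3 (by positivity)
  have hcov : Ω ∩ Metric.ball x₀ R ⊆ ⋃ m ∈ s, Ω ∩ gridCube δ m := by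
    intro x hx
    refine mem_biUnion (x := fun i => ⌊x i / δ⌋) ?_ ⟨hx.1, (mem_gridCube_iff hδ).2 fun i => rfl⟩
    have h1 : ∀ i, |x i / δ| ≤ M := by
      intro i
      refine le_trans ?_ (Int.le_ceil _)
      rw [abs_div, abs_of_pos hδ]
      gcongr
      have h2 := PiLp.norm_apply_le x i
      have h3 : ‖x - x₀‖ < R := by simpa [dist_eq_norm] using hx.2
      have h4 := norm_sub_norm_le x x₀
      rw [Real.norm_eq_abs] at h2
      linarith
    rw [hs, Finset.mem_coe, Finset.mem_Icc]
    constructor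
    · intro i
      rw [Int.le_floor]
      push_cast
      exact (abs_le.1 (h1 i)).1
    · intro i
      exact Int.floor_le_iff.2 (lt_of_le_of_lt (abs_le.1 (h1 i)).2 (lt_add_one _))
  have hcm : ∀ m ∈ s, MeasurableSet (Ω ∩ gridCube δ m) := fun m _ =>
    hΩ.measurableSet.inter (measurableSet_gridCube δ m)
  have hcd : Set.Pairwise (↑s) (Function.onFun Disjoint fun m => Ω ∩ gridCube δ m) := by
    intro m _ m' _ hmm
    refine Set.disjoint_left.2 fun x hx hx' => hmm ?_
    ext i
    rw [← (mem_gridCube_iff hδ).1 hx.2 i, (mem_gridCube_iff hδ).1 hx'.2 i]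
  have hUsub : ⋃ m ∈ s, Ω ∩ gridCube δ m ⊆ Ω := iUnion₂_subset fun m _ => inter_subset_left
  have hmain : ∫ x in Ω ∩ Metric.ball x₀ R, ‖u x‖ ^ 2 ∂gauss N ≤
      ε / 2 * J + ∑ m ∈ s, ⟪θ m, h.memLp.toLp u⟫ ^ 2 := by
    calc ∫ x in Ω ∩ Metric.ball x₀ R, ‖u x‖ ^ 2 ∂gauss N
        ≤ ∫ x in ⋃ m ∈ s, Ω ∩ gridCube δ m, ‖u x‖ ^ 2 ∂gauss N :=
          setIntegral_mono_set (iu.mono_set hUsub) (ae_of_all _ fun _ => sq_nonneg _)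
            (LE.le.eventuallyLE hcov)
      _ = ∑ m ∈ s, ∫ x in Ω ∩ gridCube δ m, ‖u x‖ ^ 2 ∂gauss N :=
          integral_biUnion_finset s hcm hcd fun m _ => iu.mono_set inter_subset_left
      _ ≤ ∑ m ∈ s, (A * B * δ ^ 2 * (∫ x in Ω ∩ gridCube δ m, ‖G x‖ ^ 2 ∂gauss N) +
          ⟪θ m, h.memLp.toLp u⟫ ^ 2) := Finset.sum_le_sum fun m hm => hθ m hm u G h
      _ = A * B * δ ^ 2 * (∫ x in ⋃ m ∈ s, Ω ∩ gridCube δ m, ‖G x‖ ^ 2 ∂gauss N) +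
          ∑ m ∈ s, ⟪θ m, h.memLp.toLp u⟫ ^ 2 := by
          rw [Finset.sum_add_distrib, ← Finset.mul_sum,
            integral_biUnion_finset s hcm hcd fun m _ => iG.mono_set inter_subset_left]
      _ ≤ ε / 2 * J + ∑ m ∈ s, ⟪θ m, h.memLp.toLp u⟫ ^ 2 := by
          gcongr
          exact setIntegral_mono_set iG (ae_of_all _ fun _ => sq_nonneg _)
            (LE.le.eventuallyLE hUsub)
  have hsplit := integral_inter_add_sdiff (f := fun x => ‖u x‖ ^ 2)
    (t := Metric.ball x₀ R) Metric.isOpen_ball.measurableSet iu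
  have : ε / 2 * (I + J) + ε / 2 * J ≤ ε * (I + J) := by nlinarith
  linarith

/-! ### The Gaussian Sobolev space as a closed subspace -/

theorem setIntegral_gauss_eq_setIntegral {N : ℕ} {Ω : Set (EuclideanSpace ℝ (Fin N))}
    (hΩ : MeasurableSet Ω) (f : EuclideanSpace ℝ (Fin N) → ℝ) :
    ∫ x in Ω, f x ∂gauss N = ∫ x in Ω, f x * (gaussConst N * weight 1 0 x) := by
  rw [setIntegral_gauss, setIntegral_gaussianMeasure _ _ hΩ, ← integral_const_mul]
  refine integral_congr_ae (ae_of_all _ fun x => ?_)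
  simp only
  ring

theorem volume_restrict_absolutelyContinuous_gauss {N : ℕ} (Ω : Set (EuclideanSpace ℝ (Fin N))) :
    volume.restrict Ω ≪ (gauss N).restrict Ω := by
  refine Measure.AbsolutelyContinuous.restrict ?_ Ω
  rw [gauss_eq_smul]
  have h1 : (volume : Measure (EuclideanSpace ℝ (Fin N))) ≪ gaussianMeasure 1 0 := by
    refine withDensity_absolutelyContinuous' (measurable_ofReal_weight _ _).aemeasurable
      (ae_of_all _ fun x => ?_)
    simpa using weight_pos 1 0 x
  exact h1.trans (Measure.absolutelyContinuous_smul (by simpa using gaussConst_pos N))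

/-- For square integrable pairs the local integrability required by `HasWeakGradient` is automatic,
since the Gaussian density is bounded below on compact sets. -/
theorem memH1_of_integral_by_parts {N : ℕ} {Ω : Set (EuclideanSpace ℝ (Fin N))} (hΩ : IsOpen Ω)
    {u : EuclideanSpace ℝ (Fin N) → ℝ}
    {G : EuclideanSpace ℝ (Fin N) → EuclideanSpace ℝ (Fin N)}
    (hu : MemLp u 2 ((gauss N).restrict Ω)) (hG : MemLp G 2 ((gauss N).restrict Ω))
    (h : ∀ φ : EuclideanSpace ℝ (Fin N) → ℝ, ContDiff ℝ ∞ φ →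
      HasCompactSupport φ → tsupport φ ⊆ Ω → ∀ v : EuclideanSpace ℝ (Fin N),
      ∫ x in Ω, u x * fderiv ℝ φ x v = -∫ x in Ω, ⟪G x, v⟫ * φ x) : MemH1 Ω u G := by
  have loc : ∀ {F : Type} [NormedAddCommGroup F] {f : EuclideanSpace ℝ (Fin N) → F},
      MemLp f 2 ((gauss N).restrict Ω) → LocallyIntegrableOn f Ω volume := by
    intro F _ f hf
    rw [locallyIntegrableOn_iff hΩ.isLocallyClosed]
    intro K hK hKc
    have : IsFiniteMeasure ((volume : Measure (EuclideanSpace ℝ (Fin N))).restrict K) :=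
      isFiniteMeasure_restrict.2 hKc.measure_lt_top.ne
    exact (memLp_volume_of_memLp_gauss hf hK hKc).integrable (by norm_num)
  exact ⟨⟨loc hu, loc hG, h⟩, hu, hG⟩

theorem MemH1.congr_ae {N : ℕ} {Ω : Set (EuclideanSpace ℝ (Fin N))} (hΩ : IsOpen Ω)
    {u u' : EuclideanSpace ℝ (Fin N) → ℝ}
    {G G' : EuclideanSpace ℝ (Fin N) → EuclideanSpace ℝ (Fin N)} (h : MemH1 Ω u G)
    (hu : u =ᵐ[(gauss N).restrict Ω] u') (hG : G =ᵐ[(gauss N).restrict Ω] G') :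
    MemH1 Ω u' G' := by
  refine memH1_of_integral_by_parts hΩ (h.memLp.ae_eq hu) (h.gradient_memLp.ae_eq hG)
    fun φ h1 h2 h3 v => ?_
  have hac := volume_restrict_absolutelyContinuous_gauss Ω
  have e := h.hasWeakGradient.integral_by_parts φ h1 h2 h3 v
  have e1 : ∫ x in Ω, u x * fderiv ℝ φ x v = ∫ x in Ω, u' x * fderiv ℝ φ x v := by
    refine integral_congr_ae ?_
    filter_upwards [hac.ae_eq hu] with x hx
    rw [hx]
  have e2 : ∫ x in Ω, ⟪G x, v⟫ * φ x = ∫ x in Ω, ⟪G' x, v⟫ * φ x := by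
    refine integral_congr_ae ?_
    filter_upwards [hac.ae_eq hG] with x hx
    rw [hx]
  rw [← e1, ← e2, e]

/-- The defect in the integration by parts formula is a continuous linear functional on
`L² × L²`. -/
theorem exists_test_functional {N : ℕ} {Ω : Set (EuclideanSpace ℝ (Fin N))} (hΩ : IsOpen Ω)
    {φ : EuclideanSpace ℝ (Fin N) → ℝ} (h1 : ContDiff ℝ ∞ φ) (h2 : HasCompactSupport φ)
    (v : EuclideanSpace ℝ (Fin N)) :
    ∃ T : (Lp ℝ 2 ((gauss N).restrict Ω) ×
        Lp (EuclideanSpace ℝ (Fin N)) 2 ((gauss N).restrict Ω)) →L[ℝ] ℝ,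
      ∀ p, T p = (∫ x in Ω, p.1 x * fderiv ℝ φ x v) + ∫ x in Ω, ⟪p.2 x, v⟫ * φ x := by
  have hC := (gaussConst_pos N).ne'
  have hw : ∀ x : EuclideanSpace ℝ (Fin N), weight 1 0 x ≠ 0 := fun x => (weight_pos _ _ x).ne'
  have hρ : ∀ x : EuclideanSpace ℝ (Fin N), gaussConst N * weight 1 0 x ≠ 0 := fun x =>
    mul_ne_zero hC (hw x)
  have hdc : Continuous (fderiv ℝ φ) := h1.continuous_fderiv (by simp)
  have hφc := h1.continuous
  have c0 : Continuous fun x : EuclideanSpace ℝ (Fin N) => (gaussConst N * weight 1 0 x)⁻¹ :=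
    Continuous.inv₀ (by fun_prop) hρ
  have c1 : Continuous fun x => fderiv ℝ φ x v * (gaussConst N * weight 1 0 x)⁻¹ := by fun_prop
  have c2 : Continuous fun x => (φ x * (gaussConst N * weight 1 0 x)⁻¹) • v := by fun_prop
  have s1 : HasCompactSupport fun x => fderiv ℝ φ x v * (gaussConst N * weight 1 0 x)⁻¹ :=
    (h2.fderiv_apply (𝕜 := ℝ) v).mul_right
  have s2 : HasCompactSupport fun x => (φ x * (gaussConst N * weight 1 0 x)⁻¹) • v :=
    h2.mul_right.smul_right
  have m1 : MemLp (fun x => fderiv ℝ φ x v * (gaussConst N * weight 1 0 x)⁻¹) 2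
    ((gauss N).restrict Ω) := c1.memLp_of_hasCompactSupport s1
  have m2 : MemLp (fun x => (φ x * (gaussConst N * weight 1 0 x)⁻¹) • v) 2
    ((gauss N).restrict Ω) := c2.memLp_of_hasCompactSupport s2
  refine ⟨(innerSL ℝ (m1.toLp _)).comp (ContinuousLinearMap.fst ℝ _ _) +
    (innerSL ℝ (m2.toLp _)).comp (ContinuousLinearMap.snd ℝ _ _), fun p => ?_⟩
  have e1 : ⟪m1.toLp _, p.1⟫ = ∫ x in Ω, p.1 x * fderiv ℝ φ x v := by
    conv_lhs => rw [← Lp.toLp_coeFn p.1 (Lp.memLp p.1)]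
    rw [inner_toLp, setIntegral_gauss_eq_setIntegral hΩ.measurableSet]
    refine integral_congr_ae (ae_of_all _ fun x => ?_)
    have := hw x
    simp only [RCLike.inner_apply, conj_trivial]
    field_simp
  have e2 : ⟪m2.toLp _, p.2⟫ = ∫ x in Ω, ⟪p.2 x, v⟫ * φ x := by
    conv_lhs => rw [← Lp.toLp_coeFn p.2 (Lp.memLp p.2)]
    rw [inner_toLp, setIntegral_gauss_eq_setIntegral hΩ.measurableSet]
    refine integral_congr_ae (ae_of_all _ fun x => ?_)
    have := hw x
    simp only [real_inner_smul_left, real_inner_comm v]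
    field_simp
  rw [← e1, ← e2]
  rfl

/-- The pairs (function, weak gradient) in `H¹(Ω, γ)` with zero mean form a closed subspace of
`L² × L²`. -/
theorem exists_closed_meanZero_submodule {N : ℕ} {Ω : Set (EuclideanSpace ℝ (Fin N))}
    (hΩ : IsOpen Ω) :
    ∃ V : Submodule ℝ (Lp ℝ 2 ((gauss N).restrict Ω) ×
        Lp (EuclideanSpace ℝ (Fin N)) 2 ((gauss N).restrict Ω)),
      IsClosed (V : Set (Lp ℝ 2 ((gauss N).restrict Ω) ×
        Lp (EuclideanSpace ℝ (Fin N)) 2 ((gauss N).restrict Ω))) ∧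
      ∀ p, p ∈ V ↔ MemH1 Ω p.1 p.2 ∧ ∫ x in Ω, p.1 x ∂gauss N = 0 := by
  have hex : ∀ i : {φ : EuclideanSpace ℝ (Fin N) → ℝ //
      ContDiff ℝ ∞ φ ∧ HasCompactSupport φ ∧ tsupport φ ⊆ Ω} × EuclideanSpace ℝ (Fin N),
      ∃ T : (Lp ℝ 2 ((gauss N).restrict Ω) ×
        Lp (EuclideanSpace ℝ (Fin N)) 2 ((gauss N).restrict Ω)) →L[ℝ] ℝ,
      ∀ p, T p = (∫ x in Ω, p.1 x * fderiv ℝ i.1.1 x i.2) + ∫ x in Ω, ⟪p.2 x, i.2⟫ * i.1.1 x :=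
    fun i => exists_test_functional hΩ i.1.2.1 i.1.2.2.1 i.2
  choose T hT using hex
  have hone : MemLp (fun _ => (1 : ℝ)) 2 ((gauss N).restrict Ω) := memLp_const 1
  set T₀ : (Lp ℝ 2 ((gauss N).restrict Ω) ×
        Lp (EuclideanSpace ℝ (Fin N)) 2 ((gauss N).restrict Ω)) →L[ℝ] ℝ :=
    (innerSL ℝ (hone.toLp _)).comp (ContinuousLinearMap.fst ℝ _ _) with hT₀
  have hT₀p : ∀ p, T₀ p = ∫ x in Ω, p.1 x ∂gauss N := by
    intro p
    have : ⟪hone.toLp _, p.1⟫ = ∫ x in Ω, p.1 x ∂gauss N := by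
      conv_lhs => rw [← Lp.toLp_coeFn p.1 (Lp.memLp p.1)]
      rw [inner_toLp]
      simp
    rw [← this]
    rfl
  refine ⟨(⨅ i, (T i).ker) ⊓ T₀.ker, ?_, fun p => ?_⟩
  · rw [Submodule.coe_inf, Submodule.coe_iInf]
    exact (isClosed_iInter fun i => (T i).isClosed_ker).inter T₀.isClosed_ker
  · simp only [Submodule.mem_inf, Submodule.mem_iInf, LinearMap.mem_ker,
      ContinuousLinearMap.coe_coe, hT, hT₀p]
    refine and_congr_left fun _ => ⟨fun h => ?_, fun h i => ?_⟩
    · exact memH1_of_integral_by_parts hΩ (Lp.memLp _) (Lp.memLp _) fun φ h1 h2 h3 v =>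
        eq_neg_of_add_eq_zero_left (h (⟨φ, h1, h2, h3⟩, v))
    · rw [h.hasWeakGradient.integral_by_parts i.1.1 i.1.2.1 i.1.2.2.1 i.1.2.2.2 i.2]
      ring

theorem memLp_id_gauss (N : ℕ) : MemLp (fun x : EuclideanSpace ℝ (Fin N) => x) 2 (gauss N) := by
  have hm : AEStronglyMeasurable (fun x : EuclideanSpace ℝ (Fin N) => x) (gauss N) :=
    continuous_id.aestronglyMeasurable
  rw [memLp_two_iff_integrable_sq_norm hm, gauss_eq_smul]
  refine Integrable.smul_measure ?_ ENNReal.ofReal_ne_top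
  rw [gaussianMeasure, integrable_withDensity_iff_integrable_smul' (measurable_ofReal_weight _ _)
    (ae_of_all _ fun _ => ENNReal.ofReal_lt_top)]
  refine ((integrable_weight (by norm_num : (0 : ℝ) < 1 / 2)
    (0 : EuclideanSpace ℝ (Fin N))).const_mul 4).mono' ?_ (ae_of_all _ fun x => ?_)
  · exact ((measurable_ofReal_weight _ _).ennreal_toReal.smul
      (continuous_norm.pow 2).measurable).aestronglyMeasurable
  · have hw := weight_pos 1 0 x
    rw [ENNReal.toReal_ofReal hw.le, smul_eq_mul,
      Real.norm_of_nonneg (by positivity), weight, weight, sub_zero]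
    have h1 : ‖x‖ ^ 2 ≤ 4 * Real.exp (‖x‖ ^ 2 / 4) := by
      have := Real.add_one_le_exp (‖x‖ ^ 2 / 4)
      linarith
    calc _ ≤ Real.exp (-(1 / 2) * ‖x‖ ^ 2) * (4 * Real.exp (‖x‖ ^ 2 / 4)) := by gcongr
      _ = 4 * Real.exp (-(1 / 2) * ‖x‖ ^ 2 + ‖x‖ ^ 2 / 4) := by rw [Real.exp_add]; ring
      _ = _ := by congr 2; ring

theorem memH1_affine {N : ℕ} {Ω : Set (EuclideanSpace ℝ (Fin N))} (hΩ : IsOpen Ω)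
    (e : EuclideanSpace ℝ (Fin N)) (a : ℝ) :
    MemH1 Ω (fun x => ⟪e, x⟫ + a) fun _ => e := by
  have h1 : MemLp (fun x => ⟪e, x⟫ + a) 2 ((gauss N).restrict Ω) :=
    ((((innerSL ℝ e).comp_memLp' (memLp_id_gauss N))).add (memLp_const a)).restrict Ω
  refine memH1_of_integral_by_parts hΩ h1 (memLp_const e) fun φ hφ hφs hφΩ v => ?_
  have hφc := hφ.continuous
  have hdc : Continuous (fderiv ℝ φ) := hφ.continuous_fderiv (by simp)
  have hz : ∀ x, x ∉ Ω → φ x = 0 := fun x hx =>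
    image_eq_zero_of_notMem_tsupport fun h => hx (hφΩ h)
  have hdz : ∀ x, x ∉ Ω → fderiv ℝ φ x = 0 := fun x hx =>
    image_eq_zero_of_notMem_tsupport fun h => hx (hφΩ (tsupport_fderiv_subset ℝ h))
  rw [setIntegral_eq_integral_of_forall_compl_eq_zero fun x hx => by simp [hdz x hx],
    setIntegral_eq_integral_of_forall_compl_eq_zero fun x hx => by simp [hz x hx]]
  have hd : ∀ x, HasFDerivAt (fun x => ⟪e, x⟫ + a) (innerSL ℝ e) x := fun x =>
    ((innerSL ℝ e).hasFDerivAt).add_const a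
  have hs : HasCompactSupport fun x => fderiv ℝ φ x v := hφs.fderiv_apply (𝕜 := ℝ) v
  have main := integral_mul_fderiv_eq_neg_fderiv_mul_of_integrable
    (μ := (volume : Measure (EuclideanSpace ℝ (Fin N))))
    (f := fun x => ⟪e, x⟫ + a) (g := φ) (v := v) ?_ ?_ ?_ (fun x _ => (hd x).differentiableAt)
    (fun x _ => hφ.differentiable (by simp) x)
  · rw [main]
    simp [(hd _).fderiv]
  · simp only [(hd _).fderiv]
    exact Continuous.integrable_of_hasCompactSupport (by fun_prop) hφs.mul_left
  · exact Continuous.integrable_of_hasCompactSupport (by fun_prop) hs.mul_left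
  · exact Continuous.integrable_of_hasCompactSupport (by fun_prop) hφs.mul_left

/-! ### The first nontrivial eigenvalue -/

theorem integral_one_gauss_pos {N : ℕ} {Ω : Set (EuclideanSpace ℝ (Fin N))} (hΩ : IsOpen Ω)
    (hne : Ω.Nonempty) : 0 < ∫ _ in Ω, (1 : ℝ) ∂gauss N := by
  have h1 : 0 < gauss N Ω := by
    rw [pos_iff_ne_zero]
    intro h0
    have h2 := volume_restrict_absolutelyContinuous_gauss Ω
    rw [Measure.restrict_eq_zero.2 h0, Measure.absolutelyContinuous_zero_iff,
      Measure.restrict_eq_zero] at h2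
    exact (hΩ.measure_pos volume hne).ne' h2
  have h2 := ENNReal.toReal_pos h1.ne' (measure_ne_top _ _)
  rw [setIntegral_const, smul_eq_mul, mul_one]
  exact h2

/-- The Poincaré-Wirtinger inequality for the Gaussian measure on a convex open set. This is
`MemH1.poincare` divided by the mass of `Ω`. -/
theorem MemH1.integral_sub_average_sq_le {N : ℕ} {Ω : Set (EuclideanSpace ℝ (Fin N))}
    (hΩ : IsOpen Ω) (hΩc : Convex ℝ Ω) (hne : Ω.Nonempty)
    {u : EuclideanSpace ℝ (Fin N) → ℝ}
    {G : EuclideanSpace ℝ (Fin N) → EuclideanSpace ℝ (Fin N)} (h : MemH1 Ω u G) :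
    ∫ x in Ω, (u x - ⨍ y in Ω, u y ∂gauss N) ^ 2 ∂gauss N ≤ ∫ x in Ω, ‖G x‖ ^ 2 ∂gauss N := by
  have hM := integral_one_gauss_pos hΩ hne
  set M := ∫ _ in Ω, (1 : ℝ) ∂gauss N with hMdef
  set m := ⨍ y in Ω, u y ∂gauss N with hm
  have hmM : ∫ x in Ω, u x ∂gauss N = m * M := by
    have hreal : (gauss N).real Ω = M := by simp [hMdef]
    rw [hm, setAverage_eq, hreal, smul_eq_mul]
    field_simp
  have i1 : Integrable u ((gauss N).restrict Ω) := h.memLp.integrable (by norm_num)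
  have i2 : Integrable (fun x => ‖u x‖ ^ 2) ((gauss N).restrict Ω) :=
    h.memLp.integrable_norm_pow two_ne_zero
  have e : ∫ x in Ω, (u x - m) ^ 2 ∂gauss N = (∫ x in Ω, ‖u x‖ ^ 2 ∂gauss N) - m ^ 2 * M := by
    have e1 : ∀ x, (u x - m) ^ 2 = ‖u x‖ ^ 2 - 2 * m * u x + m ^ 2 * 1 := fun x => by
      rw [Real.norm_eq_abs, sq_abs]; ring
    simp only [e1]
    have i3 : Integrable (fun x => ‖u x‖ ^ 2 - 2 * m * u x) ((gauss N).restrict Ω) :=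
      i2.sub (i1.const_mul _)
    have i4 : Integrable (fun _ => m ^ 2 * (1 : ℝ)) ((gauss N).restrict Ω) := integrable_const _
    rw [integral_add i3 i4,
      integral_sub i2 (i1.const_mul _), integral_const_mul, integral_const_mul, ← hMdef, hmM]
    ring
  have main := h.poincare hΩ hΩc
  rw [← hMdef, hmM] at main
  rw [e]
  refine le_of_mul_le_mul_left ?_ hM
  linarith

theorem not_ae_eq_const_affine {N : ℕ} {Ω : Set (EuclideanSpace ℝ (Fin N))} (hΩ : IsOpen Ω)
    (hne : Ω.Nonempty) {e : EuclideanSpace ℝ (Fin N)} (he : e ≠ 0) (a c : ℝ) :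
    ¬ ∀ᵐ x ∂((gauss N).restrict Ω), ⟪e, x⟫ + a = c := by
  intro h
  have h1 : (fun x => ⟪e, x⟫ + a) =ᵐ[volume.restrict Ω] fun _ => c :=
    (volume_restrict_absolutelyContinuous_gauss Ω).ae_eq h
  have h2 : EqOn (fun x => ⟪e, x⟫ + a) (fun _ => c) Ω :=
    Measure.eqOn_open_of_ae_eq h1 hΩ (by fun_prop) (by fun_prop)
  obtain ⟨x, hx⟩ := hne
  have hc : Tendsto (fun t : ℝ => x + t • e) (𝓝[≠] 0) (𝓝 (x + (0 : ℝ) • e)) :=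
    (by fun_prop : Continuous fun t : ℝ => x + t • e).continuousWithinAt
  rw [zero_smul, add_zero] at hc
  obtain ⟨t, ht, ht0⟩ := ((hc.eventually (hΩ.mem_nhds hx)).and self_mem_nhdsWithin).exists
  have e1 := h2 hx
  have e2 := h2 ht
  simp only [inner_add_right, real_inner_smul_right, real_inner_self_eq_norm_sq] at e1 e2
  have : t * ‖e‖ ^ 2 = 0 := by linarith
  simp [he] at this
  exact ht0 this

theorem memH1_one {N : ℕ} {Ω : Set (EuclideanSpace ℝ (Fin N))} (hΩ : IsOpen Ω) :
    MemH1 Ω (fun _ => 1) fun _ => 0 := by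
  simpa using memH1_affine hΩ 0 1

theorem MemH1.sub_const {N : ℕ} {Ω : Set (EuclideanSpace ℝ (Fin N))} (hΩ : IsOpen Ω)
    {u : EuclideanSpace ℝ (Fin N) → ℝ}
    {G : EuclideanSpace ℝ (Fin N) → EuclideanSpace ℝ (Fin N)} (h : MemH1 Ω u G) (c : ℝ) :
    MemH1 Ω (fun x => u x - c) G := by
  refine memH1_of_integral_by_parts hΩ (h.memLp.sub (memLp_const c)) h.gradient_memLp
    fun φ h1 h2 h3 v => ?_
  have e1 := h.hasWeakGradient.integral_by_parts φ h1 h2 h3 v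
  have e2 := (memH1_one hΩ).hasWeakGradient.integral_by_parts φ h1 h2 h3 v
  have hd : Continuous fun x => fderiv ℝ φ x v := (h1.continuous_fderiv (by simp)).clm_apply
    continuous_const
  have hds : HasCompactSupport fun x => fderiv ℝ φ x v := h2.fderiv_apply (𝕜 := ℝ) v
  simp only [one_mul, inner_zero_left, zero_mul, integral_zero, neg_zero] at e2
  simp only [sub_mul]
  have i1 : Integrable (fun x => c * fderiv ℝ φ x v) (volume.restrict Ω) :=
    ((hd.integrable_of_hasCompactSupport hds).const_mul c).restrict
  have i2 : Integrable (fun x => u x * fderiv ℝ φ x v) (volume.restrict Ω) := by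
    have hsub : tsupport (fun x => fderiv ℝ φ x v) ⊆ Ω :=
      (tsupport_fderiv_apply_subset ℝ v).trans h3
    have hK : IsCompact (tsupport fun x => fderiv ℝ φ x v) := hds
    have iu : IntegrableOn u (tsupport fun x => fderiv ℝ φ x v) volume := by
      have := isFiniteMeasure_restrict.2
        (hK.measure_lt_top (μ := (volume : Measure (EuclideanSpace ℝ (Fin N))))).ne
      exact (memLp_volume_of_memLp_gauss h.memLp hsub hK).integrable (by norm_num)
    have i3 : IntegrableOn (fun x => u x * fderiv ℝ φ x v)
        (tsupport fun x => fderiv ℝ φ x v) volume :=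
      iu.mul_continuousOn hd.continuousOn hK
    exact ((integrableOn_iff_integrable_of_support_subset
      ((Function.support_mul_subset_right _ _).trans (subset_tsupport _))).1 i3).restrict
  rw [integral_sub i2 i1, integral_const_mul, e2, e1]
  ring

/-- Every nontrivial eigenvalue is the Rayleigh quotient of its eigenfunction. Testing with a
constant shows that the eigenfunction has mean zero, unless the eigenvalue vanishes, which the
Poincaré-Wirtinger inequality excludes. -/
theorem nontrivialNeumannEigenvalues_subset_rayleighQuotients {N : ℕ}
    {Ω : Set (EuclideanSpace ℝ (Fin N))} (hΩ : IsOpen Ω) (hΩc : Convex ℝ Ω) (hne : Ω.Nonempty) :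
    nontrivialNeumannEigenvalues Ω ⊆ rayleighQuotients Ω := by
  rintro μ ⟨u, G, ⟨h, hw⟩, hnc⟩
  have e1 := hw _ _ (memH1_one hΩ)
  simp only [inner_zero_right, integral_zero, mul_one] at e1
  have e2 := hw _ _ h
  simp only [real_inner_self_eq_norm_sq, ← sq] at e2
  have i2 : Integrable (fun x => u x ^ 2) ((gauss N).restrict Ω) := h.memLp.integrable_sq
  have hmean : ∫ x in Ω, u x ∂gauss N = 0 := by
    rcases mul_eq_zero.1 e1.symm with h0 | h0
    · -- a vanishing eigenvalue forces `u` to be constant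
      exfalso
      have h1 := h.integral_sub_average_sq_le hΩ hΩc hne
      rw [e2, h0, zero_mul] at h1
      have i3 : Integrable (fun x => (u x - ⨍ y in Ω, u y ∂gauss N) ^ 2)
          ((gauss N).restrict Ω) := (h.memLp.sub (memLp_const _)).integrable_sq
      have h2 := (integral_eq_zero_iff_of_nonneg (fun _ => sq_nonneg _) i3).1
        (le_antisymm h1 (integral_nonneg fun _ => sq_nonneg _))
      refine hnc ⟨⨍ y in Ω, u y ∂gauss N, ?_⟩
      filter_upwards [h2] with x hx
      exact sub_eq_zero.1 (by simpa using hx)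
    · exact h0
  refine ⟨u, G, h, fun h0 => hnc ⟨0, h0⟩, hmean, ?_⟩
  have hpos : ∫ x in Ω, u x ^ 2 ∂gauss N ≠ 0 := by
    intro h0
    have h2 := (integral_eq_zero_iff_of_nonneg (fun _ => sq_nonneg _) i2).1 h0
    refine hnc ⟨0, ?_⟩
    filter_upwards [h2] with x hx
    simpa using hx
  rw [e2, mul_div_cancel_right₀ _ hpos]

theorem one_le_of_mem_rayleighQuotients {N : ℕ} {Ω : Set (EuclideanSpace ℝ (Fin N))}
    (hΩ : IsOpen Ω) (hΩc : Convex ℝ Ω) (hne : Ω.Nonempty) {R : ℝ}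
    (hR : R ∈ rayleighQuotients Ω) : 1 ≤ R := by
  obtain ⟨ψ, G, h, hnz, hmean, rfl⟩ := hR
  have i2 : Integrable (fun x => ψ x ^ 2) ((gauss N).restrict Ω) := h.memLp.integrable_sq
  have hpos : 0 < ∫ x in Ω, ψ x ^ 2 ∂gauss N := by
    refine lt_of_le_of_ne (integral_nonneg fun _ => sq_nonneg _) fun h0 => hnz ?_
    have h2 := (integral_eq_zero_iff_of_nonneg (fun _ => sq_nonneg _) i2).1 h0.symm
    filter_upwards [h2] with x hx
    simpa using hx
  have h1 := h.integral_sub_average_sq_le hΩ hΩc hne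
  rw [setAverage_eq, hmean, smul_zero] at h1
  simp only [sub_zero] at h1
  rwa [le_div_iff₀ hpos, one_mul]

/-- The Rayleigh quotient attains its minimum, and the minimum is an eigenvalue: the Euler-Lagrange
equation, which holds for mean zero test functions, extends to all of them because adding a
constant changes neither side. -/
theorem exists_isLeast_eigenvalue {N : ℕ} (hN : 2 ≤ N) {Ω : Set (EuclideanSpace ℝ (Fin N))}
    (hΩ : IsOpen Ω) (hΩc : Convex ℝ Ω) (hne : Ω.Nonempty) :
    ∃ lam ∈ nontrivialNeumannEigenvalues Ω, ∀ R ∈ rayleighQuotients Ω, lam ≤ R := by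
  obtain ⟨V, hVc, hV⟩ := exists_closed_meanZero_submodule hΩ
  have hmk : ∀ {u G} (h : MemH1 Ω u G), ∫ x in Ω, u x ∂gauss N = 0 →
      (h.memLp.toLp u, h.gradient_memLp.toLp G) ∈ V := by
    intro u G h h0
    rw [hV]
    refine ⟨h.congr_ae hΩ h.memLp.coeFn_toLp.symm h.gradient_memLp.coeFn_toLp.symm, ?_⟩
    rw [← h0]
    exact integral_congr_ae h.memLp.coeFn_toLp
  have hcenter : ∀ {u G}, MemH1 Ω u G → ∫ x in Ω, (u x - ⨍ y in Ω, u y ∂gauss N) ∂gauss N = 0 := by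
    intro u G h
    exact integral_sub_average ((gauss N).restrict Ω) u
  have hex : ∃ p ∈ V, p.1 ≠ 0 := by
    -- a coordinate function, centred
    set e : EuclideanSpace ℝ (Fin N) := EuclideanSpace.single ⟨0, by omega⟩ 1 with he
    have he0 : e ≠ 0 := by
      intro h0
      have := congrArg norm h0
      simp [he] at this
    have h1 := memH1_affine hΩ e 0
    have h2 := h1.sub_const hΩ (⨍ y in Ω, (⟪e, y⟫ + 0) ∂gauss N)
    refine ⟨_, hmk h2 (hcenter h1), fun h0 => ?_⟩
    have h3 := (Lp.eq_zero_iff_ae_eq_zero.1 h0)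
    refine not_ae_eq_const_affine hΩ hne he0 0 (⨍ y in Ω, (⟪e, y⟫ + 0) ∂gauss N) ?_
    filter_upwards [h3, h2.memLp.coeFn_toLp] with x hx hx'
    rw [hx] at hx'
    exact (sub_eq_zero.1 hx'.symm)
  obtain ⟨p, hpV, hp1, hmin, hEL⟩ := exists_rayleigh_minimizer (ι := Fin N → ℤ) V hVc (by
    intro ε hε
    obtain ⟨s, θ, hs⟩ := MemH1.compactness hΩ hΩc hne hε
    refine ⟨s, θ, fun p hp => ?_⟩
    have := hs _ _ ((hV p).1 hp).1
    simpa only [Lp.toLp_coeFn] using this) hex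
  have hp := (hV p).1 hpV
  have hp1' : ∫ x in Ω, ‖p.1 x‖ ^ 2 ∂gauss N = 1 := by
    rw [← norm_toLp_sq (Lp.memLp p.1), Lp.toLp_coeFn, hp1, one_pow]
  refine ⟨‖p.2‖ ^ 2, ⟨p.1, p.2, ⟨hp.1, fun φ H hφ => ?_⟩, ?_⟩, ?_⟩
  · have h2 := hφ.sub_const hΩ (⨍ y in Ω, φ y ∂gauss N)
    have h3 := hEL _ (hmk h2 (hcenter hφ))
    rw [← Lp.toLp_coeFn p.1 (Lp.memLp p.1), inner_toLp] at h3
    nth_rewrite 1 [← Lp.toLp_coeFn p.2 (Lp.memLp p.2)] at h3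
    rw [inner_toLp] at h3
    rw [h3]
    congr 1
    have i1 : Integrable (fun x => p.1 x * φ x) ((gauss N).restrict Ω) :=
      (Lp.memLp p.1).integrable_mul hφ.memLp
    have i2 : Integrable (fun x => p.1 x) ((gauss N).restrict Ω) :=
      (Lp.memLp p.1).integrable (by norm_num)
    have e1 : ∀ x, ⟪p.1 x, φ x - ⨍ y in Ω, φ y ∂gauss N⟫ =
        p.1 x * φ x - (⨍ y in Ω, φ y ∂gauss N) * p.1 x := fun x => by
      simp only [RCLike.inner_apply, conj_trivial]
      ring
    simp only [e1]
    rw [integral_sub i1 (i2.const_mul _), integral_const_mul, hp.2, mul_zero, sub_zero]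
  · rintro ⟨c, hc⟩
    have h1 : ∫ x in Ω, p.1 x ∂gauss N = c * ∫ _ in Ω, (1 : ℝ) ∂gauss N := by
      rw [← integral_const_mul]
      refine integral_congr_ae ?_
      filter_upwards [hc] with x hx
      rw [hx, mul_one]
    rw [hp.2] at h1
    have hc0 : c = 0 := by
      rcases mul_eq_zero.1 h1.symm with h | h
      · exact h
      · exact absurd h (integral_one_gauss_pos hΩ hne).ne'
    have h2 : ∫ x in Ω, ‖p.1 x‖ ^ 2 ∂gauss N = 0 := by
      rw [← integral_zero (EuclideanSpace ℝ (Fin N)) ℝ (μ := (gauss N).restrict Ω)]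
      refine integral_congr_ae ?_
      filter_upwards [hc] with x hx
      simp [hx, hc0]
    rw [hp1'] at h2
    exact one_ne_zero h2
  · rintro R ⟨ψ, G, h, hnz, hmean, rfl⟩
    have h1 := hmin _ (hmk h hmean)
    simp only [norm_toLp_sq] at h1
    simp only [Real.norm_eq_abs, sq_abs] at h1
    have i2 : Integrable (fun x => ψ x ^ 2) ((gauss N).restrict Ω) := h.memLp.integrable_sq
    have hpos : 0 < ∫ x in Ω, ψ x ^ 2 ∂gauss N := by
      refine lt_of_le_of_ne (integral_nonneg fun _ => sq_nonneg _) fun h0 => hnz ?_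
      have h2 := (integral_eq_zero_iff_of_nonneg (fun _ => sq_nonneg _) i2).1 h0.symm
      filter_upwards [h2] with x hx
      simpa using hx
    rwa [le_div_iff₀ hpos]

/-! ### Strips -/

theorem exists_ne_zero_inner_eq_zero {N : ℕ} (hN : 2 ≤ N) (e : EuclideanSpace ℝ (Fin N)) :
    ∃ f : EuclideanSpace ℝ (Fin N), f ≠ 0 ∧ ⟪e, f⟫ = 0 := by
  have h : (ℝ ∙ e)ᗮ ≠ ⊥ := by
    intro h
    rw [Submodule.orthogonal_eq_bot_iff] at h
    have h1 := finrank_span_le_card (R := ℝ) ({e} : Set (EuclideanSpace ℝ (Fin N)))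
    rw [h, finrank_top, finrank_euclideanSpace_fin] at h1
    simp at h1
    omega
  obtain ⟨f, hf, hf0⟩ := Submodule.exists_mem_ne_zero_of_ne_bot h
  exact ⟨f, hf0, Submodule.mem_orthogonal_singleton_iff_inner_right.1 hf⟩

theorem isOpen_strip {N : ℕ} (e : EuclideanSpace ℝ (Fin N)) (a b : ℝ) : IsOpen (strip e a b) :=
  (isOpen_Ioo (a := a) (b := b)).preimage (innerSL ℝ e).continuous

theorem convex_strip {N : ℕ} (e : EuclideanSpace ℝ (Fin N)) (a b : ℝ) :
    Convex ℝ (strip e a b) := by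
  have : strip e a b = innerSL ℝ e ⁻¹' Ioo a b := rfl
  rw [this]
  exact (convex_Ioo a b).linear_preimage (innerSL ℝ e).toLinearMap

theorem nonempty_strip {N : ℕ} {e : EuclideanSpace ℝ (Fin N)} {a b : ℝ} (he : ‖e‖ = 1)
    (hab : a < b) : (strip e a b).Nonempty := by
  refine ⟨((a + b) / 2) • e, ?_⟩
  simp only [strip, mem_ofPred_eq, real_inner_smul_right, real_inner_self_eq_norm_sq, he]
  constructor <;> linarith

/-- Smooth cutoffs on the line, supported in `(a, b)` and converging to `1` there. -/
theorem exists_cutoff_Ioo {a b : ℝ} (hab : a < b) : ∃ χ : ℕ → ℝ → ℝ,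
    (∀ n, ContDiff ℝ ∞ (χ n)) ∧ (∀ n s, |χ n s| ≤ 1) ∧
    (∀ n, ∃ K ⊆ Ioo a b, IsClosed K ∧ ∀ s ∉ K, χ n s = 0) ∧
    ∀ s ∈ Ioo a b, Tendsto (fun n => χ n s) atTop (𝓝 1) := by
  set L : ℝ := (b - a) / 2 with hL
  have hL0 : 0 < L := by rw [hL]; linarith
  have hn0 : ∀ n : ℕ, (0 : ℝ) ≤ n := fun n => n.cast_nonneg
  let χ : ℕ → ContDiffBump ((a + b) / 2) := fun n =>
    ⟨L * (1 - 1 / (n + 2)), L * (1 - 1 / (2 * (n + 2))), by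
      have : 1 / ((n : ℝ) + 2) < 1 := by
        rw [div_lt_one (by positivity)]
        linarith [hn0 n]
      exact mul_pos hL0 (by linarith), by
      refine mul_lt_mul_of_pos_left ?_ hL0
      have : 1 / (2 * ((n : ℝ) + 2)) < 1 / ((n : ℝ) + 2) :=
        one_div_lt_one_div_of_lt (by positivity) (by linarith [hn0 n])
      linarith⟩
  refine ⟨fun n => χ n, fun n => (χ n).contDiff, fun n s => ?_, fun n =>
    ⟨Metric.closedBall ((a + b) / 2) (χ n).rOut, fun s hs => ?_, Metric.isClosed_closedBall,
      fun s hs => ?_⟩, fun s hs => ?_⟩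
  · rw [abs_of_nonneg (χ n).nonneg]
    exact (χ n).le_one
  · have hr : (χ n).rOut < L := by
      have : 0 < 1 / (2 * ((n : ℝ) + 2)) := by positivity
      calc (χ n).rOut = L * (1 - 1 / (2 * (n + 2))) := rfl
        _ < L * 1 := mul_lt_mul_of_pos_left (by linarith) hL0
        _ = L := mul_one L
    rw [Metric.mem_closedBall, Real.dist_eq, abs_le] at hs
    constructor <;> linarith [hs.1, hs.2]
  · rw [Metric.mem_closedBall, not_le] at hs
    exact (χ n).zero_of_le_dist hs.le
  · have hd : dist s ((a + b) / 2) < L := by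
      rw [Real.dist_eq, abs_lt, hL]
      constructor <;> linarith [hs.1, hs.2]
    have hr : Tendsto (fun n => (χ n).rIn) atTop (𝓝 (L * (1 - 0))) := by
      refine (tendsto_const_nhds.sub ?_).const_mul L
      have := (tendsto_one_div_add_atTop_nhds_zero_nat (𝕜 := ℝ)).comp (tendsto_add_atTop_nat 1)
      refine this.congr fun n => ?_
      simp only [Function.comp_apply]
      push_cast
      ring_nf
    rw [sub_zero, mul_one] at hr
    refine tendsto_const_nhds.congr' ?_
    filter_upwards [hr.eventually_const_lt hd] with n hn
    exact ((χ n).one_of_mem_closedBall hn.le).symm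

/-- A smooth compactly supported function, equal to `1` at the origin, with bounded gradient. -/
theorem exists_cutoff_at_zero (N : ℕ) : ∃ (ψ : EuclideanSpace ℝ (Fin N) → ℝ) (C : ℝ),
    ContDiff ℝ ∞ ψ ∧ HasCompactSupport ψ ∧ (∀ x, |ψ x| ≤ 1) ∧ ψ 0 = 1 ∧
    ∀ x, ‖fderiv ℝ ψ x‖ ≤ C := by
  let ψ : ContDiffBump (0 : EuclideanSpace ℝ (Fin N)) := ⟨1, 2, one_pos, one_lt_two⟩
  have hψd : Continuous (fderiv ℝ ψ) := (ψ.contDiff (n := 1)).continuous_fderiv one_ne_zero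
  obtain ⟨C, hC⟩ := hψd.bounded_above_of_compact_support (ψ.hasCompactSupport.fderiv ℝ)
  refine ⟨ψ, C, ψ.contDiff, ψ.hasCompactSupport, fun x => ?_,
    ψ.one_of_mem_closedBall (Metric.mem_closedBall_self zero_le_one), hC⟩
  rw [abs_of_nonneg ψ.nonneg]
  exact ψ.le_one

/-- Gaussian integration by parts in a direction tangential to the strip: there is no boundary
contribution, since a cutoff in the transversal variable `⟪e, x⟫` has derivative zero along `f`. -/
theorem MemH1.integral_inner_eq_of_strip {N : ℕ} {e f : EuclideanSpace ℝ (Fin N)} {a b : ℝ}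
    (hab : a < b) (hef : ⟪e, f⟫ = 0) {φ : EuclideanSpace ℝ (Fin N) → ℝ}
    {H : EuclideanSpace ℝ (Fin N) → EuclideanSpace ℝ (Fin N)} (h : MemH1 (strip e a b) φ H) :
    ∫ x in strip e a b, ⟪f, H x⟫ ∂gauss N = ∫ x in strip e a b, ⟪f, x⟫ * φ x ∂gauss N := by
  have hΩ := isOpen_strip e a b
  set Ω := strip e a b with hΩdef
  -- a cutoff in the transversal variable, constant in the direction `f`
  obtain ⟨χ, hχ, hχ01, hχK, hχlim⟩ := exists_cutoff_Ioo hab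
  -- a cutoff at infinity
  obtain ⟨ψ, C, hψ, hψc0, hψ01, hψ0, hC⟩ := exists_cutoff_at_zero N
  have hψd : Continuous (fderiv ℝ ψ) := hψ.continuous_fderiv (by simp)
  have hC0 : 0 ≤ C := (norm_nonneg _).trans (hC 0)
  obtain ⟨t, ht0, ht1, htlim⟩ : ∃ t : ℕ → ℝ, (∀ n, 0 < t n) ∧ (∀ n, t n ≤ 1) ∧
      Tendsto t atTop (𝓝 0) :=
    ⟨fun n => 1 / ((n : ℝ) + 1), fun n => by positivity, fun n => by
      rw [div_le_one (by positivity)]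
      linarith [(Nat.cast_nonneg n : (0 : ℝ) ≤ n)], tendsto_one_div_add_atTop_nhds_zero_nat⟩
  let η : ℕ → EuclideanSpace ℝ (Fin N) → ℝ := fun n x =>
    χ n ⟪e, x⟫ * ψ (t n • x) * (gaussConst N * weight 1 0 x)
  have hη : ∀ n, ContDiff ℝ ∞ (η n) := fun n => by
    have h1 : ContDiff ℝ ∞ fun x : EuclideanSpace ℝ (Fin N) => χ n ⟪e, x⟫ :=
      (hχ n).comp (innerSL ℝ e).contDiff
    have h2 : ContDiff ℝ ∞ fun x : EuclideanSpace ℝ (Fin N) => ψ (t n • x) :=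
      hψ.comp ((contDiff_const_smul (t n)))
    exact (h1.mul h2).mul (contDiff_const.mul (contDiff_weight 1 0))
  have hηc : ∀ n, HasCompactSupport (η n) := by
    intro n
    have h1 : HasCompactSupport fun x : EuclideanSpace ℝ (Fin N) => ψ (t n • x) :=
      hψc0.comp_smul (ht0 n).ne'
    exact (h1.mul_left).mul_right
  have hηs : ∀ n, tsupport (η n) ⊆ Ω := by
    intro n
    obtain ⟨K, hK, hKc, hK0⟩ := hχK n
    have hsub : tsupport (η n) ⊆ innerSL ℝ e ⁻¹' K := by
      refine closure_minimal (fun x hx => ?_) (hKc.preimage (innerSL ℝ e).continuous)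
      by_contra hn
      have : χ n ⟪e, x⟫ = 0 := hK0 _ hn
      exact hx (by simp [η, this])
    exact hsub.trans fun x hx => hK hx
  have hηd : ∀ n x, fderiv ℝ (η n) x f =
      χ n ⟪e, x⟫ * (t n * fderiv ℝ ψ (t n • x) f - ψ (t n • x) * ⟪f, x⟫) *
        (gaussConst N * weight 1 0 x) := by
    intro n x
    have d1 : HasFDerivAt (fun x => χ n ⟪e, x⟫) _ x :=
      ((hχ n).differentiable (by simp) _).hasFDerivAt.comp x (innerSL ℝ e).hasFDerivAt
    have d2 : HasFDerivAt (fun x => ψ (t n • x)) _ x :=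
      (hψ.differentiable (by simp) _).hasFDerivAt.comp x
        ((hasFDerivAt_id x).const_smul (t n))
    have d3 : HasFDerivAt (fun x => gaussConst N * weight 1 0 x) _ x :=
      (((contDiff_weight (n := 1) 1 (0 : EuclideanSpace ℝ (Fin N))).differentiable
        one_ne_zero x).hasFDerivAt).const_mul (gaussConst N)
    have d4 : HasFDerivAt (η n) _ x := (d1.mul d2).mul d3
    rw [d4.fderiv]
    simp [fderiv_weight_apply, hef, real_inner_comm f x]
    ring
  have hparts : ∀ n, ∫ x in Ω, φ x * (χ n ⟪e, x⟫ *
      (t n * fderiv ℝ ψ (t n • x) f - ψ (t n • x) * ⟪f, x⟫)) ∂gauss N =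
      -∫ x in Ω, ⟪H x, f⟫ * (χ n ⟪e, x⟫ * ψ (t n • x)) ∂gauss N := by
    intro n
    have h1 := h.hasWeakGradient.integral_by_parts (η n) (hη n) (hηc n) (hηs n) f
    rw [setIntegral_gauss_eq_setIntegral hΩ.measurableSet,
      setIntegral_gauss_eq_setIntegral hΩ.measurableSet]
    simp only [hηd] at h1
    simpa only [η, mul_assoc] using h1
  have hψlim : ∀ x, Tendsto (fun n => ψ (t n • x)) atTop (𝓝 1) := by
    intro x
    have h1 : Tendsto (fun n => ψ (t n • x)) atTop (𝓝 (ψ ((0 : ℝ) • x))) :=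
      (hψ.continuous.tendsto _).comp (htlim.smul_const x)
    rwa [zero_smul, hψ0] at h1
  have hφ1 : Integrable φ ((gauss N).restrict Ω) := h.memLp.integrable (by norm_num)
  have hfx : MemLp (fun x => ⟪f, x⟫) 2 ((gauss N).restrict Ω) :=
    ((innerSL ℝ f).comp_memLp' (memLp_id_gauss N)).restrict Ω
  have hφx : Integrable (fun x => φ x * ⟪f, x⟫) ((gauss N).restrict Ω) :=
    h.memLp.integrable_mul hfx
  have hH : Integrable (fun x => ⟪H x, f⟫) ((gauss N).restrict Ω) :=
    (h.gradient_memLp.integrable (by norm_num)).inner_const f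
  have hχc : ∀ n, Continuous fun x : EuclideanSpace ℝ (Fin N) => χ n ⟪e, x⟫ := fun n =>
    (hχ n).continuous.comp (innerSL ℝ e).continuous
  have hψc : ∀ n, Continuous fun x : EuclideanSpace ℝ (Fin N) => ψ (t n • x) := fun n =>
    hψ.continuous.comp (by fun_prop)
  have hb : ∀ n x, |t n * fderiv ℝ ψ (t n • x) f| ≤ t n * (C * ‖f‖) := by
    intro n x
    rw [abs_mul, abs_of_pos (ht0 n)]
    have := ((fderiv ℝ ψ (t n • x)).le_opNorm f).trans
      (mul_le_mul_of_nonneg_right (hC _) (norm_nonneg f))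
    exact mul_le_mul_of_nonneg_left this (ht0 n).le
  have lim1 : Tendsto (fun n => ∫ x in Ω, φ x * (χ n ⟪e, x⟫ *
      (t n * fderiv ℝ ψ (t n • x) f - ψ (t n • x) * ⟪f, x⟫)) ∂gauss N) atTop
      (𝓝 (∫ x in Ω, φ x * (1 * (0 - 1 * ⟪f, x⟫)) ∂gauss N)) := by
    refine tendsto_integral_of_dominated_convergence
      (fun x => C * ‖f‖ * |φ x| + |φ x * ⟪f, x⟫|) (fun n => ?_)
      ((hφ1.abs.const_mul _).add hφx.abs) (fun n => ae_of_all _ fun x => ?_) ?_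
    · refine hφ1.1.mul ?_
      have hdc : Continuous fun x : EuclideanSpace ℝ (Fin N) => fderiv ℝ ψ (t n • x) f :=
        (hψd.comp (by fun_prop)).clm_apply continuous_const
      exact ((hχc n).mul ((continuous_const.mul hdc).sub
        ((hψc n).mul (innerSL ℝ f).continuous))).aestronglyMeasurable
    · rw [Real.norm_eq_abs, abs_mul, abs_mul, abs_mul]
      have h1 : |t n * fderiv ℝ ψ (t n • x) f - ψ (t n • x) * ⟪f, x⟫| ≤ C * ‖f‖ + |⟪f, x⟫| := by
        refine (abs_sub _ _).trans (add_le_add ((hb n x).trans ?_) ?_)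
        · exact mul_le_of_le_one_left (by positivity) (ht1 n)
        · rw [abs_mul]; exact mul_le_of_le_one_left (abs_nonneg _) (hψ01 _)
      calc _ ≤ |φ x| * (1 * (C * ‖f‖ + |⟪f, x⟫|)) := by
            gcongr
            exact hχ01 _ _
        _ = _ := by ring
    · filter_upwards [ae_restrict_mem hΩ.measurableSet] with x hx
      refine Tendsto.const_mul _ ((hχlim ⟪e, x⟫ hx).mul (Tendsto.sub ?_ ((hψlim x).mul_const _)))
      refine squeeze_zero_norm (fun n => hb n x) ?_
      simpa using htlim.mul_const (C * ‖f‖)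
  have lim2 : Tendsto (fun n => ∫ x in Ω, ⟪H x, f⟫ * (χ n ⟪e, x⟫ * ψ (t n • x)) ∂gauss N) atTop
      (𝓝 (∫ x in Ω, ⟪H x, f⟫ * (1 * 1) ∂gauss N)) := by
    refine tendsto_integral_of_dominated_convergence (fun x => |⟪H x, f⟫|) (fun n => ?_)
      hH.abs (fun n => ae_of_all _ fun x => ?_) ?_
    · exact hH.1.mul ((hχc n).mul (hψc n)).aestronglyMeasurable
    · rw [Real.norm_eq_abs, abs_mul, abs_mul]
      exact mul_le_of_le_one_right (abs_nonneg _)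
        (mul_le_one₀ (hχ01 _ _) (abs_nonneg _) (hψ01 _))
    · filter_upwards [ae_restrict_mem hΩ.measurableSet] with x hx
      exact ((hχlim ⟪e, x⟫ hx).mul (hψlim x)).const_mul _
  simp only [hparts] at lim1
  have huniq := tendsto_nhds_unique lim1 lim2.neg
  have e1 : ∀ x, φ x * (1 * (0 - 1 * ⟪f, x⟫)) = -(⟪f, x⟫ * φ x) := fun x => by ring
  simp only [e1, integral_neg, neg_inj, mul_one] at huniq
  rw [huniq]
  simp only [real_inner_comm]

end GaussNeumann

theorem theorem1p1 (N : ℕ) (hN : 2 ≤ N) :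
    (∀ Ω : Set (EuclideanSpace ℝ (Fin N)),
      Convex ℝ Ω → GaussNeumann.IsC2Domain Ω → GaussNeumann.UniformInteriorSphere Ω →
        -- the first nontrivial Neumann eigenvalue exists and is given by the Rayleigh principle
        IsLeast (GaussNeumann.nontrivialNeumannEigenvalues Ω) (GaussNeumann.mu1 Ω) ∧
        IsLeast (GaussNeumann.rayleighQuotients Ω) (GaussNeumann.mu1 Ω) ∧
        -- the lower bound
        1 ≤ GaussNeumann.mu1 Ω ∧
        -- the Poincaré-Wirtinger inequality
        ∀ u G, GaussNeumann.MemH1 Ω u G →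
          ∫ x in Ω, (u x - ⨍ y in Ω, u y ∂(GaussNeumann.gauss N)) ^ 2 ∂(GaussNeumann.gauss N) ≤
            ∫ x in Ω, ‖G x‖ ^ 2 ∂(GaussNeumann.gauss N)) ∧
    -- equality for strips
    (∀ (e : EuclideanSpace ℝ (Fin N)) (a b : ℝ), ‖e‖ = 1 → a < b →
      GaussNeumann.mu1 (GaussNeumann.strip e a b) = 1) := by
  refine ⟨fun Ω hconv hC _ => ?_, fun e a b he hab => ?_⟩
  · have hne := hC.isConnected.nonempty
    obtain ⟨lam, hlam, hle⟩ :=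
      GaussNeumann.exists_isLeast_eigenvalue hN hC.isOpen hconv hne
    have hsub :=
      GaussNeumann.nontrivialNeumannEigenvalues_subset_rayleighQuotients hC.isOpen hconv hne
    have hleast : IsLeast (GaussNeumann.nontrivialNeumannEigenvalues Ω) lam :=
      ⟨hlam, fun R hR => hle R (hsub hR)⟩
    have hmu : GaussNeumann.mu1 Ω = lam := hleast.csInf_eq
    rw [hmu]
    exact ⟨hleast, ⟨hsub hlam, fun R hR => hle R hR⟩,
      GaussNeumann.one_le_of_mem_rayleighQuotients hC.isOpen hconv hne (hsub hlam),
      fun u G h => h.integral_sub_average_sq_le hC.isOpen hconv hne⟩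
  · have hΩ := GaussNeumann.isOpen_strip e a b
    have hne := GaussNeumann.nonempty_strip he hab
    -- a linear function that varies only along the strip is an eigenfunction with eigenvalue `1`
    obtain ⟨f, hf0, hef⟩ := GaussNeumann.exists_ne_zero_inner_eq_zero hN e
    refine IsLeast.csInf_eq (a := 1)
      ⟨⟨fun x => ⟪f, x⟫ + 0, fun _ => f, ⟨GaussNeumann.memH1_affine hΩ f 0, fun φ H hφ => ?_⟩,
        fun ⟨c, hc⟩ => GaussNeumann.not_ae_eq_const_affine hΩ hne hf0 0 c hc⟩, fun R hR => ?_⟩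
    · simp only [add_zero, one_mul]
      exact hφ.integral_inner_eq_of_strip hab hef
    · exact GaussNeumann.one_le_of_mem_rayleighQuotients hΩ (GaussNeumann.convex_strip e a b) hne
        (GaussNeumann.nontrivialNeumannEigenvalues_subset_rayleighQuotients hΩ
          (GaussNeumann.convex_strip e a b) hne hR)
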